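/- **Setting.** Let $\mathcal S,\mathcal A$ be finite nonempty sets, $d\in\mathbb N$, $\gamma\in[0,1)$, $\lambda>0$, and let $\xi$ be a random context with law $\mathbb P_\xi$. For $x\in\mathbb R^d$ and each context $\xi$ let $\mathcal M_{x,\xi}$ be a Markov decision process on $\mathcal S,\mathcal A$ with rewards $r_{x,\xi}(s,a)$ and transition probabilities $P_{x,\xi}(s';s,a)$. For a policy $\pi$ put $H(\pi;s)=-\sum_a\pi(a;s)\log\pi(a;s)$ and $V^{\pi}_{x,\xi}(s)=\mathbb E^\pi_s\big[\sum_{t\ge0}\gamma^t(r_{x,\xi}(s_t,a_t)+\lambda H(\pi;s_t))\big]$. Let $\pi^*_{x,\xi}$ be the (unique) policy that maximizes $V^\pi_{x,\xi}(s)$ for all $s$ simultaneously. The leader has a loss $f(x,\pi,\xi)$ and the objective $F(x)=\mathbb E_\xi[f(x,\pi^*_{x,\xi},\xi)]$. **Assumptions.** $\|\cdot\|_\infty$ denotes the largest absolute value of an entry. (1) For all $\xi$, all $x_1,x_2$ and all $\pi_1,\pi_2$ in an open neighbourhood of the set of policies, on which $f$ is differentiable in $(x,\pi)$, one has $|f(x_1,\pi_1,\xi)-f(x_2,\pi_2,\xi)|\le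 L_f(\|x_1-x_2\|_\infty+\|\pi_1-\pi_2\|_\infty)$, and $\partial_xf$, $\partial_\pi f$ satisfy the same inequality in $\|\cdot\|_\infty$ with $S_f$ in place of $L_f$; $f(x,\pi,\cdot)$ is $\mathbb P_\xi$-integrable for every $x$ and every policy $\pi$. (2) $r$ and $P$ are differentiable in $x$, with $|r_{x,\xi}(s,a)|<\overline R$, $\|\partial_x r_{x,\xi}(s,a)\|_\infty<K_2$, and $\|\partial_x\log P_{x,\xi}(s';s,a)\|_\infty<K_1$ wherever $P_{x,\xi}(s';s,a)>0$. (3) $F$ is smooth and bounded below: $\|\nabla F(x)-\nabla F(y)\|_\infty\le S_F\|x-y\|_\infty$ for all $x,y$, and $F(x_0)-\inf F\le\Delta$, where $x_0$ is the initial point. (4) For all $x,\xi$ the oracle's random policy $\pi^o_{x,\xi}$ satisfies $\mathbb E_o\|\pi^*_{x,\xi}-\pi^o_{x,\xi}\|_\infty^2\le\delta^2$. **Algorithm (HPGD)** with step size $\alpha>0$ and a sampling distribution $\nu$ on $\mathcal S$ with $\nu\ge m>0$. In iteration $t=0,\dots,T-1$, independently of the past given $x_t$: draw $\xi\sim\mathbb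 P_\xi$, the oracle's policy $\pi=\pi^o_{x_t,\xi}$, $s\sim\nu$, $a\sim\pi(\cdot;s)$, independent $T_Q,T_V\sim\mathrm{Geo}(1-\gamma)$ and $T_Q',T_V'\sim\mathrm{Geo}(1-\sqrt\gamma)$ on $\{0,1,2,\dots\}$, and two independent trajectories of $\pi$ in $\mathcal M_{x_t,\xi}$, $\tau_Q$ started in $(s,a)$ and $\tau_V$ started in $s$. For a trajectory $\tau=(s_0,a_0,s_1,a_1,\dots)$ put $$G(\tau,T,T')=\sum_{i=0}^{T}\partial_x r_{x_t,\xi}(s_i,a_i)+\frac{\gamma}{1-\gamma}\,\partial_x\log P_{x_t,\xi}(s_{T+1};s_T,a_T)\sum_{i=T+1}^{T+T'+1}\gamma^{(i-T-1)/2}\big(r_{x_t,\xi}(s_i,a_i)+\lambda H(\pi;s_i)\big)$$ and set $$x_{t+1}=x_t-\alpha\Big(\partial_xf(x_t,\pi,\xi)+\frac{1}{\lambda\nu(s)}\frac{\partial f(x_t,\pi,\xi)}{\partial\pi(a;s)}\big(G(\tau_Q,T_Q,T_Q')-G(\tau_V,T_V,T_V')\big)\Big).$$ The output $\hat x_T$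 is uniform on $\{x_0,\dots,x_{T-1}\}$, chosen independently of the iterates. **Theorem.** $F$ is differentiable, and there is a constant $C$, depending only on $\mathcal S,\mathcal A,d,\gamma,\lambda,m,L_f,S_f,\overline R,K_1,K_2,S_F,\Delta$, such that for all $T\ge1$, $\delta\ge0$ and $0<\alpha\le 1/(2S_f)$ (any $\alpha>0$ if $S_f=0$) $$\mathbb E\|\nabla F(\hat x_T)\|^2\le C\Big(\frac1{\alpha T}+\delta+\alpha\Big),$$ with the Euclidean norm on the left. In particular, if $c_1/\sqrt T\le\alpha\le c_2/\sqrt T$ with $c_1>0$ and $\delta\le c_3/\sqrt T$, then $\mathbb E\|\nabla F(\hat x_T)\|^2\le C\,(1/c_1+c_2+c_3)/\sqrt T$. -/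

import Mathlib

open MeasureTheory ProbabilityTheory

noncomputable section

namespace HPGD

/-- The vector of partial derivatives `(∂₁ g, …, ∂_d g)` of `g` at `x`. -/
def grad {d : ℕ} (g : (Fin d → ℝ) → ℝ) (x : Fin d → ℝ) : Fin d → ℝ :=
  fun i => fderiv ℝ g x (Pi.single i 1)

section FiniteMDP

variable {S A : Type*} [Fintype S] [DecidableEq S] [Fintype A] [DecidableEq A]

/-- The array of partial derivatives `∂ g / ∂ π(a; s)` of `g` at `π`. -/
def gradPi (g : (S → A → ℝ) → ℝ) (π : S → A → ℝ) : S → A → ℝ :=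
  fun s a => fderiv ℝ g π (Pi.single s (Pi.single a 1))

variable (S A) in
/-- Stochastic stationary policies; `π.1 s a` is the probability `π(a; s)`. -/
abbrev Policy := {π : S → A → ℝ // ∀ s, π s ∈ stdSimplex ℝ A}

instance [Nonempty A] : Nonempty (Policy S A) :=
  ⟨⟨fun _ => Pi.single (Classical.arbitrary A) 1,
    fun _ => single_mem_stdSimplex ℝ (Classical.arbitrary A)⟩⟩

variable (S A) in
/-- Rewards, transition kernel (`P s a s'` is `P(s'; s, a)`) and initial distribution. -/
structure MDP where
  r : S → A → ℝ
  P : S → A → S → ℝ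
  P_mem : ∀ s a, P s a ∈ stdSimplex ℝ S
  μ₀ : S → ℝ
  μ₀_mem : μ₀ ∈ stdSimplex ℝ S

/-- The entropy `H(π; s) = - ∑ₐ π(a; s) log π(a; s)`. -/
def entropy (π : Policy S A) (s : S) : ℝ := -∑ a, π.1 s a * Real.log (π.1 s a)

namespace MDP

variable (m : MDP S A)

/-- Probability that the chain driven by `π`, started in `s`, is in state `s'` at time `t`. -/
def stateProb (π : Policy S A) (s : S) : ℕ → S → ℝ
  | 0, s' => if s' = s then 1 else 0
  | t + 1, s' => ∑ u, stateProb π s t u * ∑ a, π.1 u a * m.P u a s'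

/-- Entropy-regularized discounted value
`V(s) = E_s [∑ₜ γᵗ (r(sₜ, aₜ) + lam H(π; sₜ))]`. -/
def value (γ lam : ℝ) (π : Policy S A) (s : S) : ℝ :=
  ∑' t : ℕ, γ ^ t * ∑ s', m.stateProb π s t s' *
    ∑ a, π.1 s' a * (m.r s' a + lam * entropy π s')

/-- The objective of the follower, `J(π) = E_{s₀ ∼ μ₀} [V(s₀)]`. -/
def objective (γ lam : ℝ) (π : Policy S A) : ℝ :=
  ∑ s, m.μ₀ s * m.value γ lam π s

/-- `π` is optimal from every initial state. Such a policy maximizes the objective for every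
initial distribution, and asking it for all states removes the ambiguity at states that `μ₀`
does not charge. -/
def IsOptimal (γ lam : ℝ) (π : Policy S A) : Prop :=
  ∀ (π' : Policy S A) (s : S), m.value γ lam π' s ≤ m.value γ lam π s

theorem IsOptimal.objective_le {m : MDP S A} {γ lam : ℝ} {π : Policy S A}
    (h : m.IsOptimal γ lam π) (π' : Policy S A) :
    m.objective γ lam π' ≤ m.objective γ lam π :=
  Finset.sum_le_sum fun s _ => mul_le_mul_of_nonneg_left (h π' s) (m.μ₀_mem.1 s)

/-- The optimal policy of the entropy-regularized problem. -/
def optPolicy [Nonempty A] (γ lam : ℝ) : Policy S A :=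
  Classical.epsilon (m.IsOptimal γ lam)

/-- Probability that a trajectory of `π` with first state-action pair `p 0` continues with
`p 1, …, p n`. -/
def contProb (π : Policy S A) (p : ℕ → S × A) (n : ℕ) : ℝ :=
  ∏ i ∈ Finset.range n,
    m.P (p i).1 (p i).2 (p (i + 1)).1 * π.1 (p (i + 1)).1 (p (i + 1)).2

/-- Probability of the initial segment `p 0, …, p n` for a trajectory started in `(s, a)`. -/
def pathProbFromPair (π : Policy S A) (s : S) (a : A) (p : ℕ → S × A) (n : ℕ) : ℝ :=
  (if p 0 = (s, a) then 1 else 0) * m.contProb π p n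

/-- Probability of the initial segment `p 0, …, p n` for a trajectory started in `s`. -/
def pathProbFromState (π : Policy S A) (s : S) (p : ℕ → S × A) (n : ℕ) : ℝ :=
  (if (p 0).1 = s then π.1 s (p 0).2 else 0) * m.contProb π p n

end MDP

/-- Weight of `k` under the law of the number of failures before the first success with failure
probability `q`, that is, `Geo(1 - q)` on `{0, 1, 2, …}`. -/
def geoWeight (q : ℝ) (k : ℕ) : ℝ := (1 - q) * q ^ k

variable {d : ℕ} {Ξ : Type*}

/-- The rollout estimator of the derivative of the (action-)value function, with random
horizons `T`, `T'` and trajectory `p`; it reads only `p 0, …, p (T + T' + 1)`. -/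
def rolloutEst (M : (Fin d → ℝ) → Ξ → MDP S A) (γ lam : ℝ) (x : Fin d → ℝ) (ξ : Ξ)
    (π : Policy S A) (T T' : ℕ) (p : ℕ → S × A) : Fin d → ℝ :=
  (∑ t ∈ Finset.range (T + 1), grad (fun y => (M y ξ).r (p t).1 (p t).2) x) +
  (γ / (1 - γ) * ∑ t ∈ Finset.Icc (T + 1) (T + T' + 1),
      (Real.sqrt γ) ^ (t - (T + 1)) *
        ((M x ξ).r (p t).1 (p t).2 + lam * entropy π (p t).1)) •
    grad (fun y => Real.log ((M y ξ).P (p T).1 (p T).2 (p (T + 1)).1)) x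

variable (S A) in
/-- The discrete random quantities that the leader draws in one iteration: the pair `(s, a)`,
the horizons and the two trajectories. -/
structure Draw where
  s : S
  a : A
  TQ : ℕ
  TV : ℕ
  TQ' : ℕ
  TV' : ℕ
  pQ : ℕ → S × A
  pV : ℕ → S × A

/-- The estimator of the hypergradient. -/
def hyperGradEst (M : (Fin d → ℝ) → Ξ → MDP S A) (f : (Fin d → ℝ) → (S → A → ℝ) → Ξ → ℝ)
    (γ lam : ℝ) (ν : S → ℝ) (x : Fin d → ℝ) (ξ : Ξ) (π : Policy S A) (z : Draw S A) :
    Fin d → ℝ :=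
  grad (fun y => f y π.1 ξ) x +
  (1 / (lam * ν z.s) * gradPi (fun ρ => f x ρ ξ) π.1 z.s z.a) •
    (rolloutEst M γ lam x ξ π z.TQ z.TQ' z.pQ - rolloutEst M γ lam x ξ π z.TV z.TV' z.pV)

/-- Conditional probability, given `(x, ξ, π)`, that the draw of an iteration has the same
`s, a, TQ, TV, TQ', TV'` as `z` and trajectories that agree with those of `z` up to time `n`. -/
def drawProb (m : MDP S A) (γ : ℝ) (ν : S → ℝ) (π : Policy S A) (z : Draw S A) (n : ℕ) : ℝ :=
  ν z.s * π.1 z.s z.a *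
  (geoWeight γ z.TQ * geoWeight γ z.TV) *
  (geoWeight (Real.sqrt γ) z.TQ' * geoWeight (Real.sqrt γ) z.TV') *
  m.pathProbFromPair π z.s z.a z.pQ n * m.pathProbFromState π z.s z.pV n

/-- Two draws agree, as far as trajectories are concerned up to time `n`. -/
def Draw.Agree (n : ℕ) (z w : Draw S A) : Prop :=
  z.s = w.s ∧ z.a = w.a ∧ z.TQ = w.TQ ∧ z.TV = w.TV ∧ z.TQ' = w.TQ' ∧ z.TV' = w.TV' ∧
    (∀ i ≤ n, z.pQ i = w.pQ i) ∧ (∀ i ≤ n, z.pV i = w.pV i)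

/-- The regularity assumptions on the leader's loss `f` and on the contextual MDP `M`. All norms
are entrywise maxima. Derivatives in `π` need `f` on an open set `U` around the policies. -/
structure Regular [MeasurableSpace Ξ] (M : (Fin d → ℝ) → Ξ → MDP S A)
    (f : (Fin d → ℝ) → (S → A → ℝ) → Ξ → ℝ) (Pξ : Measure Ξ) (U : Set (S → A → ℝ))
    (Lf Sf R K₁ K₂ : ℝ) : Prop where
  isOpen_U : IsOpen U
  policy_mem : ∀ π : Policy S A, π.1 ∈ U
  f_diff : ∀ ξ x, ∀ π ∈ U,
    DifferentiableAt ℝ (fun q : (Fin d → ℝ) × (S → A → ℝ) => f q.1 q.2 ξ) (x, π)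
  f_lip : ∀ ξ x₁ x₂, ∀ π₁ ∈ U, ∀ π₂ ∈ U,
    |f x₁ π₁ ξ - f x₂ π₂ ξ| ≤ Lf * (‖x₁ - x₂‖ + ‖π₁ - π₂‖)
  f_smooth_x : ∀ ξ x₁ x₂, ∀ π₁ ∈ U, ∀ π₂ ∈ U,
    ‖grad (fun y => f y π₁ ξ) x₁ - grad (fun y => f y π₂ ξ) x₂‖
      ≤ Sf * (‖x₁ - x₂‖ + ‖π₁ - π₂‖)
  f_smooth_pi : ∀ ξ x₁ x₂, ∀ π₁ ∈ U, ∀ π₂ ∈ U,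
    ‖gradPi (fun ρ => f x₁ ρ ξ) π₁ - gradPi (fun ρ => f x₂ ρ ξ) π₂‖
      ≤ Sf * (‖x₁ - x₂‖ + ‖π₁ - π₂‖)
  r_bound : ∀ x ξ s a, |(M x ξ).r s a| < R
  r_diff : ∀ ξ s a, Differentiable ℝ (fun x => (M x ξ).r s a)
  r_grad : ∀ x ξ s a, ‖grad (fun y => (M y ξ).r s a) x‖ < K₂
  P_diff : ∀ ξ s a s', Differentiable ℝ (fun x => (M x ξ).P s a s')
  P_grad : ∀ x ξ s a s', 0 < (M x ξ).P s a s' →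
    ‖grad (fun y => Real.log ((M y ξ).P s a s')) x‖ < K₁
  r_meas : ∀ x s a, Measurable fun ξ => (M x ξ).r s a
  P_meas : ∀ x s a s', Measurable fun ξ => (M x ξ).P s a s'
  f_meas : ∀ x, ∀ π ∈ U, Measurable fun ξ => f x π ξ
  f_int : ∀ x (π : Policy S A), Integrable (fun ξ => f x π.1 ξ) Pξ

/-- The objective of the leader, `F(x) = E_ξ [f(x, π*_{x,ξ}, ξ)]`. -/
def leaderObj [Nonempty A] [MeasurableSpace Ξ] (M : (Fin d → ℝ) → Ξ → MDP S A)
    (f : (Fin d → ℝ) → (S → A → ℝ) → Ξ → ℝ) (γ lam : ℝ) (Pξ : Measure Ξ)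
    (x : Fin d → ℝ) : ℝ :=
  ∫ ξ, f x ((M x ξ).optPolicy γ lam).1 ξ ∂Pξ

/-- The follower's (random) policy is `δ`-close to optimal in mean square:
`E_o ‖π*_{x,ξ} - π^o_{x,ξ}‖∞² ≤ δ²` for all `x, ξ`. -/
def OracleAccuracy [Nonempty A] [MeasurableSpace Ξ] (M : (Fin d → ℝ) → Ξ → MDP S A)
    (γ lam : ℝ) (O : Kernel ((Fin d → ℝ) × Ξ) (Policy S A)) (δ : ℝ) : Prop :=
  ∀ x ξ, ∫ π, ‖((M x ξ).optPolicy γ lam).1 - π.1‖ ^ 2 ∂(O (x, ξ)) ≤ δ ^ 2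

/-- A run of `T` iterations of the algorithm with step size `α`, initial point `x₀` and trajectory
oracle `O`, on a probability space `(Ω, μ)`. At iteration `t`, given the past, a fresh context
`ξ t` is drawn from `Pξ`; then the follower's policy `πo t` is drawn from the oracle at
`(X t, ξ t)`; then `z t` is drawn according to `drawProb`. The index `τ` of the output is uniform
and independent of the iterates. -/
structure IsRun [MeasurableSpace Ξ] [MeasurableSpace S] [MeasurableSpace A]
    (M : (Fin d → ℝ) → Ξ → MDP S A) (f : (Fin d → ℝ) → (S → A → ℝ) → Ξ → ℝ)
    (γ lam : ℝ) (ν : S → ℝ) (Pξ : Measure Ξ)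
    (O : Kernel ((Fin d → ℝ) × Ξ) (Policy S A)) (α : ℝ) (x₀ : Fin d → ℝ) (T : ℕ)
    {Ω : Type*} {mΩ : MeasurableSpace Ω} (μ : Measure Ω) (ℱ : Filtration ℕ mΩ)
    (X : ℕ → Ω → Fin d → ℝ) (ξ : ℕ → Ω → Ξ) (πo : ℕ → Ω → Policy S A)
    (z : ℕ → Ω → Draw S A) (τ : Ω → ℕ) : Prop where
  X_meas : ∀ t, Measurable[ℱ t] (X t)
  ξ_meas : ∀ t, Measurable (ξ t)
  πo_meas : ∀ t, Measurable (πo t)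
  s_meas : ∀ t, Measurable fun ω => (z t ω).s
  a_meas : ∀ t, Measurable fun ω => (z t ω).a
  TQ_meas : ∀ t, Measurable fun ω => (z t ω).TQ
  TV_meas : ∀ t, Measurable fun ω => (z t ω).TV
  TQ'_meas : ∀ t, Measurable fun ω => (z t ω).TQ'
  TV'_meas : ∀ t, Measurable fun ω => (z t ω).TV'
  pQ_meas : ∀ t, Measurable fun ω => (z t ω).pQ
  pV_meas : ∀ t, Measurable fun ω => (z t ω).pV
  X_zero : ∀ ω, X 0 ω = x₀
  X_succ : ∀ t < T, ∀ ω, X (t + 1) ω =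
    X t ω - α • hyperGradEst M f γ lam ν (X t ω) (ξ t ω) (πo t ω) (z t ω)
  ξ_law : ∀ t < T, ∀ E, MeasurableSet[ℱ t] E → ∀ B : Set Ξ, MeasurableSet B →
    μ (E ∩ ξ t ⁻¹' B) = μ E * Pξ B
  πo_law : ∀ t < T, ∀ E, MeasurableSet[ℱ t ⊔ MeasurableSpace.comap (ξ t) inferInstance] E →
    ∀ B : Set (Policy S A), MeasurableSet B →
      μ (E ∩ πo t ⁻¹' B) = ∫⁻ ω in E, O (X t ω, ξ t ω) B ∂μ
  z_law : ∀ t < T, ∀ E,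
    MeasurableSet[(ℱ t ⊔ MeasurableSpace.comap (ξ t) inferInstance) ⊔
      MeasurableSpace.comap (πo t) inferInstance] E →
    ∀ (w : Draw S A) (n : ℕ), μ (E ∩ {ω | (z t ω).Agree n w}) =
      ∫⁻ ω in E, ENNReal.ofReal (drawProb (M (X t ω) (ξ t ω)) γ ν (πo t ω) w n) ∂μ
  τ_meas : Measurable τ
  τ_unif : ∀ t < T, μ (τ ⁻¹' {t}) = (T : ENNReal)⁻¹
  τ_indep : IndepFun τ (fun ω (t : Fin T) => X t ω) μ

end FiniteMDP

end HPGD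

end

/-! The method is stochastic gradient descent with a biased gradient. Three facts give the rate: a
formula for the gradient of $F$, a bias of order $\delta$, and a second moment of the estimator
bounded independently of the iterate.

Gradient formula. By the Gibbs variational principle the optimal policy is the softmax of the fixed
point `optQ` of the soft Bellman operator, a $\gamma$-contraction in the sup norm
(`isOptimal_softmaxPolicy`, `optPolicy_eq`). Rewards and transitions are only differentiable, not
continuously so; still the fixed point of a contraction is differentiable in the parameter
(`differentiableAt_fixedPoint`). The derivative of log-sum-exp is the softmax average, so an
envelope effect appears: $\partial_x Q^*$ solves the linear Bellman equation of the optimal policy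
held fixed (`fderiv_optQ`). Differentiating the softmax then gives
$\partial_x\pi^*(a;s)=\lambda^{-1}\pi^*(a;s)\big(\partial_xQ^*(s,a)-\sum_b\pi^*(b;s)\,\partial_xQ^*(s,b)\big)$.
The chain rule and differentiation under the integral express $\nabla F$ as the mean of `hyperGrad`
at the optimal policy (`hasFDerivAt_leaderObj`).

Bias. `hyperGrad` makes sense for every policy. At the oracle's policy it is the conditional mean of
the estimator: $P(T\ge t)=\gamma^t$ for the geometric horizon turns truncated sums into discounted
ones, and the factors $\sqrt\gamma^{\,j}$ in the estimator combine with $P(T'\ge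
j)=\sqrt\gamma^{\,j}$ into $\gamma^j$ (`Regular.tsum_rolloutWeight_mul_rolloutEst`). Moreover
`hyperGrad` is Lipschitz at the optimal policy (`Regular.abs_hyperGrad_sub_le`). Entropy is not
Lipschitz at the boundary of the simplex, but the optimal policy has an explicit positive lower
bound, and one of the two compared policies being interior is enough. Thus the bias is $O(\delta)$.

Second moment. The weights $\sqrt\gamma^{\,j}$ make the second part of a rollout bounded whatever
$T'$ is, so the estimator grows only linearly in $T_Q$ and $T_V$, whose second moments are finite
(`IsRun.integral_sq_hyperGradEst_le`).

Conditional expectations given the past are handled by testing against bounded functions $c(x_t)$;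
the needed one is $c=\partial_iF$. The smoothness inequality for $F$, integrated and summed over the
iterations, telescopes to the bound for the average of $\mathbb E\|\nabla F(x_t)\|^2$
(`sum_integral_sq_grad_le`), and the uniform independent output index converts this average into the
expectation at the output. -/

set_option linter.unusedSectionVars false

noncomputable section

namespace HPGD

/-! ### Discounted sums along a finite Markov chain and their Bellman equation. -/

section StochasticKernel

variable {Y : Type*} [Fintype Y]

/-- The action `(K g)(y) = ∑ y', K y y' g(y')` of a kernel on functions. -/
def avg (K : Y → Y → ℝ) (g : Y → ℝ) : Y → ℝ := fun y => ∑ y', K y y' * g y'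

/-- The discounted sum `∑ₜ γᵗ Kᵗ g`. -/
def resolvent (γ : ℝ) (K : Y → Y → ℝ) (g : Y → ℝ) : Y → ℝ :=
  fun y => ∑' t : ℕ, γ ^ t * ((avg K)^[t] g) y

theorem abs_sum_simplex_mul_le {w g : Y → ℝ} (hw : w ∈ stdSimplex ℝ Y) {b : ℝ}
    (hg : ∀ y, |g y| ≤ b) : |∑ y, w y * g y| ≤ b := by
  calc |∑ y, w y * g y| ≤ ∑ y, |w y * g y| := Finset.abs_sum_le_sum_abs _ _
    _ ≤ ∑ y, w y * b := Finset.sum_le_sum fun y _ => by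
        rw [abs_mul, abs_of_nonneg (hw.1 y)]
        exact mul_le_mul_of_nonneg_left (hg y) (hw.1 y)
    _ = b := by rw [← Finset.sum_mul, hw.2, one_mul]

theorem sum_simplex_mul_le {w g : Y → ℝ} (hw : w ∈ stdSimplex ℝ Y) {b : ℝ}
    (hg : ∀ y, g y ≤ b) : ∑ y, w y * g y ≤ b := by
  calc ∑ y, w y * g y ≤ ∑ y, w y * b :=
        Finset.sum_le_sum fun y _ => mul_le_mul_of_nonneg_left (hg y) (hw.1 y)
    _ = b := by rw [← Finset.sum_mul, hw.2, one_mul]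

variable {K : Y → Y → ℝ} {γ b : ℝ} {g : Y → ℝ}

theorem abs_avg_le (hK : ∀ y, K y ∈ stdSimplex ℝ Y) (hg : ∀ y, |g y| ≤ b) (y : Y) :
    |avg K g y| ≤ b :=
  abs_sum_simplex_mul_le (hK y) hg

theorem abs_iterate_avg_le (hK : ∀ y, K y ∈ stdSimplex ℝ Y) (hg : ∀ y, |g y| ≤ b) (t : ℕ)
    (y : Y) : |((avg K)^[t] g) y| ≤ b := by
  induction t generalizing y with
  | zero => exact hg y
  | succ t ih => rw [Function.iterate_succ_apply']; exact abs_avg_le hK ih y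

theorem exists_abs_bound (g : Y → ℝ) : ∃ b, ∀ y, |g y| ≤ b :=
  ⟨∑ y, |g y|, fun y =>
    Finset.single_le_sum (f := fun y => |g y|) (fun _ _ => abs_nonneg _) (Finset.mem_univ y)⟩

theorem summable_pow_mul_of_bounded (hγ : 0 ≤ γ) (hγ1 : γ < 1) {a : ℕ → ℝ}
    (ha : ∀ t, |a t| ≤ b) : Summable fun t => γ ^ t * a t := by
  refine Summable.of_norm_bounded ((summable_geometric_of_lt_one hγ hγ1).mul_right b) fun t => ?_
  rw [Real.norm_eq_abs, abs_mul, abs_of_nonneg (pow_nonneg hγ t)]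
  exact mul_le_mul_of_nonneg_left (ha t) (pow_nonneg hγ t)

theorem summable_resolvent (hγ : 0 ≤ γ) (hγ1 : γ < 1) (hK : ∀ y, K y ∈ stdSimplex ℝ Y)
    (g : Y → ℝ) (y : Y) : Summable fun t : ℕ => γ ^ t * ((avg K)^[t] g) y := by
  obtain ⟨b, hb⟩ := exists_abs_bound g
  exact summable_pow_mul_of_bounded hγ hγ1 fun t => abs_iterate_avg_le hK hb t y

/-- The Bellman equation of a discounted sum. -/
theorem resolvent_eq (hγ : 0 ≤ γ) (hγ1 : γ < 1) (hK : ∀ y, K y ∈ stdSimplex ℝ Y)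
    (g : Y → ℝ) (y : Y) : resolvent γ K g y = g y + γ * avg K (resolvent γ K g) y := by
  unfold resolvent
  rw [(summable_resolvent hγ hγ1 hK g y).tsum_eq_zero_add]
  congr 1
  · simp
  · simp only [avg]
    have h : ∀ y', K y y' * ∑' t : ℕ, γ ^ t * ((avg K)^[t] g) y' =
        ∑' t : ℕ, K y y' * (γ ^ t * ((avg K)^[t] g) y') := fun y' => tsum_mul_left.symm
    simp_rw [h]
    rw [← Summable.tsum_finsetSum
      fun y' _ => (summable_resolvent hγ hγ1 hK g y').mul_left (K y y'), ← tsum_mul_left]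
    refine tsum_congr fun t => ?_
    rw [Function.iterate_succ_apply', Finset.mul_sum, avg, Finset.mul_sum]
    refine Finset.sum_congr rfl fun y' _ => ?_
    rw [pow_succ]
    ring

/-- Maximum principle: at a maximum point of `e` the average of `e` does not exceed `e`, so
$(1-\gamma)\max e\le b$. -/
theorem le_of_le_add_avg (hγ : 0 ≤ γ) (hγ1 : γ < 1) (hK : ∀ y, K y ∈ stdSimplex ℝ Y)
    {e : Y → ℝ} (h : ∀ y, e y ≤ b + γ * avg K e y) (y : Y) : e y ≤ b / (1 - γ) := by
  obtain ⟨y₀, -, h₀⟩ := Finset.exists_max_image Finset.univ e ⟨y, Finset.mem_univ y⟩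
  have h₁ : avg K e y₀ ≤ e y₀ := sum_simplex_mul_le (hK y₀) fun y' => h₀ y' (Finset.mem_univ y')
  have h₂ := mul_le_mul_of_nonneg_left h₁ hγ
  rw [le_div_iff₀ (by linarith)]
  have h₃ := h₀ y (Finset.mem_univ y)
  have h₄ := h y₀
  have := mul_le_mul_of_nonneg_right h₃ (by linarith : 0 ≤ 1 - γ)
  linarith

theorem abs_le_of_eq_add_avg (hγ : 0 ≤ γ) (hγ1 : γ < 1) (hK : ∀ y, K y ∈ stdSimplex ℝ Y)
    {e c : Y → ℝ} (h : ∀ y, e y = c y + γ * avg K e y) (hc : ∀ y, |c y| ≤ b) (y : Y) :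
    |e y| ≤ b / (1 - γ) := by
  refine abs_le'.2 ⟨le_of_le_add_avg hγ hγ1 hK (fun y => ?_) y,
    le_of_le_add_avg (e := fun y => -e y) hγ hγ1 hK (fun y => ?_) y⟩
  · linarith [h y, (abs_le.1 (hc y)).2]
  · have : avg K (fun y => -e y) y = - avg K e y := by simp [avg]
    rw [this]
    linarith [h y, (abs_le.1 (hc y)).1]

/-- The difference of two solutions solves the homogeneous equation, where the maximum principle
applies with bound zero. This is the tool for identifying action values and their derivatives
without expanding series. -/
theorem eq_resolvent_of_eq_add_avg (hγ : 0 ≤ γ) (hγ1 : γ < 1) (hK : ∀ y, K y ∈ stdSimplex ℝ Y)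
    {e : Y → ℝ} (h : ∀ y, e y = g y + γ * avg K e y) : e = resolvent γ K g := by
  funext y
  have := abs_le_of_eq_add_avg (b := 0) (c := 0) hγ hγ1 hK
    (e := fun y => e y - resolvent γ K g y) (fun y => ?_) (by simp) y
  · rw [zero_div] at this
    exact sub_eq_zero.1 (abs_eq_zero.1 (le_antisymm this (abs_nonneg _)))
  · have h₁ : avg K (fun y => e y - resolvent γ K g y) y
        = avg K e y - avg K (resolvent γ K g) y := by
      simp [avg, mul_sub, Finset.sum_sub_distrib]
    rw [h₁]
    have h₂ := h y
    have h₃ := resolvent_eq hγ hγ1 hK g y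
    simp only [Pi.zero_apply]
    linarith

theorem abs_resolvent_le (hγ : 0 ≤ γ) (hγ1 : γ < 1) (hK : ∀ y, K y ∈ stdSimplex ℝ Y)
    (hg : ∀ y, |g y| ≤ b) (y : Y) : |resolvent γ K g y| ≤ b / (1 - γ) :=
  abs_le_of_eq_add_avg hγ hγ1 hK (resolvent_eq hγ hγ1 hK g) hg y

/-- Discounted sums depend in a Lipschitz way on the kernel and on the summand. -/
theorem abs_resolvent_sub_le (hγ : 0 ≤ γ) (hγ1 : γ < 1) {K' : Y → Y → ℝ} {g' : Y → ℝ}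
    (hK : ∀ y, K y ∈ stdSimplex ℝ Y) (hK' : ∀ y, K' y ∈ stdSimplex ℝ Y) {b₁ b₂ : ℝ}
    (hg : ∀ y, |g y - g' y| ≤ b₁)
    (hKK : ∀ y, |avg K (resolvent γ K' g') y - avg K' (resolvent γ K' g') y| ≤ b₂) (y : Y) :
    |resolvent γ K g y - resolvent γ K' g' y| ≤ (b₁ + b₂) / (1 - γ) := by
  -- Subtracting the two Bellman equations gives one for the difference, with kernel `K` and source
  -- $(g-g')+\gamma(K-K')R'$. The kernel difference acts only on the primed resolvent $R'$, so
  -- regularity is needed at one of the two data sets only.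
  refine abs_le_of_eq_add_avg hγ hγ1 hK (e := fun y => resolvent γ K g y - resolvent γ K' g' y)
    (c := fun y => (g y - g' y) +
      γ * (avg K (resolvent γ K' g') y - avg K' (resolvent γ K' g') y)) (fun y => ?_)
    (fun y => ?_) y
  · have h₁ : avg K (fun y => resolvent γ K g y - resolvent γ K' g' y) y
        = avg K (resolvent γ K g) y - avg K (resolvent γ K' g') y := by
      simp [avg, mul_sub, Finset.sum_sub_distrib]
    rw [h₁]
    have h₂ := resolvent_eq hγ hγ1 hK g y
    have h₃ := resolvent_eq hγ hγ1 hK' g' y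
    linarith
  · refine (abs_add_le _ _).trans (add_le_add (hg y) ?_)
    rw [abs_mul, abs_of_nonneg hγ]
    have := hKK y
    have h0 := abs_nonneg (avg K (resolvent γ K' g') y - avg K' (resolvent γ K' g') y)
    nlinarith

end StochasticKernel

/-! ### Geometric horizons. -/

section Geometric

variable {q b : ℝ}

theorem geoWeight_nonneg (hq : 0 ≤ q) (hq1 : q < 1) (k : ℕ) : 0 ≤ geoWeight q k :=
  mul_nonneg (by linarith) (pow_nonneg hq k)

theorem hasSum_geoWeight (hq : 0 ≤ q) (hq1 : q < 1) : HasSum (geoWeight q) 1 := by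
  have := (hasSum_geometric_of_lt_one hq hq1).mul_left (1 - q)
  rwa [mul_inv_cancel₀ (by linarith)] at this

/-- A sum up to a geometric horizon is, in the mean, a discounted sum. -/
theorem hasSum_geoWeight_mul_sum_range (hq : 0 ≤ q) (hq1 : q < 1) {a : ℕ → ℝ}
    (ha : ∀ t, |a t| ≤ b) :
    HasSum (fun T => geoWeight q T * ∑ i ∈ Finset.range (T + 1), a i) (∑' i, q ^ i * a i) := by
  have h₁ : Summable fun i => ‖q ^ i * a i‖ := (summable_pow_mul_of_bounded hq hq1 ha).norm
  have h₂ : Summable fun i => ‖q ^ i‖ := (summable_geometric_of_lt_one hq hq1).norm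
  -- Cauchy product of $\sum q^ia_i$ with $\sum q^i=1/(1-q)$; the normalization $1-q$ cancels the
  -- second factor.
  have h₃ := (hasSum_sum_range_mul_of_summable_norm h₁ h₂).mul_left (1 - q)
  rw [tsum_geometric_of_lt_one hq hq1, mul_comm (∑' i, q ^ i * a i), ← mul_assoc,
    mul_inv_cancel₀ (by linarith), one_mul] at h₃
  refine h₃.congr_fun fun T => ?_
  rw [geoWeight, mul_assoc, Finset.mul_sum]
  congr 1
  refine Finset.sum_congr rfl fun i hi => ?_
  have : T = i + (T - i) := by have := Finset.mem_range.1 hi; omega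
  conv_lhs => rw [this, pow_add]
  ring

theorem summable_geoWeight_mul_sq (hq : 0 ≤ q) (hq1 : q < 1) :
    Summable fun k : ℕ => geoWeight q k * (1 + (k : ℝ)) ^ 2 := by
  have hn : ‖q‖ < 1 := by rwa [Real.norm_of_nonneg hq]
  have h0 := summable_pow_mul_geometric_of_norm_lt_one 0 hn
  have h1 := summable_pow_mul_geometric_of_norm_lt_one 1 hn
  have h2 := summable_pow_mul_geometric_of_norm_lt_one 2 hn
  refine (((h0.add (h1.mul_left 2)).add h2).mul_left (1 - q)).congr fun k => ?_
  simp only [geoWeight]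
  ring

end Geometric

/-! ### Log-sum-exp, softmax and the Gibbs variational principle. -/

section SoftMax

variable {A : Type*} [Fintype A]

/-- The log-sum-exp function `lam log ∑ₐ exp (v a / lam)`. -/
def lse (lam : ℝ) (v : A → ℝ) : ℝ := lam * Real.log (∑ a, Real.exp (v a / lam))

/-- The Gibbs distribution with energies `-v` and temperature `lam`. -/
def softmax (lam : ℝ) (v : A → ℝ) (a : A) : ℝ :=
  Real.exp (v a / lam) / ∑ b, Real.exp (v b / lam)

variable [Nonempty A] {lam : ℝ}

theorem sum_exp_pos (lam : ℝ) (v : A → ℝ) : 0 < ∑ a, Real.exp (v a / lam) :=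
  Finset.sum_pos (fun _ _ => Real.exp_pos _) Finset.univ_nonempty

theorem softmax_pos (lam : ℝ) (v : A → ℝ) (a : A) : 0 < softmax lam v a :=
  div_pos (Real.exp_pos _) (sum_exp_pos lam v)

theorem sum_softmax (lam : ℝ) (v : A → ℝ) : ∑ a, softmax lam v a = 1 := by
  simp only [softmax]
  rw [← Finset.sum_div, div_self (sum_exp_pos lam v).ne']

theorem softmax_mem (lam : ℝ) (v : A → ℝ) : softmax lam v ∈ stdSimplex ℝ A :=
  ⟨fun a => (softmax_pos lam v a).le, sum_softmax lam v⟩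

theorem log_softmax (hlam : 0 < lam) (v : A → ℝ) (a : A) :
    Real.log (softmax lam v a) = (v a - lse lam v) / lam := by
  rw [softmax, Real.log_div (Real.exp_ne_zero _) (sum_exp_pos lam v).ne', Real.log_exp, lse]
  field_simp

theorem softmax_eq_exp (hlam : 0 < lam) (v : A → ℝ) (a : A) :
    softmax lam v a = Real.exp ((v a - lse lam v) / lam) := by
  rw [← log_softmax hlam, Real.exp_log (softmax_pos lam v a)]

/-- Log-sum-exp is monotone and commutes with adding constants, hence it is nonexpansive in the sup
norm; this is what makes the soft Bellman operator a contraction. -/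
theorem lse_le_lse_add (hlam : 0 < lam) {v w : A → ℝ} {c : ℝ} (h : ∀ a, v a ≤ w a + c) :
    lse lam v ≤ lse lam w + c := by
  have h₁ : ∑ a, Real.exp (v a / lam) ≤ (∑ a, Real.exp (w a / lam)) * Real.exp (c / lam) := by
    rw [Finset.sum_mul]
    refine Finset.sum_le_sum fun a _ => ?_
    rw [← Real.exp_add, ← add_div]
    exact Real.exp_le_exp.2 (div_le_div_of_nonneg_right (h a) hlam.le)
  have h₂ := Real.log_le_log (sum_exp_pos lam v) h₁
  rw [Real.log_mul (sum_exp_pos lam w).ne' (Real.exp_ne_zero _), Real.log_exp] at h₂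
  have h₃ := mul_le_mul_of_nonneg_left h₂ hlam.le
  rw [mul_add, mul_div_cancel₀ _ hlam.ne'] at h₃
  exact h₃

theorem abs_lse_sub_le (hlam : 0 < lam) {v w : A → ℝ} {c : ℝ} (h : ∀ a, |v a - w a| ≤ c) :
    |lse lam v - lse lam w| ≤ c := by
  rw [abs_le]
  constructor
  · linarith [lse_le_lse_add hlam (v := w) (w := v) (c := c)
      fun a => by linarith [(abs_le.1 (h a)).1]]
  · linarith [lse_le_lse_add hlam (v := v) (w := w) (c := c)
      fun a => by linarith [(abs_le.1 (h a)).2]]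

/-- The defect in the Gibbs variational principle is a relative entropy. -/
theorem lse_sub_eq (hlam : 0 < lam) (v : A → ℝ) {p : A → ℝ} (hp : p ∈ stdSimplex ℝ A) :
    lse lam v - (∑ a, p a * v a + lam * -∑ a, p a * Real.log (p a)) =
      lam * ∑ a, softmax lam v a * InformationTheory.klFun (p a / softmax lam v a) := by
  have h₁ : ∀ a, softmax lam v a * InformationTheory.klFun (p a / softmax lam v a) =
      p a * Real.log (p a) - p a * v a / lam + p a * lse lam v / lam + softmax lam v a - p a := by
    intro a
    have hs := softmax_pos lam v a
    -- The logarithm of the quotient splits only when `p a` is nonzero; at zero both sides vanish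
    -- because of the factor `p a`.
    have hl : p a * Real.log (p a / softmax lam v a) =
        p a * Real.log (p a) - p a * ((v a - lse lam v) / lam) := by
      by_cases h0 : p a = 0
      · simp [h0]
      · rw [Real.log_div h0 hs.ne', log_softmax hlam, mul_sub]
    have : softmax lam v a * InformationTheory.klFun (p a / softmax lam v a) =
        p a * Real.log (p a / softmax lam v a) + softmax lam v a - p a := by
      rw [InformationTheory.klFun_apply]; field_simp
    rw [this, hl]
    ring
  simp_rw [h₁]
  rw [Finset.sum_sub_distrib, Finset.sum_add_distrib, Finset.sum_add_distrib,
    Finset.sum_sub_distrib, hp.2, sum_softmax, ← Finset.sum_div, ← Finset.sum_div,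
    ← Finset.sum_mul, hp.2]
  field_simp
  ring

theorem gibbs_le (hlam : 0 < lam) (v : A → ℝ) {p : A → ℝ} (hp : p ∈ stdSimplex ℝ A) :
    ∑ a, p a * v a + lam * -∑ a, p a * Real.log (p a) ≤ lse lam v := by
  have h := lse_sub_eq hlam v hp
  have : 0 ≤ ∑ a, softmax lam v a * InformationTheory.klFun (p a / softmax lam v a) :=
    Finset.sum_nonneg fun a _ => mul_nonneg (softmax_pos lam v a).le
      (InformationTheory.klFun_nonneg (div_nonneg (hp.1 a) (softmax_pos lam v a).le))
  nlinarith

/-- Equality forces the relative entropy to vanish, and each of its nonnegative terms is zero only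
where the two probabilities agree. Uniqueness of the optimal policy rests on this. -/
theorem eq_softmax_of_gibbs_eq (hlam : 0 < lam) (v : A → ℝ) {p : A → ℝ}
    (hp : p ∈ stdSimplex ℝ A)
    (h : ∑ a, p a * v a + lam * -∑ a, p a * Real.log (p a) = lse lam v) :
    p = softmax lam v := by
  have h₁ := lse_sub_eq hlam v hp
  rw [h, sub_self, zero_eq_mul, or_iff_right hlam.ne', Finset.sum_eq_zero_iff_of_nonneg
    fun a _ => mul_nonneg (softmax_pos lam v a).le
      (InformationTheory.klFun_nonneg (div_nonneg (hp.1 a) (softmax_pos lam v a).le))] at h₁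
  funext a
  have h₂ := h₁ a (Finset.mem_univ a)
  rw [mul_eq_zero, or_iff_right (softmax_pos lam v a).ne', InformationTheory.klFun_eq_zero_iff
    (div_nonneg (hp.1 a) (softmax_pos lam v a).le), div_eq_one_iff_eq (softmax_pos lam v a).ne']
    at h₂
  exact h₂

theorem gibbs_softmax (hlam : 0 < lam) (v : A → ℝ) :
    ∑ a, softmax lam v a * v a + lam * -∑ a, softmax lam v a * Real.log (softmax lam v a) =
      lse lam v := by
  have h := lse_sub_eq hlam v (softmax_mem lam v)
  have h₁ : ∀ a, softmax lam v a / softmax lam v a = 1 := fun a =>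
    div_self (softmax_pos lam v a).ne'
  simp only [h₁, InformationTheory.klFun_one, mul_zero, Finset.sum_const_zero] at h
  linarith

end SoftMax

/-! ### Soft Bellman operator and the optimal policy. -/

section OptimalPolicy

variable {S A : Type*} [Fintype S] [Fintype A]

theorem entropy_eq (π : Policy S A) (s : S) :
    entropy π s = -∑ a, π.1 s a * Real.log (π.1 s a) := rfl

/-- Crude but sufficient: $|t\log t|\le1$ on $[0,1]$, once for each action. -/
theorem abs_entropy_le (π : Policy S A) (s : S) : |entropy π s| ≤ Fintype.card A := by
  rw [entropy, abs_neg]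
  calc |∑ a, π.1 s a * Real.log (π.1 s a)| ≤ ∑ a, |π.1 s a * Real.log (π.1 s a)| :=
        Finset.abs_sum_le_sum_abs _ _
    _ ≤ ∑ _a : A, (1 : ℝ) := Finset.sum_le_sum fun a _ => by
        have h0 := (π.2 s).1 a
        have h1 : π.1 s a ≤ 1 := by
          rw [← (π.2 s).2]
          exact Finset.single_le_sum (fun b _ => (π.2 s).1 b) (Finset.mem_univ a)
        rcases h0.eq_or_lt with h | h
        · simp [← h]
        · rw [mul_comm]; exact (Real.abs_log_mul_self_lt _ h h1).le
    _ = Fintype.card A := by simp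

/-- Transition kernel of the chain of state-action pairs. -/
def pairKernel (m : MDP S A) (π : Policy S A) (q q' : S × A) : ℝ :=
  m.P q.1 q.2 q'.1 * π.1 q'.1 q'.2

variable (m : MDP S A) (π : Policy S A)

theorem pairKernel_mem (q : S × A) : pairKernel m π q ∈ stdSimplex ℝ (S × A) := by
  refine ⟨fun q' => mul_nonneg ((m.P_mem _ _).1 _) ((π.2 _).1 _), ?_⟩
  simp only [pairKernel, Fintype.sum_prod_type, ← Finset.mul_sum, (π.2 _).2, mul_one,
    (m.P_mem _ _).2]

theorem avg_pairKernel (g : S × A → ℝ) (q : S × A) :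
    avg (pairKernel m π) g q = ∑ s', m.P q.1 q.2 s' * ∑ a', π.1 s' a' * g (s', a') := by
  simp only [avg, pairKernel, Fintype.sum_prod_type, Finset.mul_sum, mul_assoc]

/-- The reward including the entropy bonus. -/
def softReward (lam : ℝ) (q : S × A) : ℝ := m.r q.1 q.2 + lam * entropy π q.1

/-- The action value, with the entropy bonus at time `0` included. -/
def qValue (γ lam : ℝ) : S × A → ℝ := resolvent γ (pairKernel m π) (softReward m π lam)

/-- The soft Bellman optimality operator on action values. -/
def softBellman (γ lam : ℝ) (Q : S × A → ℝ) (q : S × A) : ℝ :=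
  m.r q.1 q.2 + γ * ∑ s', m.P q.1 q.2 s' * lse lam fun a => Q (s', a)

/-- The optimal soft action value. -/
def optQ (γ lam : ℝ) : S × A → ℝ := Classical.epsilon fun Q => softBellman m γ lam Q = Q

variable {γ lam : ℝ}

theorem value_eq [DecidableEq S] (hγ : 0 ≤ γ) (hγ1 : γ < 1) (s : S) :
    m.value γ lam π s = ∑ a, π.1 s a * qValue m π γ lam (s, a) := by
  -- The state distribution at time `t` followed by an action of `π` is the `t`-step law of the
  -- chain of pairs. The function `g` stays general because the induction peels off the last
  -- transition, which replaces `g` by its average.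
  have key : ∀ (t : ℕ) (g : S × A → ℝ),
      ∑ s', m.stateProb π s t s' * ∑ a, π.1 s' a * g (s', a) =
        ∑ a, π.1 s a * ((avg (pairKernel m π))^[t] g) (s, a) := by
    intro t
    induction t with
    | zero => intro g; simp [MDP.stateProb]
    | succ t ih =>
      intro g
      rw [Function.iterate_succ_apply, ← ih]
      simp only [MDP.stateProb, avg_pairKernel]
      have h : ∀ s', (∑ u, m.stateProb π s t u * ∑ a, π.1 u a * m.P u a s') *
          (∑ a, π.1 s' a * g (s', a)) = ∑ u, m.stateProb π s t u *
            ∑ a, π.1 u a * (m.P u a s' * ∑ a, π.1 s' a * g (s', a)) := fun s' => by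
        simp only [Finset.sum_mul, mul_assoc]
      simp_rw [h]
      rw [Finset.sum_comm]
      refine Finset.sum_congr rfl fun u _ => ?_
      rw [← Finset.mul_sum, Finset.sum_comm]
      simp only [← Finset.mul_sum]
  have hs := fun a => summable_resolvent hγ hγ1 (pairKernel_mem m π) (softReward m π lam) (s, a)
  simp only [qValue, resolvent, ← tsum_mul_left]
  rw [← Summable.tsum_finsetSum fun a _ => (hs a).mul_left _]
  refine tsum_congr fun t => ?_
  rw [show (∑ s', m.stateProb π s t s' * ∑ a, π.1 s' a * (m.r s' a + lam * entropy π s')) = _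
    from key t (softReward m π lam), Finset.mul_sum]
  refine Finset.sum_congr rfl fun a _ => ?_
  ring

variable [Nonempty A]

variable (S) in
/-- The policy that plays the Gibbs distribution of `Q (s, ·)` in state `s`. -/
def softmaxPolicy (lam : ℝ) (Q : S × A → ℝ) : Policy S A :=
  ⟨fun s => softmax lam fun a => Q (s, a), fun _ => softmax_mem _ _⟩

theorem abs_softBellman_sub_le (hγ : 0 ≤ γ) (hlam : 0 < lam) (Q Q' : S × A → ℝ) (q : S × A) :
    |softBellman m γ lam Q q - softBellman m γ lam Q' q| ≤ γ * ‖Q - Q'‖ := by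
  have h : softBellman m γ lam Q q - softBellman m γ lam Q' q =
      γ * ∑ s', m.P q.1 q.2 s' *
        (lse lam (fun a => Q (s', a)) - lse lam fun a => Q' (s', a)) := by
    simp only [softBellman, mul_sub, Finset.sum_sub_distrib]; ring
  rw [h, abs_mul, abs_of_nonneg hγ]
  refine mul_le_mul_of_nonneg_left (abs_sum_simplex_mul_le (m.P_mem _ _) fun s' => ?_) hγ
  exact abs_lse_sub_le hlam fun a => norm_le_pi_norm (Q - Q') (s', a)

theorem contractingWith_softBellman (hγ : 0 ≤ γ) (hγ1 : γ < 1) (hlam : 0 < lam) :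
    ContractingWith ⟨γ, hγ⟩ (softBellman m γ lam) := by
  refine ⟨by exact_mod_cast hγ1, LipschitzWith.of_dist_le_mul fun Q Q' => ?_⟩
  rw [dist_eq_norm, dist_eq_norm]
  exact (pi_norm_le_iff_of_nonneg (mul_nonneg hγ (norm_nonneg _))).2
    fun q => abs_softBellman_sub_le m hγ hlam Q Q' q

theorem softBellman_optQ (hγ : 0 ≤ γ) (hγ1 : γ < 1) (hlam : 0 < lam) :
    softBellman m γ lam (optQ m γ lam) = optQ m γ lam :=
  Classical.epsilon_spec (p := fun Q => softBellman m γ lam Q = Q)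
    ⟨_, (contractingWith_softBellman m hγ hγ1 hlam).fixedPoint_isFixedPt⟩

theorem tendsto_iterate_softBellman (hγ : 0 ≤ γ) (hγ1 : γ < 1) (hlam : 0 < lam) :
    Filter.Tendsto (fun n => (softBellman m γ lam)^[n] 0) Filter.atTop
      (nhds (optQ m γ lam)) := by
  have h := contractingWith_softBellman m hγ hγ1 hlam
  rw [h.fixedPoint_unique (softBellman_optQ m hγ hγ1 hlam)]
  exact h.tendsto_iterate_fixedPoint 0

theorem optQ_apply (hγ : 0 ≤ γ) (hγ1 : γ < 1) (hlam : 0 < lam) (q : S × A) :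
    optQ m γ lam q = m.r q.1 q.2 + γ * ∑ s', m.P q.1 q.2 s' *
      lse lam fun a => optQ m γ lam (s', a) :=
  (congrFun (softBellman_optQ m hγ hγ1 hlam) q).symm

theorem sum_softmaxPolicy_add_entropy (hlam : 0 < lam) (Q : S × A → ℝ) (s : S) :
    ∑ a, (softmaxPolicy S lam Q).1 s a * (Q (s, a) + lam * entropy (softmaxPolicy S lam Q) s) =
      lse lam fun a => Q (s, a) := by
  simp only [mul_add, Finset.sum_add_distrib, ← Finset.sum_mul, ((softmaxPolicy S lam Q).2 s).2,
    one_mul]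
  exact gibbs_softmax hlam fun a => Q (s, a)

/-- `qValue` contains the entropy bonus at time zero and `optQ` does not. After correction by this
bonus, `optQ` solves the linear Bellman equation of its own softmax policy, since equality in the
Gibbs principle turns the policy average into log-sum-exp. -/
theorem qValue_softmaxPolicy (hγ : 0 ≤ γ) (hγ1 : γ < 1) (hlam : 0 < lam) (q : S × A) :
    qValue m (softmaxPolicy S lam (optQ m γ lam)) γ lam q =
      optQ m γ lam q + lam * entropy (softmaxPolicy S lam (optQ m γ lam)) q.1 := by
  set σ := softmaxPolicy S lam (optQ m γ lam) with hσ
  have := eq_resolvent_of_eq_add_avg hγ hγ1 (pairKernel_mem m σ) (g := softReward m σ lam)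
    (e := fun q => optQ m γ lam q + lam * entropy σ q.1) fun q => ?_
  · exact (congrFun this q).symm
  · rw [avg_pairKernel]
    simp only [hσ, sum_softmaxPolicy_add_entropy hlam]
    rw [optQ_apply m hγ hγ1 hlam q, softReward]
    ring

theorem sum_softmaxPolicy_qValue (hγ : 0 ≤ γ) (hγ1 : γ < 1) (hlam : 0 < lam) (s : S) :
    ∑ a, (softmaxPolicy S lam (optQ m γ lam)).1 s a *
      qValue m (softmaxPolicy S lam (optQ m γ lam)) γ lam (s, a) =
      lse lam fun a => optQ m γ lam (s, a) := by
  simp only [qValue_softmaxPolicy m hγ hγ1 hlam, sum_softmaxPolicy_add_entropy hlam]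

variable [DecidableEq S]

theorem value_softmaxPolicy (hγ : 0 ≤ γ) (hγ1 : γ < 1) (hlam : 0 < lam) (s : S) :
    m.value γ lam (softmaxPolicy S lam (optQ m γ lam)) s = lse lam fun a => optQ m γ lam (s, a) := by
  rw [value_eq m _ hγ hγ1, sum_softmaxPolicy_qValue m hγ hγ1 hlam]

theorem qValue_eq (hγ : 0 ≤ γ) (hγ1 : γ < 1) (q : S × A) :
    qValue m π γ lam q = m.r q.1 q.2 + lam * entropy π q.1 +
      γ * ∑ s', m.P q.1 q.2 s' * m.value γ lam π s' := by
  rw [qValue, resolvent_eq hγ hγ1 (pairKernel_mem m π), avg_pairKernel]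
  simp only [value_eq m π hγ hγ1, softReward, qValue]

theorem isOptimal_softmaxPolicy (hγ : 0 ≤ γ) (hγ1 : γ < 1) (hlam : 0 < lam) :
    m.IsOptimal γ lam (softmaxPolicy S lam (optQ m γ lam)) := by
  intro π s
  rw [value_softmaxPolicy m hγ hγ1 hlam]
  have hstate : ∀ s, (fun s' => ∑ a, π.1 s a * m.P s a s') ∈ stdSimplex ℝ S := by
    intro s
    refine ⟨fun s' => Finset.sum_nonneg fun a _ => mul_nonneg ((π.2 s).1 a) ((m.P_mem s a).1 s'),
      ?_⟩
    rw [Finset.sum_comm]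
    simp only [← Finset.mul_sum, (m.P_mem _ _).2, mul_one, (π.2 s).2]
  -- By the Gibbs inequality, the excess of the value of `π` over the candidate optimum is at most
  -- `γ` times its own average along the state chain of `π`; the maximum principle makes it
  -- nonpositive.
  have h := le_of_le_add_avg (b := 0) hγ hγ1 hstate
    (e := fun s => m.value γ lam π s - lse lam fun a => optQ m γ lam (s, a)) (fun s => ?_) s
  · rw [zero_div] at h; linarith
  · have hg := gibbs_le hlam (fun a => optQ m γ lam (s, a)) (π.2 s)
    rw [← entropy_eq] at hg
    have hv : m.value γ lam π s = ∑ a, π.1 s a * optQ m γ lam (s, a) + lam * entropy π s +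
        γ * avg (fun s s' => ∑ a, π.1 s a * m.P s a s')
          (fun s => m.value γ lam π s - lse lam fun a => optQ m γ lam (s, a)) s := by
      rw [value_eq m π hγ hγ1]
      have h₁ : ∀ a, qValue m π γ lam (s, a) = optQ m γ lam (s, a) + lam * entropy π s +
          γ * ∑ s', m.P s a s' *
            (m.value γ lam π s' - lse lam fun a => optQ m γ lam (s', a)) := by
        intro a
        rw [qValue_eq m π hγ hγ1, optQ_apply m hγ hγ1 hlam]
        simp only [mul_sub, Finset.sum_sub_distrib]
        ring
      simp only [h₁, mul_add, Finset.sum_add_distrib, ← Finset.sum_mul, (π.2 s).2, one_mul]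
      congr 1
      simp only [avg, Finset.mul_sum, Finset.sum_mul]
      rw [Finset.sum_comm]
      refine Finset.sum_congr rfl fun s' _ => Finset.sum_congr rfl fun a _ => ?_
      ring
    linarith

/-- The value of an optimal policy equals the log-sum-exp of `optQ` at every state, so its action
value is `optQ` plus its entropy bonus. This is equality in the Gibbs principle state by state. -/
theorem IsOptimal.eq_softmaxPolicy {m : MDP S A} {π : Policy S A} (hγ : 0 ≤ γ) (hγ1 : γ < 1)
    (hlam : 0 < lam) (h : m.IsOptimal γ lam π) : π = softmaxPolicy S lam (optQ m γ lam) := by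
  have hv : ∀ s, m.value γ lam π s = lse lam fun a => optQ m γ lam (s, a) := fun s => by
    rw [← value_softmaxPolicy m hγ hγ1 hlam]
    exact le_antisymm (isOptimal_softmaxPolicy m hγ hγ1 hlam π s) (h _ s)
  refine Subtype.ext (funext fun s => eq_softmax_of_gibbs_eq hlam _ (π.2 s) ?_)
  rw [← entropy_eq, ← hv, value_eq m π hγ hγ1]
  have h₁ : ∀ a, qValue m π γ lam (s, a) = optQ m γ lam (s, a) + lam * entropy π s := by
    intro a
    rw [qValue_eq m π hγ hγ1, optQ_apply m hγ hγ1 hlam]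
    simp only [hv]
    ring
  simp only [h₁, mul_add, Finset.sum_add_distrib, ← Finset.sum_mul, (π.2 s).2, one_mul]

/-- Replaces the choice in the definition by an explicit formula, on which differentiability,
measurability and the lower bound of the optimal policy all rely. -/
theorem optPolicy_eq [DecidableEq A] (hγ : 0 ≤ γ) (hγ1 : γ < 1) (hlam : 0 < lam) :
    m.optPolicy γ lam = softmaxPolicy S lam (optQ m γ lam) :=
  IsOptimal.eq_softmaxPolicy hγ hγ1 hlam
    (Classical.epsilon_spec ⟨_, isOptimal_softmaxPolicy m hγ hγ1 hlam⟩)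

end OptimalPolicy

/-! ### Uniform bounds on values and on the optimal policy. -/

section Bounds

variable {S A : Type*} [Fintype S] [Fintype A] (m : MDP S A) (π : Policy S A) {γ lam R : ℝ}

theorem policy_le_one (s : S) (a : A) : π.1 s a ≤ 1 := by
  rw [← (π.2 s).2]
  exact Finset.single_le_sum (fun b _ => (π.2 s).1 b) (Finset.mem_univ a)

theorem norm_policy_sub_le (π π' : Policy S A) : ‖π.1 - π'.1‖ ≤ 1 := by
  refine (pi_norm_le_iff_of_nonneg zero_le_one).2 fun s =>
    (pi_norm_le_iff_of_nonneg zero_le_one).2 fun a => ?_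
  have h₁ := (π.2 s).1 a
  have h₂ := (π'.2 s).1 a
  have h₃ := policy_le_one π s a
  have h₄ := policy_le_one π' s a
  simp only [Pi.sub_apply, Real.norm_eq_abs, abs_le]
  constructor <;> linarith

theorem abs_softReward_le (hlam : 0 < lam) (hr : ∀ s a, |m.r s a| ≤ R) (q : S × A) :
    |softReward m π lam q| ≤ R + lam * Fintype.card A := by
  refine (abs_add_le _ _).trans (add_le_add (hr _ _) ?_)
  rw [abs_mul, abs_of_pos hlam]
  exact mul_le_mul_of_nonneg_left (abs_entropy_le π _) hlam.le

theorem abs_qValue_le (hγ : 0 ≤ γ) (hγ1 : γ < 1) (hlam : 0 < lam) (hr : ∀ s a, |m.r s a| ≤ R)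
    (q : S × A) : |qValue m π γ lam q| ≤ (R + lam * Fintype.card A) / (1 - γ) :=
  abs_resolvent_le hγ hγ1 (pairKernel_mem m π) (abs_softReward_le m π hlam hr) q

/-- The optimal policy is bounded away from zero. -/
theorem exp_le_softmaxPolicy [Nonempty A] (hγ : 0 ≤ γ) (hγ1 : γ < 1) (hlam : 0 < lam)
    (hr : ∀ s a, |m.r s a| ≤ R) (s : S) (a : A) :
    Real.exp (-(2 * ((R + lam * Fintype.card A) / (1 - γ)) + lam * Fintype.card A) / lam) ≤
      (softmaxPolicy S lam (optQ m γ lam)).1 s a := by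
  change _ ≤ softmax lam (fun a => optQ m γ lam (s, a)) a
  rw [softmax_eq_exp hlam]
  refine Real.exp_le_exp.2 (div_le_div_of_nonneg_right ?_ hlam.le)
  -- The exponent is `optQ` minus log-sum-exp, over `lam`. The first is an action value minus an
  -- entropy bonus, the second is a policy average of action values; this yields twice the value
  -- bound plus one entropy bound.
  have h₁ := qValue_softmaxPolicy m hγ hγ1 hlam (s, a)
  have h₂ := abs_le.1 (abs_qValue_le m (softmaxPolicy S lam (optQ m γ lam)) hγ hγ1 hlam hr (s, a))
  have h₃ := abs_le.1 (abs_entropy_le (softmaxPolicy S lam (optQ m γ lam)) s)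
  have h₄ := abs_le.1 (abs_sum_simplex_mul_le ((softmaxPolicy S lam (optQ m γ lam)).2 s)
    fun a => abs_qValue_le m (softmaxPolicy S lam (optQ m γ lam)) hγ hγ1 hlam hr (s, a))
  rw [sum_softmaxPolicy_qValue m hγ hγ1 hlam] at h₄
  have h₅ := mul_le_mul_of_nonneg_left h₃.2 hlam.le
  simp only at h₁
  linarith

end Bounds

/-! ### Differentiability of the fixed point of a parametrized contraction. -/

section FixedPoint

variable {E F : Type*} [NormedAddCommGroup E] [NormedSpace ℝ E] [NormedAddCommGroup F]
  [NormedSpace ℝ F] [CompleteSpace F]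

open Asymptotics in
/-- The fixed point of a contraction depending on a parameter is differentiable in the parameter
wherever the contraction is jointly differentiable. -/
theorem differentiableAt_fixedPoint {Φ : E × F → F} {w : E → F} {c : ℝ} (hc0 : 0 ≤ c)
    (hc1 : c < 1) (hw : ∀ x, Φ (x, w x) = w x)
    (hΦ : ∀ x v v', ‖Φ (x, v) - Φ (x, v')‖ ≤ c * ‖v - v'‖) {x₀ : E}
    (hd : DifferentiableAt ℝ Φ (x₀, w x₀)) : DifferentiableAt ℝ w x₀ := by
  set D := fderiv ℝ Φ (x₀, w x₀)
  have hD : HasFDerivAt Φ D (x₀, w x₀) := hd.hasFDerivAt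
  -- The partial derivative in the fixed-point variable has norm below one, because `Φ` is a
  -- contraction in this variable; so `1 - B` is invertible by a Neumann series.
  set B : F →L[ℝ] F := D.comp (ContinuousLinearMap.inr ℝ E F)
  have hB : ‖B‖ < 1 := by
    have h₁ : HasFDerivAt (fun v => Φ (x₀, v)) B (w x₀) :=
      hD.comp (w x₀) (hasFDerivAt_prodMk_right x₀ (w x₀))
    refine lt_of_le_of_lt (h₁.le_of_lip' hc0 ?_) hc1
    exact Filter.Eventually.of_forall fun v => hΦ x₀ v (w x₀)
  -- Insert $\Phi(x,w(x_0))$: the first difference is at most $c\|w(x)-w(x_0)\|$ and is absorbed on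
  -- the left, the second is differentiable in `x`. This Lipschitz estimate at the base point
  -- replaces the continuous differentiability that an implicit function theorem would ask for.
  have hbig : (fun x => w x - w x₀) =O[nhds x₀] fun x => x - x₀ := by
    have h₁ : HasFDerivAt (fun x => Φ (x, w x₀)) (D.comp (ContinuousLinearMap.inl ℝ E F)) x₀ :=
      hD.comp x₀ (hasFDerivAt_prodMk_left x₀ (w x₀))
    refine IsBigO.trans (IsBigO.of_bound (1 - c)⁻¹ (Filter.Eventually.of_forall fun x => ?_))
      h₁.isBigO_sub
    rw [inv_mul_eq_div, le_div_iff₀ (by linarith)]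
    have h₂ : ‖w x - w x₀‖ ≤ ‖Φ (x, w x) - Φ (x, w x₀)‖ + ‖Φ (x, w x₀) - Φ (x₀, w x₀)‖ := by
      rw [hw x, hw x₀]
      exact norm_sub_le_norm_sub_add_norm_sub _ _ _
    have h₃ := hΦ x (w x) (w x₀)
    linarith
  have hcont : Filter.Tendsto (fun x => (x, w x)) (nhds x₀) (nhds (x₀, w x₀)) := by
    refine Filter.Tendsto.prodMk_nhds Filter.tendsto_id ?_
    have h₁ : Filter.Tendsto (fun x => x - x₀) (nhds x₀) (nhds 0) :=
      tendsto_sub_nhds_zero_iff.2 Filter.tendsto_id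
    exact tendsto_sub_nhds_zero_iff.1 (hbig.trans_tendsto h₁)
  have hlit : (fun x => Φ (x, w x) - Φ (x₀, w x₀) - D ((x, w x) - (x₀, w x₀))) =o[nhds x₀]
      fun x => x - x₀ :=
    (hD.isLittleO.comp_tendsto hcont).trans_isBigO (IsBigO.prod_left (isBigO_refl _ _) hbig)
  set u : (F →L[ℝ] F)ˣ := Units.oneSub B hB
  have hu : ∀ v, (↑u⁻¹ : F →L[ℝ] F) (v - B v) = v := fun v => by
    have h₁ : (↑u⁻¹ : F →L[ℝ] F) * (1 - B) = 1 := u.inv_mul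
    have := congrArg (fun L : F →L[ℝ] F => L v) h₁
    simpa using this
  refine (HasFDerivAt.of_isLittleO (f' := (↑u⁻¹ : F →L[ℝ] F).comp
    (D.comp (ContinuousLinearMap.inl ℝ E F))) ?_).differentiableAt
  -- The linearized fixed-point equation reads $(1-B)(w(x)-w(x_0))=D(x-x_0,0)+o(\|x-x_0\|)$; apply
  -- the inverse of $1-B$.
  refine (((↑u⁻¹ : F →L[ℝ] F).isBigO_comp _ _).trans_isLittleO hlit).congr_left fun x => ?_
  have h₁ : D (x - x₀, w x - w x₀) =
      D.comp (ContinuousLinearMap.inl ℝ E F) (x - x₀) + B (w x - w x₀) := by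
    simp only [B, ContinuousLinearMap.comp_apply, ContinuousLinearMap.inl_apply,
      ContinuousLinearMap.inr_apply, ← map_add, Prod.mk_add_mk, add_zero, zero_add]
  simp only [Prod.mk_sub_mk, hw, h₁]
  rw [← sub_sub, sub_right_comm, map_sub, hu]
  rfl

end FixedPoint

/-! ### Derivatives of log-sum-exp and softmax. -/

section SoftMaxDeriv

variable {A E : Type*} [Fintype A] [Nonempty A] [NormedAddCommGroup E] [NormedSpace ℝ E]
  {lam : ℝ} {u : E → A → ℝ} {u' : A → E →L[ℝ] ℝ} {x : E}

theorem hasFDerivAt_lse (hlam : 0 < lam) (hu : ∀ a, HasFDerivAt (fun y => u y a) (u' a) x) :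
    HasFDerivAt (fun y => lse lam (u y)) (∑ a, softmax lam (u x) a • u' a) x := by
  have h₁ : HasFDerivAt (fun y => ∑ a, Real.exp (u y a / lam))
      (∑ a, Real.exp (u x a / lam) • (lam⁻¹ • u' a)) x := by
    refine HasFDerivAt.fun_sum fun a _ => ?_
    simp only [div_eq_mul_inv]
    exact ((hu a).mul_const lam⁻¹).exp
  refine ((h₁.log (sum_exp_pos lam _).ne').const_mul lam).congr_fderiv ?_
  ext v
  simp only [softmax, smul_apply, sum_apply, smul_eq_mul,
    Finset.mul_sum]
  refine Finset.sum_congr rfl fun a _ => ?_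
  field_simp

/-- Differentiating $\exp((v_a-\mathrm{lse})/\lambda)$ centres the derivative of `v a` by its
softmax mean; this centring is the origin of the advantage, and hence of the baseline rollout from
the state. -/
theorem hasFDerivAt_softmax (hlam : 0 < lam) (hu : ∀ a, HasFDerivAt (fun y => u y a) (u' a) x)
    (a : A) :
    HasFDerivAt (fun y => softmax lam (u y) a)
      ((softmax lam (u x) a * (1 / lam)) • (u' a - ∑ b, softmax lam (u x) b • u' b)) x := by
  simp only [softmax_eq_exp hlam _ a, div_eq_mul_inv]
  have h := (((hu a).sub (hasFDerivAt_lse hlam hu)).mul_const lam⁻¹).exp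
  refine h.congr_fderiv ?_
  simp only [Pi.sub_apply, one_mul]
  rw [smul_smul]

end SoftMaxDeriv

/-! ### Gradients in coordinates and the score identity. -/

section Gradients

variable {d : ℕ}

/-- The linear form `v ↦ ∑ i, g i * v i`. -/
def gradCLM (g : Fin d → ℝ) : (Fin d → ℝ) →L[ℝ] ℝ :=
  LinearMap.toContinuousLinearMap (∑ i, g i • LinearMap.proj i)

theorem gradCLM_apply (g v : Fin d → ℝ) : gradCLM g v = ∑ i, g i * v i := by
  simp [gradCLM]

theorem eq_gradCLM (L : (Fin d → ℝ) →L[ℝ] ℝ) : L = gradCLM fun i => L (Pi.single i 1) := by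
  ext v
  rw [gradCLM_apply]
  conv_lhs => rw [pi_eq_sum_univ' v, map_sum]
  refine Finset.sum_congr rfl fun i _ => ?_
  rw [map_smul, smul_eq_mul, mul_comm]

theorem norm_gradCLM_le {g : Fin d → ℝ} {b : ℝ} (hb : 0 ≤ b) (hg : ∀ i, |g i| ≤ b) :
    ‖gradCLM g‖ ≤ d * b := by
  refine ContinuousLinearMap.opNorm_le_bound _ (by positivity) fun v => ?_
  rw [gradCLM_apply]
  refine (norm_sum_le _ _).trans ((Finset.sum_le_sum (g := fun _ => b * ‖v‖) fun i _ => ?_).trans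
    (by simp [mul_assoc]))
  rw [norm_mul]
  exact mul_le_mul (hg i) (norm_le_pi_norm v i) (norm_nonneg _) hb

theorem continuous_gradCLM : Continuous (gradCLM (d := d)) := by
  refine continuous_clm_apply.2 fun v => ?_
  simp only [gradCLM_apply]
  fun_prop

theorem fderiv_apply_eq_sum_grad (g : (Fin d → ℝ) → ℝ) (x v : Fin d → ℝ) :
    fderiv ℝ g x v = ∑ i, grad g x i * v i := by
  conv_lhs => rw [eq_gradCLM (fderiv ℝ g x), gradCLM_apply]
  rfl

/-- The junk values of `log` and `fderiv` match, so that the rule holds also at zeros of `p`. -/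
theorem grad_log {p : (Fin d → ℝ) → ℝ} (hp : Differentiable ℝ p) (hp0 : ∀ y, 0 ≤ p y)
    (x : Fin d → ℝ) : grad (fun y => Real.log (p y)) x = (p x)⁻¹ • grad p x := by
  by_cases hx : p x = 0
  · rw [hx, inv_zero, zero_smul]
    suffices h : fderiv ℝ (fun y => Real.log (p y)) x = 0 by
      funext i; simp [grad, h]
    by_cases hd : DifferentiableAt ℝ (fun y => Real.log (p y)) x
    · have h₁ : ∀ᶠ y in nhds x, -1 < Real.log (p y) := by
        have := hd.continuousAt.tendsto
        rw [hx, Real.log_zero] at this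
        exact this.eventually (lt_mem_nhds (by norm_num))
      have h₂ : ∀ᶠ y in nhds x, p y < Real.exp (-1) := by
        have := (hp x).continuousAt.tendsto
        rw [hx] at this
        exact this.eventually (gt_mem_nhds (Real.exp_pos _))
      have h₃ : (fun y => Real.log (p y)) =ᶠ[nhds x] fun _ => 0 := by
        filter_upwards [h₁, h₂] with y hy₁ hy₂
        rcases (hp0 y).eq_or_lt with h | h
        · simp [← h]
        · have := Real.log_lt_log h hy₂
          rw [Real.log_exp] at this
          linarith
      rw [h₃.fderiv_eq]
      exact fderiv_const_apply 0
    · exact fderiv_zero_of_not_differentiableAt hd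
  · funext i
    simp only [grad, Pi.smul_apply]
    rw [fderiv.log (hp x) hx]
    rfl

/-- A zero of the nonnegative function `p` is a minimum, where its gradient vanishes too. Therefore
the score identity needs no positivity. -/
theorem mul_grad_log {p : (Fin d → ℝ) → ℝ} (hp : Differentiable ℝ p) (hp0 : ∀ y, 0 ≤ p y)
    (x : Fin d → ℝ) (i : Fin d) : p x * grad (fun y => Real.log (p y)) x i = grad p x i := by
  rw [grad_log hp hp0]
  by_cases hx : p x = 0
  · have : IsLocalMin p x := Filter.Eventually.of_forall fun y => by rw [hx]; exact hp0 y
    simp [hx, grad, this.fderiv_eq_zero]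
  · simp [hx]

theorem abs_le_of_norm_le {v : Fin d → ℝ} {b : ℝ} (h : ‖v‖ ≤ b) (i : Fin d) : |v i| ≤ b :=
  (norm_le_pi_norm v i).trans h

end Gradients

/-! ### Derivative of the optimal action value and of the leader's loss. -/

section HyperGradient

variable {S A : Type*} [Fintype S] [Fintype A]

/-- The derivative of the action value of a fixed policy, given the derivatives `dr`, `dP` of
rewards and transition probabilities. -/
def dqValue (m : MDP S A) (π : Policy S A) (γ lam : ℝ) (dr : S → A → ℝ) (dP : S → A → S → ℝ) :
    S × A → ℝ :=
  resolvent γ (pairKernel m π) fun q => dr q.1 q.2 +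
    γ * ∑ s', dP q.1 q.2 s' * ∑ a', π.1 s' a' * qValue m π γ lam (s', a')

section Family

variable {E : Type*} [NormedAddCommGroup E] [NormedSpace ℝ E] [Nonempty A] {m : E → MDP S A}
  {γ lam : ℝ}

theorem differentiable_optQ (hγ : 0 ≤ γ) (hγ1 : γ < 1) (hlam : 0 < lam)
    (hr : ∀ s a, Differentiable ℝ fun y => (m y).r s a)
    (hP : ∀ s a s', Differentiable ℝ fun y => (m y).P s a s') :
    Differentiable ℝ fun y => optQ (m y) γ lam := by
  intro x
  refine differentiableAt_fixedPoint (Φ := fun z : E × (S × A → ℝ) => softBellman (m z.1) γ lam z.2)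
    hγ hγ1 (fun y => softBellman_optQ (m y) hγ hγ1 hlam) (fun y v v' => ?_) ?_
  · exact (pi_norm_le_iff_of_nonneg (mul_nonneg hγ (norm_nonneg _))).2
      fun q => abs_softBellman_sub_le (m y) hγ hlam v v' q
  · rw [differentiableAt_pi]
    intro q
    have h₁ : DifferentiableAt ℝ (fun z : E × (S × A → ℝ) => (m z.1).r q.1 q.2)
        (x, optQ (m x) γ lam) := 
      DifferentiableAt.comp (x, optQ (m x) γ lam) (g := fun y => (m y).r q.1 q.2) (f := Prod.fst)
        (hr q.1 q.2 x) differentiableAt_fst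
    have h₂ : ∀ s', DifferentiableAt ℝ (fun z : E × (S × A → ℝ) => (m z.1).P q.1 q.2 s')
        (x, optQ (m x) γ lam) := fun s' =>
      DifferentiableAt.comp (x, optQ (m x) γ lam) (g := fun y => (m y).P q.1 q.2 s') (f := Prod.fst)
        (hP q.1 q.2 s' x) differentiableAt_fst
    have h₃ : ∀ s', DifferentiableAt ℝ (fun z : E × (S × A → ℝ) => lse lam fun a => z.2 (s', a))
        (x, optQ (m x) γ lam) := fun s' =>
      (hasFDerivAt_lse hlam (u := fun (z : E × (S × A → ℝ)) a => z.2 (s', a)) fun a =>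
        (show DifferentiableAt ℝ (fun z : E × (S × A → ℝ) => z.2 (s', a)) _ by
          fun_prop).hasFDerivAt).differentiableAt
    exact h₁.add ((DifferentiableAt.fun_sum fun s' _ => (h₂ s').mul (h₃ s')).const_mul γ)

/-- The derivative of the optimal action value is that of the action value of the optimal
policy, with the policy held fixed. -/
theorem fderiv_optQ (hγ : 0 ≤ γ) (hγ1 : γ < 1) (hlam : 0 < lam)
    (hr : ∀ s a, Differentiable ℝ fun y => (m y).r s a)
    (hP : ∀ s a s', Differentiable ℝ fun y => (m y).P s a s') (x v : E) (q : S × A) :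
    fderiv ℝ (fun y => optQ (m y) γ lam q) x v =
      dqValue (m x) (softmaxPolicy S lam (optQ (m x) γ lam)) γ lam
        (fun s a => fderiv ℝ (fun y => (m y).r s a) x v)
        (fun s a s' => fderiv ℝ (fun y => (m y).P s a s') x v) q := by
  have hQ : ∀ q, HasFDerivAt (fun y => optQ (m y) γ lam q)
      (fderiv ℝ (fun y => optQ (m y) γ lam q) x) x := fun q =>
    ((differentiableAt_pi.1 (differentiable_optQ hγ hγ1 hlam hr hP x)) q).hasFDerivAt
  -- Envelope argument: differentiating the soft Bellman equation, the derivative of log-sum-exp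
  -- becomes the softmax average, so the result is a linear Bellman equation with the kernel of the
  -- fixed optimal policy. Uniqueness of its solution concludes.
  refine congrFun (eq_resolvent_of_eq_add_avg hγ hγ1 (pairKernel_mem _ _)
    (e := fun q => fderiv ℝ (fun y => optQ (m y) γ lam q) x v) fun q => ?_) q
  have h₁ : HasFDerivAt (fun y => optQ (m y) γ lam q) (fderiv ℝ (fun y => (m y).r q.1 q.2) x +
      γ • ∑ s', ((m x).P q.1 q.2 s' • (∑ a, softmax lam (fun a => optQ (m x) γ lam (s', a)) a •
        fderiv ℝ (fun y => optQ (m y) γ lam (s', a)) x) +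
        (lse lam fun a => optQ (m x) γ lam (s', a)) •
          fderiv ℝ (fun y => (m y).P q.1 q.2 s') x)) x := by
    have h₂ : (fun y => optQ (m y) γ lam q) = fun y => (m y).r q.1 q.2 +
        γ * ∑ s', (m y).P q.1 q.2 s' * lse lam fun a => optQ (m y) γ lam (s', a) :=
      funext fun y => optQ_apply (m y) hγ hγ1 hlam q
    rw [h₂]
    refine (hr q.1 q.2 x).hasFDerivAt.add (HasFDerivAt.const_mul
      (HasFDerivAt.fun_sum fun s' _ => ?_) γ)
    exact (hP q.1 q.2 s' x).hasFDerivAt.mul (hasFDerivAt_lse hlam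
      (u := fun y a => optQ (m y) γ lam (s', a)) fun a => hQ (s', a))
  rw [h₁.fderiv, avg_pairKernel]
  simp only [sum_softmaxPolicy_qValue (m x) hγ hγ1 hlam, add_apply,
    smul_apply, sum_apply, smul_eq_mul]
  rw [add_assoc, ← mul_add, ← Finset.sum_add_distrib]
  congr 2
  refine Finset.sum_congr rfl fun s' _ => ?_
  rw [add_comm, mul_comm (lse lam _)]
  rfl

end Family

variable [DecidableEq S] [DecidableEq A] {d : ℕ} {Ξ : Type*}

/-- The derivative of the action value of `π` with respect to the `i`-th coordinate of `x`. -/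
def gradQ (M : (Fin d → ℝ) → Ξ → MDP S A) (γ lam : ℝ) (x : Fin d → ℝ) (ξ : Ξ) (π : Policy S A)
    (i : Fin d) : S × A → ℝ :=
  dqValue (M x ξ) π γ lam (fun s a => grad (fun y => (M y ξ).r s a) x i)
    (fun s a s' => grad (fun y => (M y ξ).P s a s') x i)

/-- The mean of the hypergradient estimator when the follower plays `π`. -/
def hyperGrad (M : (Fin d → ℝ) → Ξ → MDP S A) (f : (Fin d → ℝ) → (S → A → ℝ) → Ξ → ℝ)
    (γ lam : ℝ) (x : Fin d → ℝ) (ξ : Ξ) (π : Policy S A) (i : Fin d) : ℝ :=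
  grad (fun y => f y π.1 ξ) x i +
    ∑ s, ∑ a, π.1 s a * (1 / lam) * gradPi (fun ρ => f x ρ ξ) π.1 s a *
      (gradQ M γ lam x ξ π i (s, a) - ∑ b, π.1 s b * gradQ M γ lam x ξ π i (s, b))

variable {γ lam : ℝ} [Nonempty A]

theorem fderiv_pi_apply_eq_sum (L : (S → A → ℝ) →L[ℝ] ℝ) (v : S → A → ℝ) :
    L v = ∑ s, ∑ a, v s a * L (Pi.single s (Pi.single a 1)) := by
  have h : v = ∑ s, ∑ a, v s a • (Pi.single s (Pi.single a (1 : ℝ)) : S → A → ℝ) := by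
    ext s' a'
    simp only [Finset.sum_apply, Pi.smul_apply, smul_eq_mul]
    rw [Finset.sum_eq_single s' (fun s _ hs => by simp [hs.symm]) (by simp),
      Finset.sum_eq_single a' (fun a _ ha => by simp [ha.symm]) (by simp)]
    simp
  conv_lhs => rw [h]
  simp only [map_sum, map_smul, smul_eq_mul]

/-- Chain rule through $y\mapsto(y,\pi^*_y)$: the derivative of the softmax supplies the factor
$\pi(a;s)/\lambda$ and the advantage, and `fderiv_optQ` identifies the derivatives of `optQ` with
`gradQ`. -/
theorem hasFDerivAt_leaderLoss (hγ : 0 ≤ γ) (hγ1 : γ < 1) (hlam : 0 < lam)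
    (M : (Fin d → ℝ) → Ξ → MDP S A) (f : (Fin d → ℝ) → (S → A → ℝ) → Ξ → ℝ) (ξ : Ξ)
    (hr : ∀ s a, Differentiable ℝ fun y => (M y ξ).r s a)
    (hP : ∀ s a s', Differentiable ℝ fun y => (M y ξ).P s a s') (x : Fin d → ℝ)
    (hf : DifferentiableAt ℝ (fun q : (Fin d → ℝ) × (S → A → ℝ) => f q.1 q.2 ξ)
      (x, ((M x ξ).optPolicy γ lam).1)) :
    HasFDerivAt (fun y => f y ((M y ξ).optPolicy γ lam).1 ξ)
      (gradCLM (hyperGrad M f γ lam x ξ ((M x ξ).optPolicy γ lam))) x := by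
  simp only [optPolicy_eq _ hγ hγ1 hlam] at hf ⊢
  set σ : (Fin d → ℝ) → Policy S A := fun y => softmaxPolicy S lam (optQ (M y ξ) γ lam)
  have hQ : ∀ q, HasFDerivAt (fun y => optQ (M y ξ) γ lam q)
      (fderiv ℝ (fun y => optQ (M y ξ) γ lam q) x) x := fun q =>
    ((differentiableAt_pi.1 (differentiable_optQ (m := fun y => M y ξ) hγ hγ1 hlam hr hP x))
      q).hasFDerivAt
  have hσ' : ∀ s a, HasFDerivAt (fun y => (σ y).1 s a)
      (((σ x).1 s a * (1 / lam)) • (fderiv ℝ (fun y => optQ (M y ξ) γ lam (s, a)) x -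
        ∑ b, (σ x).1 s b • fderiv ℝ (fun y => optQ (M y ξ) γ lam (s, b)) x)) x := fun s a =>
    hasFDerivAt_softmax hlam (u := fun y a => optQ (M y ξ) γ lam (s, a)) (fun a => hQ (s, a)) a
  have hσ : HasFDerivAt (fun y => (σ y).1) (ContinuousLinearMap.pi fun s =>
      ContinuousLinearMap.pi fun a =>
      (((σ x).1 s a * (1 / lam)) • (fderiv ℝ (fun y => optQ (M y ξ) γ lam (s, a)) x -
        ∑ b, (σ x).1 s b • fderiv ℝ (fun y => optQ (M y ξ) γ lam (s, b)) x))) x :=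
    hasFDerivAt_pi.2 fun s => hasFDerivAt_pi.2 fun a => hσ' s a
  set D := fderiv ℝ (fun q : (Fin d → ℝ) × (S → A → ℝ) => f q.1 q.2 ξ) (x, (σ x).1)
  have hD : HasFDerivAt (fun q : (Fin d → ℝ) × (S → A → ℝ) => f q.1 q.2 ξ) D (x, (σ x).1) :=
    hf.hasFDerivAt
  have hcomp := hD.comp x ((hasFDerivAt_id x).prodMk hσ)
  refine HasFDerivAt.congr_fderiv hcomp ?_
  rw [eq_gradCLM (D.comp _)]
  congr 1
  funext i
  set v : Fin d → ℝ := Pi.single i 1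
  have h₁ : fderiv ℝ (fun y => f y (σ x).1 ξ) x = D.comp (ContinuousLinearMap.inl ℝ _ _) :=
    HasFDerivAt.fderiv (f := fun y => f y (σ x).1 ξ)
      (HasFDerivAt.comp (f := fun y => (y, (σ x).1)) x hD (hasFDerivAt_prodMk_left x (σ x).1))
  have h₂ : fderiv ℝ (fun ρ => f x ρ ξ) (σ x).1 = D.comp (ContinuousLinearMap.inr ℝ _ _) :=
    HasFDerivAt.fderiv (f := fun ρ => f x ρ ξ)
      (hD.comp (σ x).1 (hasFDerivAt_prodMk_right x (σ x).1))
  have h₃ : ∀ q, fderiv ℝ (fun y => optQ (M y ξ) γ lam q) x v = gradQ M γ lam x ξ (σ x) i q :=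
    fun q => fderiv_optQ (m := fun y => M y ξ) hγ hγ1 hlam hr hP x v q
  have hsplit : ∀ (a : Fin d → ℝ) (b : S → A → ℝ), D (a, b) =
      D.comp (ContinuousLinearMap.inl ℝ _ _) a + D.comp (ContinuousLinearMap.inr ℝ _ _) b := by
    intro a b
    simp [← map_add]
  rw [ContinuousLinearMap.comp_apply, ContinuousLinearMap.prod_apply, hsplit, ← h₁, ← h₂,
    fderiv_pi_apply_eq_sum (fderiv ℝ (fun ρ => f x ρ ξ) (σ x).1)]
  simp only [hyperGrad]
  congr 1
  refine Finset.sum_congr rfl fun s _ => Finset.sum_congr rfl fun a _ => ?_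
  simp only [ContinuousLinearMap.pi_apply, smul_apply,
    sub_apply, sum_apply, smul_eq_mul, h₃, gradPi]
  ring

end HyperGradient

/-! ### Stability of values and their derivatives under a change of policy. -/

section Perturbation

/-- $t\log t$ is not Lipschitz at zero, but it suffices that one argument stays above `p`. Write the
difference as $u(\log u-\log t)+(u-t)\log t$ and use $\log r\le r-1$ for both $r=u/t$ and $r=t/u$;
each part costs $1/p$. -/
theorem abs_mul_log_sub_le {t u p : ℝ} (hp : 0 < p) (hpt : p ≤ t) (ht : t ≤ 1) (hu : 0 ≤ u)
    (hu1 : u ≤ 1) : |u * Real.log u - t * Real.log t| ≤ 2 / p * |u - t| := by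
  have ht0 : 0 < t := hp.trans_le hpt
  have h1p : 1 ≤ 1 / p := by rw [le_div_iff₀ hp]; linarith
  have hlog : |Real.log t| ≤ 1 / p := by
    rw [abs_of_nonpos (Real.log_nonpos ht0.le ht), ← Real.log_inv]
    have := Real.log_le_sub_one_of_pos (inv_pos.2 ht0)
    have h₂ : t⁻¹ ≤ 1 / p := by rw [one_div]; exact inv_anti₀ hp hpt
    linarith
  have hfirst : |u * (Real.log u - Real.log t)| ≤ 1 / p * |u - t| := by
    rcases hu.eq_or_lt with h | h
    · rw [← h, zero_mul, abs_zero]; positivity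
    · have h₁ : Real.log u - Real.log t ≤ u / t - 1 := by
        rw [← Real.log_div h.ne' ht0.ne']; exact Real.log_le_sub_one_of_pos (div_pos h ht0)
      have h₂ : Real.log t - Real.log u ≤ t / u - 1 := by
        rw [← Real.log_div ht0.ne' h.ne']; exact Real.log_le_sub_one_of_pos (div_pos ht0 h)
      have h₃ := mul_le_mul_of_nonneg_left h₁ hu
      have h₄ := mul_le_mul_of_nonneg_left h₂ hu
      have h₅ : u * (t / u - 1) = t - u := by field_simp
      have h₆ : u * (u / t - 1) = u / t * (u - t) := by field_simp
      have h₇ : u / t ≤ 1 / p := div_le_div₀ zero_le_one hu1 hp hpt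
      have h₈ : u / t * (u - t) ≤ 1 / p * |u - t| :=
        (mul_le_mul_of_nonneg_left (le_abs_self (u - t)) (by positivity)).trans
          (mul_le_mul_of_nonneg_right h₇ (abs_nonneg _))
      have h₉ : |u - t| ≤ 1 / p * |u - t| := le_mul_of_one_le_left (abs_nonneg _) h1p
      have h₁₀ := neg_abs_le (u - t)
      rw [abs_le]
      constructor <;> linarith
  have hdec : u * Real.log u - t * Real.log t =
      u * (Real.log u - Real.log t) + (u - t) * Real.log t := by ring
  rw [hdec]
  refine (abs_add_le _ _).trans ?_
  rw [abs_mul (u - t)]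
  have := mul_le_mul_of_nonneg_left hlog (abs_nonneg (u - t))
  have h₁ : 2 / p * |u - t| = 1 / p * |u - t| + |u - t| * (1 / p) := by ring
  linarith

variable {S A : Type*} [Fintype S] [Fintype A]

/-- Only `σ`, which will be the optimal policy, is kept away from zero; the oracle's policy may put
no mass on some actions. -/
theorem abs_entropy_sub_le {π σ : Policy S A} {p ε : ℝ} (hp : 0 < p) (hσ : ∀ s a, p ≤ σ.1 s a)
    (hε : ∀ s a, |π.1 s a - σ.1 s a| ≤ ε) (s : S) :
    |entropy π s - entropy σ s| ≤ Fintype.card A * (2 / p * ε) := by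
  rw [entropy, entropy, neg_sub_neg, abs_sub_comm, ← Finset.sum_sub_distrib]
  refine (Finset.abs_sum_le_sum_abs _ _).trans ?_
  refine (Finset.sum_le_sum (g := fun _ => 2 / p * ε) fun a _ => ?_).trans (by simp)
  refine (abs_mul_log_sub_le hp (hσ s a) (policy_le_one σ s a) ((π.2 s).1 a)
    (policy_le_one π s a)).trans ?_
  exact mul_le_mul_of_nonneg_left (hε s a) (by positivity)

theorem abs_sum_policy_mul_sub_le {π σ : Policy S A} {ε b e : ℝ}
    (hε : ∀ s a, |π.1 s a - σ.1 s a| ≤ ε) {g g' : A → ℝ} (hg' : ∀ a, |g' a| ≤ b)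
    (hg : ∀ a, |g a - g' a| ≤ e) (s : S) :
    |∑ a, π.1 s a * g a - ∑ a, σ.1 s a * g' a| ≤ Fintype.card A * (ε * b) + e := by
  have h : ∑ a, π.1 s a * g a - ∑ a, σ.1 s a * g' a =
      ∑ a, (π.1 s a - σ.1 s a) * g' a + ∑ a, π.1 s a * (g a - g' a) := by
    rw [← Finset.sum_sub_distrib, ← Finset.sum_add_distrib]
    exact Finset.sum_congr rfl fun a _ => by ring
  rw [h]
  refine (abs_add_le _ _).trans (add_le_add ?_ (abs_sum_simplex_mul_le (π.2 s) hg))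
  refine (Finset.abs_sum_le_sum_abs _ _).trans ?_
  refine (Finset.sum_le_sum (g := fun _ => ε * b) fun a _ => ?_).trans (by simp)
  rw [abs_mul]
  exact mul_le_mul (hε s a) (hg' a) (abs_nonneg _) ((abs_nonneg _).trans (hε s a))

theorem abs_avg_pairKernel_sub_le (m : MDP S A) {π σ : Policy S A} {ε b : ℝ}
    (hε : ∀ s a, |π.1 s a - σ.1 s a| ≤ ε) {g : S × A → ℝ} (hg : ∀ q, |g q| ≤ b) (q : S × A) :
    |avg (pairKernel m π) g q - avg (pairKernel m σ) g q| ≤ Fintype.card A * (ε * b) := by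
  rw [avg_pairKernel, avg_pairKernel, ← Finset.sum_sub_distrib]
  simp only [← mul_sub]
  refine abs_sum_simplex_mul_le (m.P_mem _ _) fun s' => ?_
  have := abs_sum_policy_mul_sub_le hε (g := fun a => g (s', a)) (g' := fun a => g (s', a))
    (e := 0) (fun a => hg _) (by simp) s'
  rwa [add_zero] at this

theorem abs_sum_mul_le_of_sum_abs_le {w v : S → ℝ} {K b : ℝ} (hw : ∑ s, |w s| ≤ K)
    (hb : 0 ≤ b) (hv : ∀ s, |v s| ≤ b) : |∑ s, w s * v s| ≤ K * b := by
  refine (Finset.abs_sum_le_sum_abs _ _).trans ((Finset.sum_le_sum (g := fun s => |w s| * b)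
    fun s _ => ?_).trans ?_)
  · rw [abs_mul]; exact mul_le_mul_of_nonneg_left (hv s) (abs_nonneg _)
  · rw [← Finset.sum_mul]; exact mul_le_mul_of_nonneg_right hw hb

variable (A) in
/-- A bound for soft action values. -/
def valueBound (γ lam R : ℝ) : ℝ := (R + lam * Fintype.card A) / (1 - γ)

variable (A) in
/-- A bound for derivatives of soft action values. -/
def gradBound (γ lam R K₁ K₂ : ℝ) : ℝ := (K₂ + K₁ * valueBound A γ lam R) / (1 - γ)

variable (A) in
/-- A lower bound for optimal action probabilities. -/
def policyBound (γ lam R : ℝ) : ℝ :=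
  Real.exp (-(2 * valueBound A γ lam R + lam * Fintype.card A) / lam)

variable (A) in
/-- Lipschitz constant at the optimal policy of the soft action values. -/
def valueLip (γ lam R : ℝ) : ℝ :=
  (lam * (Fintype.card A * (2 / policyBound A γ lam R)) +
    Fintype.card A * valueBound A γ lam R) / (1 - γ)

variable (A) in
/-- Lipschitz constant at the optimal policy of the derivatives of soft action values. -/
def gradLip (γ lam R K₁ K₂ : ℝ) : ℝ :=
  (K₁ * (Fintype.card A * valueBound A γ lam R + valueLip A γ lam R) +
    Fintype.card A * gradBound A γ lam R K₁ K₂) / (1 - γ)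

variable {γ lam R K₁ K₂ : ℝ} {m : MDP S A} {π σ : Policy S A}

/-- The summed bound on `dP` is the natural one: derivatives of transition probabilities are
probabilities times scores, so no factor of the number of states arises. -/
theorem abs_dqValue_le (hγ : 0 ≤ γ) (hγ1 : γ < 1) (hlam : 0 < lam) (hR : 0 ≤ R)
    (hr : ∀ s a, |m.r s a| ≤ R) {dr : S → A → ℝ} {dP : S → A → S → ℝ}
    (hdr : ∀ s a, |dr s a| ≤ K₂) (hdP : ∀ s a, ∑ s', |dP s a s'| ≤ K₁) (q : S × A) :
    |dqValue m π γ lam dr dP q| ≤ gradBound A γ lam R K₁ K₂ := by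
  refine abs_resolvent_le hγ hγ1 (pairKernel_mem m π) (fun q => ?_) q
  refine (abs_add_le _ _).trans (add_le_add (hdr _ _) ?_)
  have hv : 0 ≤ valueBound A γ lam R := div_nonneg (by positivity) (by linarith)
  have h := abs_sum_mul_le_of_sum_abs_le (hdP q.1 q.2) hv fun s' =>
    abs_sum_simplex_mul_le (π.2 s') fun a' => abs_qValue_le m π hγ hγ1 hlam hr (s', a')
  rw [abs_mul, abs_of_nonneg hγ]
  exact (mul_le_of_le_one_left (abs_nonneg _) hγ1.le).trans h

theorem abs_qValue_sub_le (hγ : 0 ≤ γ) (hγ1 : γ < 1) (hlam : 0 < lam)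
    (hr : ∀ s a, |m.r s a| ≤ R) {ε : ℝ} (hε : ∀ s a, |π.1 s a - σ.1 s a| ≤ ε)
    (hσ : ∀ s a, policyBound A γ lam R ≤ σ.1 s a) (q : S × A) :
    |qValue m π γ lam q - qValue m σ γ lam q| ≤ valueLip A γ lam R * ε := by
  refine (abs_resolvent_sub_le hγ hγ1 (pairKernel_mem m π) (pairKernel_mem m σ)
    (b₁ := lam * (Fintype.card A * (2 / policyBound A γ lam R * ε))) (fun q => ?_)
    (abs_avg_pairKernel_sub_le m hε (abs_qValue_le m σ hγ hγ1 hlam hr)) q).trans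
    (le_of_eq (b := valueLip A γ lam R * ε) ?_)
  · simp only [softReward, add_sub_add_left_eq_sub, ← mul_sub]
    rw [abs_mul, abs_of_pos hlam]
    exact mul_le_mul_of_nonneg_left (abs_entropy_sub_le (Real.exp_pos _) hσ hε _) hlam.le
  · rw [valueLip, valueBound]; ring

/-- The resolvent perturbation estimate is used at two levels: the source of this discounted sum
contains the action value, whose own perturbation is `abs_qValue_sub_le`. -/
theorem abs_dqValue_sub_le (hγ : 0 ≤ γ) (hγ1 : γ < 1) (hlam : 0 < lam) (hR : 0 ≤ R)
    (hr : ∀ s a, |m.r s a| ≤ R) {dr : S → A → ℝ} {dP : S → A → S → ℝ}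
    (hdr : ∀ s a, |dr s a| ≤ K₂) (hdP : ∀ s a, ∑ s', |dP s a s'| ≤ K₁) {ε : ℝ} (hε0 : 0 ≤ ε)
    (hε : ∀ s a, |π.1 s a - σ.1 s a| ≤ ε)
    (hσ : ∀ s a, policyBound A γ lam R ≤ σ.1 s a) (q : S × A) :
    |dqValue m π γ lam dr dP q - dqValue m σ γ lam dr dP q| ≤ gradLip A γ lam R K₁ K₂ * ε := by
  have hv : 0 ≤ valueBound A γ lam R := div_nonneg (by positivity) (by linarith)
  have hp : 0 < policyBound A γ lam R := Real.exp_pos _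
  have hl : 0 ≤ valueLip A γ lam R := div_nonneg (by positivity) (by linarith)
  refine (abs_resolvent_sub_le hγ hγ1 (pairKernel_mem m π) (pairKernel_mem m σ)
    (b₁ := K₁ * (Fintype.card A * (ε * valueBound A γ lam R) + valueLip A γ lam R * ε))
    (fun q => ?_)
    (abs_avg_pairKernel_sub_le m hε (abs_dqValue_le hγ hγ1 hlam hR hr hdr hdP)) q).trans
    (le_of_eq (b := gradLip A γ lam R K₁ K₂ * ε) ?_)
  · rw [add_sub_add_left_eq_sub, ← mul_sub, ← Finset.sum_sub_distrib]
    simp only [← mul_sub]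
    rw [abs_mul, abs_of_nonneg hγ]
    refine (mul_le_of_le_one_left (abs_nonneg _) hγ1.le).trans ?_
    refine abs_sum_mul_le_of_sum_abs_le (hdP _ _) (by positivity) fun s' => ?_
    exact abs_sum_policy_mul_sub_le hε (fun a => abs_qValue_le m σ hγ hγ1 hlam hr (s', a))
      (fun a => abs_qValue_sub_le hγ hγ1 hlam hr hε hσ (s', a)) s'
  · rw [gradLip]; ring

end Perturbation

/-! ### Consequences of the regularity assumptions; the Lipschitz estimate for the hypergradient. -/

section Regularity

variable {S A : Type*} [Fintype S] [DecidableEq S] [Fintype A] [DecidableEq A]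
  {d : ℕ} {Ξ : Type*} [MeasurableSpace Ξ] {M : (Fin d → ℝ) → Ξ → MDP S A}
  {f : (Fin d → ℝ) → (S → A → ℝ) → Ξ → ℝ} {Pξ : Measure Ξ} {U : Set (S → A → ℝ)}
  {γ lam Lf Sf R K₁ K₂ : ℝ}

namespace Regular

variable (h : Regular M f Pξ U Lf Sf R K₁ K₂)
include h

theorem abs_r_le (x : Fin d → ℝ) (ξ : Ξ) (s : S) (a : A) : |(M x ξ).r s a| ≤ R :=
  (h.r_bound x ξ s a).le

theorem R_nonneg [Nonempty S] [Nonempty A] [Nonempty Ξ] : 0 ≤ R :=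
  (abs_nonneg _).trans (h.abs_r_le 0 (Classical.arbitrary Ξ) (Classical.arbitrary S)
    (Classical.arbitrary A))

theorem K₂_nonneg [Nonempty S] [Nonempty A] [Nonempty Ξ] : 0 ≤ K₂ :=
  (norm_nonneg _).trans (h.r_grad 0 (Classical.arbitrary Ξ) (Classical.arbitrary S)
    (Classical.arbitrary A)).le

theorem K₁_nonneg [Nonempty S] [Nonempty A] [Nonempty Ξ] : 0 ≤ K₁ := by
  set m := M 0 (Classical.arbitrary Ξ)
  obtain ⟨s', -, hs'⟩ := Finset.exists_lt_of_sum_lt (s := Finset.univ)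
    (f := fun _ : S => (0 : ℝ)) (g := m.P (Classical.arbitrary S) (Classical.arbitrary A))
    (by rw [(m.P_mem _ _).2]; simp)
  exact (norm_nonneg _).trans (h.P_grad _ _ _ _ _ hs').le

/-- An open set around a policy contains other points. Lipschitz inequalities between distinct
points then force `Lf` and `Sf` to be nonnegative, which is not assumed. -/
theorem exists_mem_ne [Nonempty S] [Nonempty A] :
    ∃ π₁ ∈ U, ∃ π₂ ∈ U, 0 < ‖π₁ - π₂‖ := by
  obtain ⟨π⟩ : Nonempty (Policy S A) := inferInstance
  have h₁ : U ∈ nhdsWithin π.1 {π.1}ᶜ :=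
    mem_nhdsWithin_of_mem_nhds (h.isOpen_U.mem_nhds (h.policy_mem π))
  obtain ⟨ρ, hρ, hne⟩ := Filter.NeBot.nonempty_of_mem inferInstance
    (Filter.inter_mem h₁ self_mem_nhdsWithin)
  exact ⟨ρ, hρ, π.1, h.policy_mem π, norm_pos_iff.2 (sub_ne_zero.2 hne)⟩

theorem Lf_nonneg [Nonempty S] [Nonempty A] [Nonempty Ξ] : 0 ≤ Lf := by
  obtain ⟨π₁, h₁, π₂, h₂, hpos⟩ := h.exists_mem_ne
  have := (abs_nonneg _).trans (h.f_lip (Classical.arbitrary Ξ) 0 0 π₁ h₁ π₂ h₂)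
  rw [sub_self, norm_zero, zero_add] at this
  exact nonneg_of_mul_nonneg_left this hpos

theorem Sf_nonneg [Nonempty S] [Nonempty A] [Nonempty Ξ] : 0 ≤ Sf := by
  obtain ⟨π₁, h₁, π₂, h₂, hpos⟩ := h.exists_mem_ne
  have := (norm_nonneg _).trans (h.f_smooth_x (Classical.arbitrary Ξ) 0 0 π₁ h₁ π₂ h₂)
  rw [sub_self, norm_zero, zero_add] at this
  exact nonneg_of_mul_nonneg_left this hpos

theorem abs_grad_f_le (hLf : 0 ≤ Lf) (x : Fin d → ℝ) (ξ : Ξ) (π : Policy S A) (i : Fin d) :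
    |grad (fun y => f y π.1 ξ) x i| ≤ Lf := by
  have h₁ : ‖fderiv ℝ (fun y => f y π.1 ξ) x‖ ≤ Lf :=
    norm_fderiv_le_of_lip' ℝ hLf (Filter.Eventually.of_forall fun y => by
      have := h.f_lip ξ y x π.1 (h.policy_mem π) π.1 (h.policy_mem π)
      rwa [sub_self, norm_zero, add_zero] at this)
  refine ((fderiv ℝ (fun y => f y π.1 ξ) x).le_of_opNorm_le h₁ (Pi.single i 1)).trans ?_
  rw [Pi.norm_single]; simp

theorem abs_gradPi_f_le (hLf : 0 ≤ Lf) (x : Fin d → ℝ) (ξ : Ξ) (π : Policy S A) (s : S) (a : A) :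
    |gradPi (fun ρ => f x ρ ξ) π.1 s a| ≤ Lf := by
  have h₁ : ‖fderiv ℝ (fun ρ => f x ρ ξ) π.1‖ ≤ Lf := by
    refine norm_fderiv_le_of_lip' ℝ hLf ?_
    filter_upwards [h.isOpen_U.mem_nhds (h.policy_mem π)] with ρ hρ
    have := h.f_lip ξ x x ρ hρ π.1 (h.policy_mem π)
    rwa [sub_self, norm_zero, zero_add] at this
  refine ((fderiv ℝ (fun ρ => f x ρ ξ) π.1).le_of_opNorm_le h₁
    (Pi.single s (Pi.single a 1))).trans ?_
  rw [Pi.norm_single, Pi.norm_single]; simp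

theorem abs_grad_r_le (x : Fin d → ℝ) (ξ : Ξ) (s : S) (a : A) (i : Fin d) :
    |grad (fun y => (M y ξ).r s a) x i| ≤ K₂ :=
  abs_le_of_norm_le (h.r_grad x ξ s a).le i

theorem mul_grad_log_P (x : Fin d → ℝ) (ξ : Ξ) (s : S) (a : A) (s' : S) (i : Fin d) :
    (M x ξ).P s a s' * grad (fun y => Real.log ((M y ξ).P s a s')) x i =
      grad (fun y => (M y ξ).P s a s') x i :=
  mul_grad_log (h.P_diff ξ s a s') (fun y => ((M y ξ).P_mem s a).1 s') x i

/-- The assumption covers positive probabilities only; where the probability is zero, `grad_log`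
gives the value zero. -/
theorem abs_grad_log_P_le (hK₁ : 0 ≤ K₁) (x : Fin d → ℝ) (ξ : Ξ) (s : S) (a : A) (s' : S)
    (i : Fin d) : |grad (fun y => Real.log ((M y ξ).P s a s')) x i| ≤ K₁ := by
  rcases (((M x ξ).P_mem s a).1 s').eq_or_lt with h0 | h0
  · rw [grad_log (h.P_diff ξ s a s') (fun y => ((M y ξ).P_mem s a).1 s'), ← h0]
    simpa using hK₁
  · exact abs_le_of_norm_le (h.P_grad x ξ s a s' h0).le i

/-- By the score identity the sum is an average of absolute scores under the transition law. -/
theorem sum_abs_grad_P_le (hK₁ : 0 ≤ K₁) (x : Fin d → ℝ) (ξ : Ξ) (s : S) (a : A) (i : Fin d) :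
    ∑ s', |grad (fun y => (M y ξ).P s a s') x i| ≤ K₁ := by
  simp only [← h.mul_grad_log_P, abs_mul, abs_of_nonneg (((M x ξ).P_mem s a).1 _)]
  exact sum_simplex_mul_le ((M x ξ).P_mem s a) fun s' => h.abs_grad_log_P_le hK₁ x ξ s a s' i

variable [Nonempty S] [Nonempty A]

theorem abs_gradQ_le (hγ : 0 ≤ γ) (hγ1 : γ < 1) (hlam : 0 < lam) (x : Fin d → ℝ) (ξ : Ξ)
    (π : Policy S A) (i : Fin d) (q : S × A) :
    |gradQ M γ lam x ξ π i q| ≤ gradBound A γ lam R K₁ K₂ := by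
  have : Nonempty Ξ := ⟨ξ⟩
  exact abs_dqValue_le hγ hγ1 hlam h.R_nonneg (h.abs_r_le x ξ)
    (fun s a => h.abs_grad_r_le x ξ s a i)
    (fun s a => h.sum_abs_grad_P_le h.K₁_nonneg x ξ s a i) q

theorem policyBound_le_optPolicy (hγ : 0 ≤ γ) (hγ1 : γ < 1) (hlam : 0 < lam) (x : Fin d → ℝ)
    (ξ : Ξ) (s : S) (a : A) : policyBound A γ lam R ≤ ((M x ξ).optPolicy γ lam).1 s a := by
  rw [optPolicy_eq _ hγ hγ1 hlam]
  exact exp_le_softmaxPolicy (M x ξ) hγ hγ1 hlam (h.abs_r_le x ξ) s a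

theorem abs_gradQ_sub_le (hγ : 0 ≤ γ) (hγ1 : γ < 1) (hlam : 0 < lam) (x : Fin d → ℝ) (ξ : Ξ)
    (π : Policy S A) (i : Fin d) (q : S × A) :
    |gradQ M γ lam x ξ π i q - gradQ M γ lam x ξ ((M x ξ).optPolicy γ lam) i q| ≤
      gradLip A γ lam R K₁ K₂ * ‖((M x ξ).optPolicy γ lam).1 - π.1‖ := by
  have : Nonempty Ξ := ⟨ξ⟩
  refine abs_dqValue_sub_le hγ hγ1 hlam h.R_nonneg (h.abs_r_le x ξ)
    (fun s a => h.abs_grad_r_le x ξ s a i)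
    (fun s a => h.sum_abs_grad_P_le h.K₁_nonneg x ξ s a i) (norm_nonneg _) (fun s a => ?_)
    (h.policyBound_le_optPolicy hγ hγ1 hlam x ξ) q
  rw [abs_sub_comm]
  exact (norm_le_pi_norm ((((M x ξ).optPolicy γ lam).1 - π.1) s) a).trans
    (norm_le_pi_norm (((M x ξ).optPolicy γ lam).1 - π.1) s)

theorem gradBound_nonneg [Nonempty Ξ] (hγ1 : γ < 1) (hlam : 0 < lam) :
    0 ≤ gradBound A γ lam R K₁ K₂ := by
  have h₁ := h.R_nonneg
  have h₂ := h.K₁_nonneg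
  have h₃ := h.K₂_nonneg
  have hv : 0 ≤ valueBound A γ lam R := div_nonneg (by positivity) (by linarith)
  exact div_nonneg (by positivity) (by linarith)

theorem gradLip_nonneg [Nonempty Ξ] (hγ1 : γ < 1) (hlam : 0 < lam) :
    0 ≤ gradLip A γ lam R K₁ K₂ := by
  have h₁ := h.R_nonneg
  have h₂ := h.K₁_nonneg
  have hv : 0 ≤ valueBound A γ lam R := div_nonneg (by positivity) (by linarith)
  have hp : 0 < policyBound A γ lam R := Real.exp_pos _
  have hl : 0 ≤ valueLip A γ lam R := div_nonneg (by positivity) (by linarith)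
  have hG := h.gradBound_nonneg hγ1 hlam
  exact div_nonneg (by positivity) (by linarith)

theorem abs_advantage_le (hγ : 0 ≤ γ) (hγ1 : γ < 1) (hlam : 0 < lam) (x : Fin d → ℝ) (ξ : Ξ)
    (π : Policy S A) (i : Fin d) (s : S) (a : A) :
    |gradQ M γ lam x ξ π i (s, a) - ∑ b, π.1 s b * gradQ M γ lam x ξ π i (s, b)| ≤
      2 * gradBound A γ lam R K₁ K₂ := by
  have h₁ := h.abs_gradQ_le hγ hγ1 hlam x ξ π i (s, a)
  have h₂ := abs_sum_simplex_mul_le (π.2 s) fun b => h.abs_gradQ_le hγ hγ1 hlam x ξ π i (s, b)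
  exact (abs_sub _ _).trans (by linarith)

end Regular

variable (S A) in
/-- A bound for hypergradients. -/
def hyperGradBound (γ lam Lf R K₁ K₂ : ℝ) : ℝ :=
  Lf + Fintype.card S * (Fintype.card A * (1 / lam * Lf * (2 * gradBound A γ lam R K₁ K₂)))

variable (S A) in
/-- Lipschitz constant of the hypergradient at the optimal policy. -/
def hyperGradLip (γ lam Lf Sf R K₁ K₂ : ℝ) : ℝ :=
  Sf + Fintype.card S * (Fintype.card A * (1 / lam *
    ((Lf + Sf) * (2 * gradBound A γ lam R K₁ K₂) +
      Lf * (2 * gradLip A γ lam R K₁ K₂ + Fintype.card A * gradBound A γ lam R K₁ K₂))))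

namespace Regular

variable (h : Regular M f Pξ U Lf Sf R K₁ K₂) [Nonempty S] [Nonempty A]
include h

theorem abs_hyperGrad_le (hγ : 0 ≤ γ) (hγ1 : γ < 1) (hlam : 0 < lam) (x : Fin d → ℝ) (ξ : Ξ)
    (π : Policy S A) (i : Fin d) :
    |hyperGrad M f γ lam x ξ π i| ≤ hyperGradBound S A γ lam Lf R K₁ K₂ := by
  have : Nonempty Ξ := ⟨ξ⟩
  have hLf := h.Lf_nonneg
  refine (abs_add_le _ _).trans (add_le_add (h.abs_grad_f_le hLf x ξ π i) ?_)
  refine (Finset.abs_sum_le_sum_abs _ _).trans ((Finset.sum_le_sum (g := fun _ =>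
    Fintype.card A * (1 / lam * Lf * (2 * gradBound A γ lam R K₁ K₂))) fun s _ => ?_).trans
      (by simp))
  refine (Finset.abs_sum_le_sum_abs _ _).trans ((Finset.sum_le_sum (g := fun _ =>
    (1 / lam * Lf * (2 * gradBound A γ lam R K₁ K₂))) fun a _ => ?_).trans (by simp))
  rw [abs_mul, abs_mul, abs_mul, abs_of_nonneg ((π.2 s).1 a), abs_of_nonneg
    (by positivity : 0 ≤ 1 / lam)]
  refine mul_le_mul (mul_le_mul (mul_le_of_le_one_left (by positivity) (policy_le_one π s a))
    (h.abs_gradPi_f_le hLf x ξ π s a) (abs_nonneg _) (by positivity))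
    (h.abs_advantage_le hγ hγ1 hlam x ξ π i s a) (abs_nonneg _) (by positivity)

theorem hyperGradLip_nonneg [Nonempty Ξ] (hγ1 : γ < 1) (hlam : 0 < lam) :
    0 ≤ hyperGradLip S A γ lam Lf Sf R K₁ K₂ := by
  have h₁ := h.Lf_nonneg
  have h₂ := h.Sf_nonneg
  have h₃ := h.gradBound_nonneg hγ1 hlam
  have h₄ := h.gradLip_nonneg hγ1 hlam
  unfold hyperGradLip
  positivity

theorem abs_hyperGrad_sub_le (hγ : 0 ≤ γ) (hγ1 : γ < 1) (hlam : 0 < lam) (x : Fin d → ℝ) (ξ : Ξ)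
    (π : Policy S A) (i : Fin d) :
    |hyperGrad M f γ lam x ξ π i - hyperGrad M f γ lam x ξ ((M x ξ).optPolicy γ lam) i| ≤
      hyperGradLip S A γ lam Lf Sf R K₁ K₂ * ‖((M x ξ).optPolicy γ lam).1 - π.1‖ := by
  have : Nonempty Ξ := ⟨ξ⟩
  have hLf := h.Lf_nonneg
  have hSf := h.Sf_nonneg
  have hG := h.gradBound_nonneg hγ1 hlam
  have hL := h.gradLip_nonneg hγ1 hlam
  set σ := (M x ξ).optPolicy γ lam with hσ
  set ε := ‖σ.1 - π.1‖ with hε_def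
  have hε0 : 0 ≤ ε := norm_nonneg _
  have hε : ∀ s a, |π.1 s a - σ.1 s a| ≤ ε := fun s a => by
    rw [abs_sub_comm]
    exact (norm_le_pi_norm ((σ.1 - π.1) s) a).trans (norm_le_pi_norm (σ.1 - π.1) s)
  have hx : |grad (fun y => f y π.1 ξ) x i - grad (fun y => f y σ.1 ξ) x i| ≤ Sf * ε := by
    have h₁ := h.f_smooth_x ξ x x π.1 (h.policy_mem π) σ.1 (h.policy_mem σ)
    rw [sub_self, norm_zero, zero_add, norm_sub_rev π.1] at h₁
    exact (norm_le_pi_norm (grad (fun y => f y π.1 ξ) x - grad (fun y => f y σ.1 ξ) x) i).trans h₁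
  have hpi : ∀ s a, |gradPi (fun ρ => f x ρ ξ) π.1 s a - gradPi (fun ρ => f x ρ ξ) σ.1 s a| ≤
      Sf * ε := fun s a => by
    have h₁ := h.f_smooth_pi ξ x x π.1 (h.policy_mem π) σ.1 (h.policy_mem σ)
    rw [sub_self, norm_zero, zero_add, norm_sub_rev π.1] at h₁
    exact (norm_le_pi_norm ((gradPi (fun ρ => f x ρ ξ) π.1 - gradPi (fun ρ => f x ρ ξ) σ.1) s)
      a).trans ((norm_le_pi_norm (gradPi (fun ρ => f x ρ ξ) π.1 - gradPi (fun ρ => f x ρ ξ) σ.1)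
        s).trans h₁)
  have hadv : ∀ s a,
      |(gradQ M γ lam x ξ π i (s, a) - ∑ b, π.1 s b * gradQ M γ lam x ξ π i (s, b)) -
        (gradQ M γ lam x ξ σ i (s, a) - ∑ b, σ.1 s b * gradQ M γ lam x ξ σ i (s, b))| ≤
      (2 * gradLip A γ lam R K₁ K₂ + Fintype.card A * gradBound A γ lam R K₁ K₂) * ε := by
    intro s a
    have h₁ := h.abs_gradQ_sub_le hγ hγ1 hlam x ξ π i (s, a)
    have h₂ := abs_sum_policy_mul_sub_le hε (g := fun b => gradQ M γ lam x ξ π i (s, b))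
      (g' := fun b => gradQ M γ lam x ξ σ i (s, b))
      (fun b => h.abs_gradQ_le hγ hγ1 hlam x ξ σ i (s, b))
      (fun b => h.abs_gradQ_sub_le hγ hγ1 hlam x ξ π i (s, b)) s
    rw [sub_sub_sub_comm]
    refine (abs_sub _ _).trans ((add_le_add h₁ h₂).trans (le_of_eq ?_))
    ring
  simp only [hyperGrad]
  rw [add_sub_add_comm, ← Finset.sum_sub_distrib]
  simp only [← Finset.sum_sub_distrib]
  have hterm : ∀ s a, |π.1 s a * (1 / lam) * gradPi (fun ρ => f x ρ ξ) π.1 s a *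
      (gradQ M γ lam x ξ π i (s, a) - ∑ b, π.1 s b * gradQ M γ lam x ξ π i (s, b)) -
      σ.1 s a * (1 / lam) * gradPi (fun ρ => f x ρ ξ) σ.1 s a *
      (gradQ M γ lam x ξ σ i (s, a) - ∑ b, σ.1 s b * gradQ M γ lam x ξ σ i (s, b))| ≤
      1 / lam * ((Lf + Sf) * (2 * gradBound A γ lam R K₁ K₂) +
      Lf * (2 * gradLip A γ lam R K₁ K₂ + Fintype.card A * gradBound A γ lam R K₁ K₂)) * ε := by
    intro s a
    have a₁ := h.abs_advantage_le hγ hγ1 hlam x ξ π i s a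
    have a₂ := hadv s a
    have a₃ := hpi s a
    have a₄ := h.abs_gradPi_f_le hLf x ξ π s a
    have a₅ := h.abs_gradPi_f_le hLf x ξ σ s a
    have a₆ := hε s a
    have a₇ : |σ.1 s a| ≤ 1 := by
      rw [abs_of_nonneg ((σ.2 s).1 a)]; exact policy_le_one σ s a
    generalize gradQ M γ lam x ξ π i (s, a) - ∑ b, π.1 s b * gradQ M γ lam x ξ π i (s, b) = D₁
      at *
    generalize gradQ M γ lam x ξ σ i (s, a) - ∑ b, σ.1 s b * gradQ M γ lam x ξ σ i (s, b) = D₂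
      at *
    generalize gradPi (fun ρ => f x ρ ξ) π.1 s a = φ₁ at *
    generalize gradPi (fun ρ => f x ρ ξ) σ.1 s a = φ₂ at *
    generalize π.1 s a = p₁ at *
    generalize σ.1 s a = p₂ at *
    -- The product is changed one factor at a time: policy, derivative of the loss, advantage. Each
    -- difference is of order `ε` and the other factors are bounded.
    have hdec : p₁ * (1 / lam) * φ₁ * D₁ - p₂ * (1 / lam) * φ₂ * D₂ =
        1 / lam * ((p₁ - p₂) * φ₁ * D₁ + p₂ * (φ₁ - φ₂) * D₁ + p₂ * φ₂ * (D₁ - D₂)) := by ring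
    rw [hdec, abs_mul, abs_of_nonneg (by positivity : 0 ≤ 1 / lam)]
    refine (mul_le_mul_of_nonneg_left ?_ (by positivity : 0 ≤ 1 / lam)).trans
      (le_of_eq (mul_assoc _ _ _).symm)
    have b₁ : |(p₁ - p₂) * φ₁ * D₁| ≤ ε * Lf * (2 * gradBound A γ lam R K₁ K₂) := by
      rw [abs_mul, abs_mul]; gcongr
    have b₂ : |p₂ * (φ₁ - φ₂) * D₁| ≤ 1 * (Sf * ε) * (2 * gradBound A γ lam R K₁ K₂) := by
      rw [abs_mul, abs_mul]; gcongr
    have b₃ : |p₂ * φ₂ * (D₁ - D₂)| ≤ 1 * Lf *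
        ((2 * gradLip A γ lam R K₁ K₂ + Fintype.card A * gradBound A γ lam R K₁ K₂) * ε) := by
      rw [abs_mul, abs_mul]; gcongr
    refine (abs_add_three _ _ _).trans ((add_le_add (add_le_add b₁ b₂) b₃).trans (le_of_eq ?_))
    ring
  refine (abs_add_le _ _).trans ?_
  have hsum := (Finset.abs_sum_le_sum_abs (s := Finset.univ) (fun s => ∑ a,
    (π.1 s a * (1 / lam) * gradPi (fun ρ => f x ρ ξ) π.1 s a *
      (gradQ M γ lam x ξ π i (s, a) - ∑ b, π.1 s b * gradQ M γ lam x ξ π i (s, b)) -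
      σ.1 s a * (1 / lam) * gradPi (fun ρ => f x ρ ξ) σ.1 s a *
      (gradQ M γ lam x ξ σ i (s, a) - ∑ b, σ.1 s b * gradQ M γ lam x ξ σ i (s, b))))).trans
    (Finset.sum_le_sum fun s _ => (Finset.abs_sum_le_sum_abs _ _).trans
      (Finset.sum_le_sum fun a _ => hterm s a))
  refine (add_le_add hx hsum).trans (le_of_eq ?_)
  simp only [Finset.sum_const, Finset.card_univ, nsmul_eq_mul, hyperGradLip]
  ring

end Regular

end Regularity

/-! ### Joint measurability in iterate, context and policy. -/

section Measurability

theorem tendsto_norm_natCast_atTop :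
    Filter.Tendsto (fun n : ℕ => ‖(n : ℝ)‖) Filter.atTop Filter.atTop := by
  simpa using tendsto_natCast_atTop_atTop (R := ℝ)

/-- A partial derivative is the pointwise limit of measurable difference quotients with increments
$1/n$. -/
theorem measurable_grad {d : ℕ} {Ξ : Type*} [MeasurableSpace Ξ] {u : (Fin d → ℝ) → Ξ → ℝ}
    (hm : Measurable (Function.uncurry u)) (hu : ∀ ξ, Differentiable ℝ fun x => u x ξ)
    (i : Fin d) : Measurable fun z : (Fin d → ℝ) × Ξ => grad (fun y => u y z.2) z.1 i := by
  refine measurable_of_tendsto_metrizable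
    (f := fun (n : ℕ) (z : (Fin d → ℝ) × Ξ) =>
      (n : ℝ) • (u (z.1 + (n : ℝ)⁻¹ • Pi.single i 1) z.2 - u z.1 z.2)) (fun n => ?_) ?_
  · have h₁ := hm.comp (g := Function.uncurry u)
        (f := fun z : (Fin d → ℝ) × Ξ => (z.1 + (n : ℝ)⁻¹ • Pi.single i 1, z.2)) (by fun_prop)
    exact (h₁.sub hm).const_smul (n : ℝ)
  · exact tendsto_pi_nhds.2 fun z =>
      (hu z.2 z.1).hasFDerivAt.lim (Pi.single i 1) tendsto_norm_natCast_atTop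

theorem measurable_iterate_avg {Θ Y : Type*} [MeasurableSpace Θ] [Fintype Y]
    {K : Θ → Y → Y → ℝ} {g : Θ → Y → ℝ} (hK : ∀ y y', Measurable fun θ => K θ y y')
    (hg : ∀ y, Measurable fun θ => g θ y) (t : ℕ) (y : Y) :
    Measurable fun θ => ((avg (K θ))^[t] (g θ)) y := by
  induction t generalizing y with
  | zero => exact hg y
  | succ t ih =>
    simp only [Function.iterate_succ_apply']
    exact Finset.measurable_fun_sum _ fun y' _ => (hK y y').mul (ih y')

theorem measurable_resolvent {Θ Y : Type*} [MeasurableSpace Θ] [Fintype Y] {γ : ℝ} (hγ : 0 ≤ γ)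
    (hγ1 : γ < 1) {K : Θ → Y → Y → ℝ} {g : Θ → Y → ℝ} (hK : ∀ y y', Measurable fun θ => K θ y y')
    (hKs : ∀ θ y, K θ y ∈ stdSimplex ℝ Y) (hg : ∀ y, Measurable fun θ => g θ y) (y : Y) :
    Measurable fun θ => resolvent γ (K θ) (g θ) y :=
  measurable_of_tendsto_metrizable
    (f := fun (n : ℕ) θ => ∑ t ∈ Finset.range n, γ ^ t * ((avg (K θ))^[t] (g θ)) y)
    (fun _ => Finset.measurable_fun_sum _ fun t _ =>
      (measurable_iterate_avg hK hg t y).const_mul _)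
    (tendsto_pi_nhds.2 fun θ =>
      (summable_resolvent hγ hγ1 (hKs θ) (g θ) y).hasSum.tendsto_sum_nat)

variable {S A : Type*} [Fintype S] [DecidableEq S] [Fintype A] [DecidableEq A]
  {d : ℕ} {Ξ : Type*} [MeasurableSpace Ξ] {M : (Fin d → ℝ) → Ξ → MDP S A}
  {f : (Fin d → ℝ) → (S → A → ℝ) → Ξ → ℝ} {Pξ : Measure Ξ} {U : Set (S → A → ℝ)}
  {γ lam Lf Sf R K₁ K₂ : ℝ}

theorem measurable_policy_apply (s : S) (a : A) : Measurable fun π : Policy S A => π.1 s a :=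
  (measurable_pi_apply a).comp ((measurable_pi_apply s).comp measurable_subtype_coe)

theorem measurable_entropy (s : S) : Measurable fun π : Policy S A => entropy π s :=
  (Finset.measurable_fun_sum _ fun a _ => (measurable_policy_apply s a).mul
    (Real.measurable_log.comp (measurable_policy_apply s a))).neg

namespace Regular

variable (h : Regular M f Pξ U Lf Sf R K₁ K₂)
include h

theorem measurable_r (s : S) (a : A) :
    Measurable fun z : (Fin d → ℝ) × Ξ => (M z.1 z.2).r s a :=
  measurable_uncurry_of_continuous_of_measurable (u := fun x ξ => (M x ξ).r s a)
    (fun ξ => (h.r_diff ξ s a).continuous) (fun x => h.r_meas x s a)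

theorem measurable_P (s : S) (a : A) (s' : S) :
    Measurable fun z : (Fin d → ℝ) × Ξ => (M z.1 z.2).P s a s' :=
  measurable_uncurry_of_continuous_of_measurable (u := fun x ξ => (M x ξ).P s a s')
    (fun ξ => (h.P_diff ξ s a s').continuous) (fun x => h.P_meas x s a s')

theorem measurable_grad_r (s : S) (a : A) (i : Fin d) :
    Measurable fun z : (Fin d → ℝ) × Ξ => grad (fun y => (M y z.2).r s a) z.1 i :=
  measurable_grad (u := fun x ξ => (M x ξ).r s a) (h.measurable_r s a)
    (fun ξ => h.r_diff ξ s a) i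

theorem measurable_grad_P (s : S) (a : A) (s' : S) (i : Fin d) :
    Measurable fun z : (Fin d → ℝ) × Ξ => grad (fun y => (M y z.2).P s a s') z.1 i :=
  measurable_grad (u := fun x ξ => (M x ξ).P s a s') (h.measurable_P s a s')
    (fun ξ => h.P_diff ξ s a s') i

theorem measurable_grad_log_P (s : S) (a : A) (s' : S) (i : Fin d) :
    Measurable fun z : (Fin d → ℝ) × Ξ =>
      grad (fun y => Real.log ((M y z.2).P s a s')) z.1 i := by
  simp only [grad_log (h.P_diff _ s a s') (fun y => ((M y _).P_mem s a).1 s'), Pi.smul_apply,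
    smul_eq_mul]
  exact (h.measurable_P s a s').inv.mul (h.measurable_grad_P s a s' i)

open Classical in
/-- The loss, cut off outside `U`, is jointly measurable. -/
theorem measurable_cutoff : Measurable fun z : ((Fin d → ℝ) × (S → A → ℝ)) × Ξ =>
    if z.1.2 ∈ U then f z.1.1 z.1.2 z.2 else 0 := by
  have hU : MeasurableSet {z : ((Fin d → ℝ) × (S → A → ℝ)) × Ξ | z.1.2 ∈ U} :=
    h.isOpen_U.measurableSet.preimage (measurable_snd.comp measurable_fst)
  refine measurable_of_restrict_of_restrict_compl hU ?_ ?_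
  -- On `U` the loss is a Carathéodory function: continuous in iterate and policy, measurable in the
  -- context.
  · have h₁ : Measurable (Function.uncurry fun (p : (Fin d → ℝ) × U) (ξ : Ξ) => f p.1 p.2.1 ξ) := by
      refine measurable_uncurry_of_continuous_of_measurable (fun ξ => ?_)
        (fun p => h.f_meas p.1 p.2.1 p.2.2)
      refine continuous_iff_continuousAt.2 fun p => ?_
      exact ContinuousAt.comp (f := fun p : (Fin d → ℝ) × U => (p.1, p.2.1))
        (g := fun q : (Fin d → ℝ) × (S → A → ℝ) => f q.1 q.2 ξ)
        (h.f_diff ξ p.1 p.2.1 p.2.2).continuousAt (by fun_prop)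
    have h₂ : Measurable fun z : {z : ((Fin d → ℝ) × (S → A → ℝ)) × Ξ | z.1.2 ∈ U} =>
        (((z.1.1.1, ⟨z.1.1.2, z.2⟩), z.1.2) : ((Fin d → ℝ) × U) × Ξ) := by
      refine Measurable.prodMk (Measurable.prodMk ?_ (Measurable.subtype_mk ?_)) ?_ <;> fun_prop
    convert h₁.comp h₂ using 1
    funext z
    exact if_pos z.2
  · convert measurable_const (a := (0 : ℝ)) using 1
    funext z
    exact if_neg z.2

theorem measurable_f : Measurable fun z : ((Fin d → ℝ) × Ξ) × Policy S A => f z.1.1 z.2.1 z.1.2 := by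
  classical
  convert h.measurable_cutoff.comp (g := fun z : ((Fin d → ℝ) × (S → A → ℝ)) × Ξ =>
      if z.1.2 ∈ U then f z.1.1 z.1.2 z.2 else 0)
    (f := fun z : ((Fin d → ℝ) × Ξ) × Policy S A => ((z.1.1, z.2.1), z.1.2)) (by fun_prop) using 1
  funext z
  exact (if_pos (h.policy_mem z.2)).symm

theorem measurable_grad_f (i : Fin d) : Measurable fun z : ((Fin d → ℝ) × Ξ) × Policy S A =>
    grad (fun y => f y z.2.1 z.1.2) z.1.1 i := by
  have h₁ := measurable_grad (Ξ := Ξ × Policy S A) (u := fun x p => f x p.2.1 p.1)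
    (h.measurable_f.comp (f := fun z : (Fin d → ℝ) × (Ξ × Policy S A) =>
      ((z.1, z.2.1), z.2.2)) (by fun_prop)) (fun p x =>
        DifferentiableAt.comp (f := fun y => (y, p.2.1))
          (g := fun q : (Fin d → ℝ) × (S → A → ℝ) => f q.1 q.2 p.1) x
          (h.f_diff p.1 x p.2.1 (h.policy_mem p.2)) (by fun_prop)) i
  exact h₁.comp (f := fun z : ((Fin d → ℝ) × Ξ) × Policy S A => (z.1.1, (z.1.2, z.2)))
    (by fun_prop)

/-- The difference quotients leave the simplex and may leave `U`, so they are formed with the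
cut-off loss. It agrees with the loss near every policy, hence has the same derivative there. -/
theorem measurable_gradPi_f (s : S) (a : A) :
    Measurable fun z : ((Fin d → ℝ) × Ξ) × Policy S A =>
      gradPi (fun ρ => f z.1.1 ρ z.1.2) z.2.1 s a := by
  classical
  set v : S → A → ℝ := Pi.single s (Pi.single a 1)
  set g : (Fin d → ℝ) → (S → A → ℝ) → Ξ → ℝ := fun x ρ ξ => if ρ ∈ U then f x ρ ξ else 0
  have hg : Measurable fun z : ((Fin d → ℝ) × (S → A → ℝ)) × Ξ => g z.1.1 z.1.2 z.2 :=
    h.measurable_cutoff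
  refine measurable_of_tendsto_metrizable
    (f := fun (n : ℕ) (z : ((Fin d → ℝ) × Ξ) × Policy S A) =>
      (n : ℝ) • (g z.1.1 (z.2.1 + (n : ℝ)⁻¹ • v) z.1.2 - g z.1.1 z.2.1 z.1.2)) (fun n => ?_) ?_
  · have h₁ := hg.comp (f := fun z : ((Fin d → ℝ) × Ξ) × Policy S A =>
        ((z.1.1, z.2.1 + (n : ℝ)⁻¹ • v), z.1.2)) (by fun_prop)
    have h₂ := hg.comp (f := fun z : ((Fin d → ℝ) × Ξ) × Policy S A =>
        ((z.1.1, z.2.1), z.1.2)) (by fun_prop)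
    exact (h₁.sub h₂).const_smul (n : ℝ)
  · refine tendsto_pi_nhds.2 fun z => ?_
    have h₁ : DifferentiableAt ℝ (fun ρ => f z.1.1 ρ z.1.2) z.2.1 :=
      DifferentiableAt.comp (f := fun ρ => (z.1.1, ρ))
        (g := fun q : (Fin d → ℝ) × (S → A → ℝ) => f q.1 q.2 z.1.2) z.2.1
        (h.f_diff z.1.2 z.1.1 z.2.1 (h.policy_mem z.2)) (by fun_prop)
    have h₂ : (fun ρ => g z.1.1 ρ z.1.2) =ᶠ[nhds z.2.1] fun ρ => f z.1.1 ρ z.1.2 := by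
      filter_upwards [h.isOpen_U.mem_nhds (h.policy_mem z.2)] with ρ hρ
      exact if_pos hρ
    exact (h₁.hasFDerivAt.congr_of_eventuallyEq h₂).lim v tendsto_norm_natCast_atTop

theorem measurable_pairKernel (q q' : S × A) :
    Measurable fun z : ((Fin d → ℝ) × Ξ) × Policy S A => pairKernel (M z.1.1 z.1.2) z.2 q q' :=
  ((h.measurable_P q.1 q.2 q'.1).comp measurable_fst).mul
    ((measurable_policy_apply q'.1 q'.2).comp measurable_snd)

theorem measurable_softReward (q : S × A) :
    Measurable fun z : ((Fin d → ℝ) × Ξ) × Policy S A =>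
      softReward (M z.1.1 z.1.2) z.2 lam q :=
  ((h.measurable_r q.1 q.2).comp measurable_fst).add
    (((measurable_entropy q.1).comp measurable_snd).const_mul lam)

theorem measurable_qValue (hγ : 0 ≤ γ) (hγ1 : γ < 1) (q : S × A) :
    Measurable fun z : ((Fin d → ℝ) × Ξ) × Policy S A => qValue (M z.1.1 z.1.2) z.2 γ lam q :=
  measurable_resolvent hγ hγ1 h.measurable_pairKernel
    (fun z => pairKernel_mem (M z.1.1 z.1.2) z.2) h.measurable_softReward q

theorem measurable_gradQ (hγ : 0 ≤ γ) (hγ1 : γ < 1) (i : Fin d) (q : S × A) :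
    Measurable fun z : ((Fin d → ℝ) × Ξ) × Policy S A =>
      gradQ M γ lam z.1.1 z.1.2 z.2 i q := by
  refine measurable_resolvent hγ hγ1 h.measurable_pairKernel
    (fun z => pairKernel_mem (M z.1.1 z.1.2) z.2) (fun q => ?_) q
  refine ((h.measurable_grad_r q.1 q.2 i).comp measurable_fst).add
    ((Finset.measurable_fun_sum _ fun s' _ => ?_).const_mul γ)
  exact ((h.measurable_grad_P q.1 q.2 s' i).comp measurable_fst).mul
    (Finset.measurable_fun_sum _ fun a' _ =>
      ((measurable_policy_apply s' a').comp measurable_snd).mul (h.measurable_qValue hγ hγ1 _))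

theorem measurable_hyperGrad (hγ : 0 ≤ γ) (hγ1 : γ < 1) (i : Fin d) :
    Measurable fun z : ((Fin d → ℝ) × Ξ) × Policy S A =>
      hyperGrad M f γ lam z.1.1 z.1.2 z.2 i := by
  refine (h.measurable_grad_f i).add (Finset.measurable_fun_sum _ fun s _ =>
    Finset.measurable_fun_sum _ fun a _ => Measurable.mul (Measurable.mul
      (((measurable_policy_apply s a).comp measurable_snd).mul_const _)
      (h.measurable_gradPi_f s a)) (Measurable.sub (h.measurable_gradQ hγ hγ1 i _)
      (Finset.measurable_fun_sum _ fun b _ =>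
        ((measurable_policy_apply s b).comp measurable_snd).mul
          (h.measurable_gradQ hγ hγ1 i _))))

variable [Nonempty A]

/-- Value iteration from zero converges to the fixed point and each of its stages is measurable. -/
theorem measurable_optQ (hγ : 0 ≤ γ) (hγ1 : γ < 1) (hlam : 0 < lam) (q : S × A) :
    Measurable fun z : (Fin d → ℝ) × Ξ => optQ (M z.1 z.2) γ lam q := by
  refine measurable_of_tendsto_metrizable
    (f := fun n (z : (Fin d → ℝ) × Ξ) => ((softBellman (M z.1 z.2) γ lam)^[n] 0) q)
    (fun n => ?_) (tendsto_pi_nhds.2 fun z =>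
      (tendsto_pi_nhds.1 (tendsto_iterate_softBellman (M z.1 z.2) hγ hγ1 hlam)) q)
  induction n generalizing q with
  | zero => exact measurable_const
  | succ n ih =>
    simp only [Function.iterate_succ_apply']
    refine (h.measurable_r q.1 q.2).add ((Finset.measurable_fun_sum _ fun s' _ =>
      (h.measurable_P q.1 q.2 s').mul ?_).const_mul γ)
    exact (Real.measurable_log.comp (Finset.measurable_fun_sum _ fun a _ =>
      Real.measurable_exp.comp ((ih (s', a)).div_const lam))).const_mul lam

theorem measurable_optPolicy (hγ : 0 ≤ γ) (hγ1 : γ < 1) (hlam : 0 < lam) :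
    Measurable fun z : (Fin d → ℝ) × Ξ => (M z.1 z.2).optPolicy γ lam := by
  simp only [optPolicy_eq _ hγ hγ1 hlam]
  refine Measurable.subtype_mk (measurable_pi_iff.2 fun s => measurable_pi_iff.2 fun a => ?_)
  have h₁ : ∀ a, Measurable fun z : (Fin d → ℝ) × Ξ =>
      Real.exp (optQ (M z.1 z.2) γ lam (s, a) / lam) := fun a =>
    Real.measurable_exp.comp ((h.measurable_optQ hγ hγ1 hlam (s, a)).div_const lam)
  exact (h₁ a).div (Finset.measurable_fun_sum _ fun b _ => h₁ b)

end Regular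

end Measurability

/-! ### Differentiability of the leader's objective. -/

section Objective

variable {S A : Type*} [Fintype S] [DecidableEq S] [Fintype A] [DecidableEq A]
  [Nonempty S] [Nonempty A] {d : ℕ} {Ξ : Type*} [MeasurableSpace Ξ]
  {M : (Fin d → ℝ) → Ξ → MDP S A}
  {f : (Fin d → ℝ) → (S → A → ℝ) → Ξ → ℝ} {Pξ : Measure Ξ} {U : Set (S → A → ℝ)}
  {γ lam Lf Sf R K₁ K₂ : ℝ}

namespace Regular

variable (h : Regular M f Pξ U Lf Sf R K₁ K₂)
include h

theorem measurable_hyperGrad_optPolicy (hγ : 0 ≤ γ) (hγ1 : γ < 1) (hlam : 0 < lam) (i : Fin d) :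
    Measurable fun z : (Fin d → ℝ) × Ξ =>
      hyperGrad M f γ lam z.1 z.2 ((M z.1 z.2).optPolicy γ lam) i :=
  (h.measurable_hyperGrad hγ hγ1 i).comp
    (f := fun z : (Fin d → ℝ) × Ξ => (z, (M z.1 z.2).optPolicy γ lam))
    (measurable_id.prodMk (h.measurable_optPolicy hγ hγ1 hlam))

theorem measurable_f_optPolicy (hγ : 0 ≤ γ) (hγ1 : γ < 1) (hlam : 0 < lam) :
    Measurable fun z : (Fin d → ℝ) × Ξ => f z.1 ((M z.1 z.2).optPolicy γ lam).1 z.2 :=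
  h.measurable_f.comp (f := fun z : (Fin d → ℝ) × Ξ => (z, (M z.1 z.2).optPolicy γ lam))
    (measurable_id.prodMk (h.measurable_optPolicy hγ hγ1 hlam))

theorem hyperGradBound_nonneg [Nonempty Ξ] (hγ1 : γ < 1) (hlam : 0 < lam) :
    0 ≤ hyperGradBound S A γ lam Lf R K₁ K₂ := by
  have h₁ := h.Lf_nonneg
  have h₂ := h.gradBound_nonneg hγ1 hlam
  unfold hyperGradBound
  positivity

theorem integrable_gradCLM_hyperGrad [IsProbabilityMeasure Pξ] (hγ : 0 ≤ γ) (hγ1 : γ < 1)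
    (hlam : 0 < lam) (x : Fin d → ℝ) :
    Integrable (fun ξ => gradCLM (hyperGrad M f γ lam x ξ ((M x ξ).optPolicy γ lam))) Pξ := by
  have hm : Measurable fun ξ => hyperGrad M f γ lam x ξ ((M x ξ).optPolicy γ lam) :=
    measurable_pi_iff.2 fun i => Measurable.comp
      (g := fun z : (Fin d → ℝ) × Ξ =>
        hyperGrad M f γ lam z.1 z.2 ((M z.1 z.2).optPolicy γ lam) i) (f := fun ξ => (x, ξ))
      (h.measurable_hyperGrad_optPolicy hγ hγ1 hlam i) measurable_prodMk_left
  refine Integrable.of_bound (continuous_gradCLM.comp_aestronglyMeasurable hm.aestronglyMeasurable)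
    (d * hyperGradBound S A γ lam Lf R K₁ K₂) (Filter.Eventually.of_forall fun ξ => ?_)
  have : Nonempty Ξ := ⟨ξ⟩
  exact norm_gradCLM_le (h.hyperGradBound_nonneg hγ1 hlam)
    fun i => h.abs_hyperGrad_le hγ hγ1 hlam x ξ _ i

/-- The objective of the leader is differentiable; its gradient is the mean hypergradient. -/
theorem hasFDerivAt_leaderObj [IsProbabilityMeasure Pξ] (hγ : 0 ≤ γ) (hγ1 : γ < 1)
    (hlam : 0 < lam) (x : Fin d → ℝ) :
    HasFDerivAt (leaderObj M f γ lam Pξ)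
      (∫ ξ, gradCLM (hyperGrad M f γ lam x ξ ((M x ξ).optPolicy γ lam)) ∂Pξ) x := by
  have hmeas : ∀ y, Measurable fun ξ => f y ((M y ξ).optPolicy γ lam).1 ξ := fun y =>
    Measurable.comp (g := fun z : (Fin d → ℝ) × Ξ => f z.1 ((M z.1 z.2).optPolicy γ lam).1 z.2)
      (f := fun ξ => (y, ξ)) (h.measurable_f_optPolicy hγ hγ1 hlam) measurable_prodMk_left
  refine hasFDerivAt_integral_of_dominated_of_fderiv_le (s := Set.univ)
    (F' := fun y ξ => gradCLM (hyperGrad M f γ lam y ξ ((M y ξ).optPolicy γ lam)))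
    (bound := fun _ => d * hyperGradBound S A γ lam Lf R K₁ K₂) Filter.univ_mem
    (Filter.Eventually.of_forall fun y => (hmeas y).aestronglyMeasurable) ?_ ?_
    (Filter.Eventually.of_forall fun ξ y _ => ?_) (integrable_const _)
    (Filter.Eventually.of_forall fun ξ y _ => ?_)
  · obtain ⟨π⟩ : Nonempty (Policy S A) := inferInstance
    -- Integrability is assumed for policies that do not depend on the context. It passes to the
    -- optimal policy because the two losses differ by at most `|Lf|`, policies being at sup
    -- distance at most one.
    have h₁ : Integrable (fun ξ => f x ((M x ξ).optPolicy γ lam).1 ξ - f x π.1 ξ) Pξ := by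
      refine Integrable.of_bound ((hmeas x).sub
        (h.f_meas x π.1 (h.policy_mem π))).aestronglyMeasurable |Lf|
        (Filter.Eventually.of_forall fun ξ => ?_)
      have h₂ := h.f_lip ξ x x _ (h.policy_mem ((M x ξ).optPolicy γ lam)) _ (h.policy_mem π)
      rw [sub_self, norm_zero, zero_add] at h₂
      refine h₂.trans ((le_abs_self _).trans ?_)
      rw [abs_mul, abs_norm]
      exact mul_le_of_le_one_right (abs_nonneg _) (norm_policy_sub_le _ _)
    exact (h₁.add (h.f_int x π)).congr (Filter.Eventually.of_forall fun ξ => by simp)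
  · exact (h.integrable_gradCLM_hyperGrad hγ hγ1 hlam x).aestronglyMeasurable
  · have : Nonempty Ξ := ⟨ξ⟩
    exact norm_gradCLM_le (h.hyperGradBound_nonneg hγ1 hlam)
      fun i => h.abs_hyperGrad_le hγ hγ1 hlam y ξ _ i
  · exact hasFDerivAt_leaderLoss hγ hγ1 hlam M f ξ (h.r_diff ξ) (h.P_diff ξ) y
      (h.f_diff ξ y _ (h.policy_mem _))

theorem grad_leaderObj [IsProbabilityMeasure Pξ] (hγ : 0 ≤ γ) (hγ1 : γ < 1)
    (hlam : 0 < lam) (x : Fin d → ℝ) (i : Fin d) :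
    grad (leaderObj M f γ lam Pξ) x i =
      ∫ ξ, hyperGrad M f γ lam x ξ ((M x ξ).optPolicy γ lam) i ∂Pξ := by
  rw [grad, (h.hasFDerivAt_leaderObj hγ hγ1 hlam x).fderiv,
    ContinuousLinearMap.integral_apply (h.integrable_gradCLM_hyperGrad hγ hγ1 hlam x)]
  refine integral_congr_ae (Filter.Eventually.of_forall fun ξ => ?_)
  simp [gradCLM_apply, Pi.single_apply]

theorem abs_grad_leaderObj_le [IsProbabilityMeasure Pξ] (hγ : 0 ≤ γ) (hγ1 : γ < 1)
    (hlam : 0 < lam) (x : Fin d → ℝ) (i : Fin d) :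
    |grad (leaderObj M f γ lam Pξ) x i| ≤ hyperGradBound S A γ lam Lf R K₁ K₂ := by
  rw [h.grad_leaderObj hγ hγ1 hlam x i]
  refine (norm_integral_le_of_norm_le_const
    (f := fun ξ => hyperGrad M f γ lam x ξ ((M x ξ).optPolicy γ lam) i)
    (Filter.Eventually.of_forall fun ξ => h.abs_hyperGrad_le hγ hγ1 hlam x ξ _ i)).trans ?_
  simp

end Regular

end Objective

/-! ### Path expectations and the mean of a rollout. -/

section Paths

variable {Y : Type*} [Fintype Y]

/-- The sequence that starts with `y` and goes on with `p`. -/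
def seqCons (y : Y) (p : ℕ → Y) : ℕ → Y
  | 0 => y
  | k + 1 => p k

/-- A finite path, continued by its last point. -/
def extendPath {n : ℕ} (p : Fin (n + 1) → Y) : ℕ → Y := fun k => p ⟨min k n, by omega⟩

theorem extendPath_apply_of_le {n : ℕ} (p : Fin (n + 1) → Y) {k : ℕ} (hk : k ≤ n) :
    extendPath p k = p ⟨k, by omega⟩ := by
  simp only [extendPath, min_eq_left hk]

theorem extendPath_cons {n : ℕ} (y : Y) (p : Fin (n + 1) → Y) :
    extendPath (Fin.cons y p : Fin (n + 2) → Y) = seqCons y (extendPath p) := by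
  funext k
  cases k with
  | zero => rfl
  | succ k =>
    have : (⟨min (k + 1) (n + 1), by omega⟩ : Fin (n + 2)) = Fin.succ ⟨min k n, by omega⟩ := by
      ext; simp
    simp only [extendPath, seqCons]
    rw [this, Fin.cons_succ]

/-- The mean of a functional of the first `n` steps of the chain with kernel `K`. -/
def pathMean (K : Y → Y → ℝ) : ℕ → ((ℕ → Y) → ℝ) → Y → ℝ
  | 0, φ, y => φ fun _ => y
  | n + 1, φ, y => ∑ y', K y y' * pathMean K n (fun p => φ (seqCons y p)) y'

variable (K : Y → Y → ℝ)

/-- Splitting off the first point turns the sum over finite paths into the recursion of `pathMean`;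
functionals are defined on infinite sequences, so each path is continued by its last point. -/
theorem sum_path_eq_pathMean (n : ℕ) (ψ : Y → ℝ) (φ : (ℕ → Y) → ℝ) :
    ∑ p : Fin (n + 1) → Y, ψ (extendPath p 0) *
      (∏ i ∈ Finset.range n, K (extendPath p i) (extendPath p (i + 1))) * φ (extendPath p) =
      ∑ y, ψ y * pathMean K n φ y := by
  induction n generalizing ψ φ with
  | zero =>
    refine Fintype.sum_equiv (Equiv.funUnique (Fin 1) Y) _ _ fun p => ?_
    have : extendPath p = fun _ => p 0 := by
      funext k; simp only [extendPath]; congr 1; ext; simp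
    simp [this, pathMean]
  | succ n ih =>
    rw [← (Fin.consEquiv fun _ : Fin (n + 2) => Y).sum_comp, Fintype.sum_prod_type]
    refine Finset.sum_congr rfl fun y _ => ?_
    simp only [pathMean]
    rw [← ih, Finset.mul_sum]
    refine Finset.sum_congr rfl fun p _ => ?_
    have hc : (Fin.consEquiv fun _ : Fin (n + 2) => Y) (y, p) = Fin.cons y p := rfl
    rw [hc, extendPath_cons, Finset.prod_range_succ']
    simp only [seqCons]
    ring

theorem pathMean_add (n : ℕ) (φ ψ : (ℕ → Y) → ℝ) (y : Y) :
    pathMean K n (fun p => φ p + ψ p) y = pathMean K n φ y + pathMean K n ψ y := by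
  induction n generalizing φ ψ y with
  | zero => rfl
  | succ n ih => simp only [pathMean, ih, mul_add, Finset.sum_add_distrib]

theorem pathMean_const_mul (n : ℕ) (c : ℝ) (φ : (ℕ → Y) → ℝ) (y : Y) :
    pathMean K n (fun p => c * φ p) y = c * pathMean K n φ y := by
  induction n generalizing φ y with
  | zero => rfl
  | succ n ih =>
    simp only [pathMean, ih, Finset.mul_sum]
    exact Finset.sum_congr rfl fun y' _ => by ring

theorem pathMean_sum {ι : Type*} (s : Finset ι) (n : ℕ) (φ : ι → (ℕ → Y) → ℝ) (y : Y) :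
    pathMean K n (fun p => ∑ i ∈ s, φ i p) y = ∑ i ∈ s, pathMean K n (φ i) y := by
  induction n generalizing φ y with
  | zero => rfl
  | succ n ih =>
    simp only [pathMean, ih, Finset.mul_sum]
    exact Finset.sum_comm

variable {K}

theorem pathMean_const (hK : ∀ y, K y ∈ stdSimplex ℝ Y) (n : ℕ) (c : ℝ) (y : Y) :
    pathMean K n (fun _ => c) y = c := by
  induction n generalizing y with
  | zero => rfl
  | succ n ih => simp only [pathMean, ih, ← Finset.sum_mul, (hK y).2, one_mul]

theorem pathMean_eval (hK : ∀ y, K y ∈ stdSimplex ℝ Y) (g : Y → ℝ) {i n : ℕ} (hi : i ≤ n)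
    (y : Y) : pathMean K n (fun p => g (p i)) y = ((avg K)^[i] g) y := by
  induction i generalizing n y with
  | zero =>
    cases n with
    | zero => rfl
    | succ n => exact pathMean_const hK (n + 1) (g y) y
  | succ i ih =>
    obtain ⟨n, rfl⟩ : ∃ k, n = k + 1 := ⟨n - 1, by omega⟩
    rw [Function.iterate_succ_apply']
    simp only [pathMean, seqCons, avg]
    refine Finset.sum_congr rfl fun y' _ => ?_
    rw [ih (by omega)]

/-- The Markov property, for one weighted transition at time `T`. -/
theorem pathMean_eval_transition (hK : ∀ y, K y ∈ stdSimplex ℝ Y) (b : Y → Y → ℝ) (g : Y → ℝ)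
    {T j n : ℕ} (hn : T + 1 + j ≤ n) (y : Y) :
    pathMean K n (fun p => b (p T) (p (T + 1)) * g (p (T + 1 + j))) y =
      ((avg K)^[T] fun z => ∑ z', K z z' * b z z' * ((avg K)^[j] g) z') y := by
  induction T generalizing n y with
  | zero =>
    obtain ⟨n, rfl⟩ : ∃ k, n = k + 1 := ⟨n - 1, by omega⟩
    simp only [pathMean, Function.iterate_zero, id]
    refine Finset.sum_congr rfl fun y' _ => ?_
    have h₁ : ∀ p : ℕ → Y, seqCons y p (0 + 1 + j) = p j := fun p => by
      rw [zero_add, add_comm]; rfl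
    simp only [h₁]
    -- The weight reads only the first two points, which are already fixed as `y` and `y'`, so it
    -- factors out of the mean.
    have h₂ : pathMean K n (fun p => b (seqCons y p 0) (seqCons y p (0 + 1)) * g (p j)) y' =
        b y y' * ((avg K)^[j] g) y' := by
      rw [← pathMean_eval hK g (by omega : j ≤ n) y', ← pathMean_const_mul]
      cases n with
      | zero => rfl
      | succ n => rfl
    rw [h₂, mul_assoc]
  | succ T ih =>
    obtain ⟨n, rfl⟩ : ∃ k, n = k + 1 := ⟨n - 1, by omega⟩
    rw [Function.iterate_succ_apply']
    have h₁ : ∀ p : ℕ → Y, seqCons y p (T + 1 + 1 + j) = p (T + 1 + j) := fun p => by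
      rw [show T + 1 + 1 + j = (T + 1 + j) + 1 by omega]; rfl
    have h₂ : ∀ (p : ℕ → Y) (k : ℕ), seqCons y p (k + 1) = p k := fun _ _ => rfl
    simp only [pathMean, h₁, h₂, avg]
    refine Finset.sum_congr rfl fun y' _ => ?_
    rw [ih (by omega)]

theorem hasSum_iterate_avg {ι : Type*} {F : ι → Y → ℝ} {G : Y → ℝ}
    (h : ∀ z, HasSum (fun j => F j z) (G z)) (t : ℕ) (y : Y) :
    HasSum (fun j => ((avg K)^[t] (F j)) y) (((avg K)^[t] G) y) := by
  induction t generalizing y with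
  | zero => exact h y
  | succ t ih =>
    simp only [Function.iterate_succ_apply']
    exact hasSum_sum fun y' _ => (ih y').mul_left (K y y')

theorem iterate_avg_const_mul (c : ℝ) (g : Y → ℝ) (t : ℕ) (y : Y) :
    ((avg K)^[t] fun z => c * g z) y = c * ((avg K)^[t] g) y := by
  induction t generalizing y with
  | zero => rfl
  | succ t ih =>
    simp only [Function.iterate_succ_apply', avg]
    rw [Finset.mul_sum]
    refine Finset.sum_congr rfl fun y' _ => ?_
    rw [ih]
    ring

theorem iterate_avg_add (g g' : Y → ℝ) (t : ℕ) (y : Y) :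
    ((avg K)^[t] fun z => g z + g' z) y = ((avg K)^[t] g) y + ((avg K)^[t] g') y := by
  induction t generalizing y with
  | zero => rfl
  | succ t ih =>
    simp only [Function.iterate_succ_apply', avg]
    rw [← Finset.sum_add_distrib]
    refine Finset.sum_congr rfl fun y' _ => ?_
    rw [ih]
    ring

/-- The mean of the rollout estimator for fixed horizons. -/
def rolloutMean (γ : ℝ) (K : Y → Y → ℝ) (dr : Y → ℝ) (b : Y → Y → ℝ) (ρ : Y → ℝ) (T T' : ℕ)
    (y : Y) : ℝ :=
  ∑ t ∈ Finset.range (T + 1), ((avg K)^[t] dr) y +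
    γ / (1 - γ) * ∑ j ∈ Finset.range (T' + 1), (Real.sqrt γ) ^ j *
      ((avg K)^[T] fun z => ∑ z', K z z' * b z z' * ((avg K)^[j] ρ) z') y

theorem pathMean_rollout (hK : ∀ y, K y ∈ stdSimplex ℝ Y) (γ : ℝ) (dr : Y → ℝ) (b : Y → Y → ℝ)
    (ρ : Y → ℝ) (T T' : ℕ) (y : Y) :
    pathMean K (T + T' + 1) (fun p => ∑ t ∈ Finset.range (T + 1), dr (p t) +
      (γ / (1 - γ) * ∑ t ∈ Finset.Icc (T + 1) (T + T' + 1),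
        (Real.sqrt γ) ^ (t - (T + 1)) * ρ (p t)) * b (p T) (p (T + 1))) y =
      rolloutMean γ K dr b ρ T T' y := by
  have h₁ : ∀ p : ℕ → Y, (γ / (1 - γ) * ∑ t ∈ Finset.Icc (T + 1) (T + T' + 1),
        (Real.sqrt γ) ^ (t - (T + 1)) * ρ (p t)) * b (p T) (p (T + 1)) =
      γ / (1 - γ) * ∑ j ∈ Finset.range (T' + 1), (Real.sqrt γ) ^ j *
        (b (p T) (p (T + 1)) * ρ (p (T + 1 + j))) := by
    intro p
    have h₂ : Finset.Icc (T + 1) (T + T' + 1) = Finset.Ico (T + 1) (T + T' + 2) := by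
      ext t; simp only [Finset.mem_Icc, Finset.mem_Ico]; omega
    rw [h₂, Finset.sum_Ico_eq_sum_range, show T + T' + 2 - (T + 1) = T' + 1 by omega, mul_assoc,
      Finset.sum_mul]
    congr 1
    refine Finset.sum_congr rfl fun j _ => ?_
    rw [Nat.add_sub_cancel_left]
    ring
  simp only [h₁]
  rw [pathMean_add, pathMean_sum, pathMean_const_mul, pathMean_sum, rolloutMean]
  congr 1
  · refine Finset.sum_congr rfl fun t ht => pathMean_eval hK dr ?_ y
    have := Finset.mem_range.1 ht; omega
  · congr 1
    refine Finset.sum_congr rfl fun j hj => ?_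
    rw [pathMean_const_mul, pathMean_eval_transition hK b ρ _ y]
    have := Finset.mem_range.1 hj; omega

variable {γ : ℝ}

theorem sqrt_lt_one_of (hγ1 : γ < 1) : Real.sqrt γ < 1 := by
  rw [Real.sqrt_lt' one_pos]; simpa using hγ1

/-- Averaging over `T'` multiplies the term of index `j` by $P(T'\ge j)=\sqrt\gamma^{\,j}$; with the
factor $\sqrt\gamma^{\,j}$ of the estimator this is the discount $\gamma^j$. -/
theorem hasSum_rolloutMean_inner (hγ : 0 ≤ γ) (hγ1 : γ < 1) (hK : ∀ y, K y ∈ stdSimplex ℝ Y)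
    (dr : Y → ℝ) (b : Y → Y → ℝ) (ρ : Y → ℝ) (T : ℕ) (y : Y) :
    HasSum (fun T' => geoWeight (Real.sqrt γ) T' * rolloutMean γ K dr b ρ T T' y)
      (∑ t ∈ Finset.range (T + 1), ((avg K)^[t] dr) y + γ / (1 - γ) *
        ((avg K)^[T] fun z => ∑ z', K z z' * b z z' * resolvent γ K ρ z') y) := by
  have hs0 := Real.sqrt_nonneg γ
  have hs1 := sqrt_lt_one_of hγ1
  obtain ⟨B, hB⟩ := exists_abs_bound ρ
  obtain ⟨C, hC⟩ := exists_abs_bound fun z => ∑ z', |K z z' * b z z'| * B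
  have hbound : ∀ j, |((avg K)^[T] fun z => ∑ z', K z z' * b z z' * ((avg K)^[j] ρ) z') y| ≤ C := by
    intro j
    refine abs_iterate_avg_le hK (fun z => ?_) T y
    refine (Finset.abs_sum_le_sum_abs _ _).trans ((Finset.sum_le_sum fun z' _ => ?_).trans
      ((le_abs_self _).trans (hC z)))
    rw [abs_mul]
    exact mul_le_mul_of_nonneg_left (abs_iterate_avg_le hK hB j z') (abs_nonneg _)
  have hb1 : ∀ j, |(Real.sqrt γ) ^ j *
      ((avg K)^[T] fun z => ∑ z', K z z' * b z z' * ((avg K)^[j] ρ) z') y| ≤ C := fun j => by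
    rw [abs_mul, abs_of_nonneg (pow_nonneg hs0 j)]
    exact (mul_le_of_le_one_left (abs_nonneg _) (pow_le_one₀ hs0 hs1.le)).trans (hbound j)
  have h₁ := hasSum_geoWeight_mul_sum_range hs0 hs1 hb1
  have h₂ : HasSum (fun j : ℕ => (Real.sqrt γ) ^ j * ((Real.sqrt γ) ^ j *
      ((avg K)^[T] fun z => ∑ z', K z z' * b z z' * ((avg K)^[j] ρ) z') y))
      (((avg K)^[T] fun z => ∑ z', K z z' * b z z' * resolvent γ K ρ z') y) := by
    refine (hasSum_iterate_avg (K := K) (F := fun j z => γ ^ j *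
      ∑ z', K z z' * b z z' * ((avg K)^[j] ρ) z') (fun z => ?_) T y).congr_fun fun j => ?_
    · simp only [Finset.mul_sum]
      refine hasSum_sum fun z' _ => ?_
      refine ((summable_resolvent hγ hγ1 hK ρ z').hasSum.mul_left (K z z' * b z z')).congr_fun
        fun j => ?_
      ring
    · rw [iterate_avg_const_mul, ← mul_assoc, ← mul_pow, Real.mul_self_sqrt hγ]
  rw [h₂.tsum_eq] at h₁
  have h₃ := ((hasSum_geoWeight hs0 hs1).mul_right
    (∑ t ∈ Finset.range (T + 1), ((avg K)^[t] dr) y)).add (h₁.mul_left (γ / (1 - γ)))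
  rw [one_mul] at h₃
  refine h₃.congr_fun fun T' => ?_
  rw [rolloutMean]
  ring

/-- The partial sums of `dr` average to a discounted sum since $P(T\ge t)=\gamma^t$. The other term
is read only at `T` itself, which has weight $(1-\gamma)\gamma^T$; the prefactor $\gamma/(1-\gamma)$
cancels the normalization. -/
theorem hasSum_rolloutMean_outer (hγ : 0 ≤ γ) (hγ1 : γ < 1) (hK : ∀ y, K y ∈ stdSimplex ℝ Y)
    (dr c : Y → ℝ) (y : Y) :
    HasSum (fun T => geoWeight γ T * (∑ t ∈ Finset.range (T + 1), ((avg K)^[t] dr) y +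
      γ / (1 - γ) * ((avg K)^[T] c) y)) (resolvent γ K (fun z => dr z + γ * c z) y) := by
  obtain ⟨B, hB⟩ := exists_abs_bound dr
  have h₁ := hasSum_geoWeight_mul_sum_range hγ hγ1 fun t => abs_iterate_avg_le hK hB t y
  have h₂ := (summable_resolvent hγ hγ1 hK c y).hasSum.mul_left γ
  have h₃ : resolvent γ K (fun z => dr z + γ * c z) y =
      ∑' t : ℕ, γ ^ t * ((avg K)^[t] dr) y + γ * ∑' t : ℕ, γ ^ t * ((avg K)^[t] c) y := by
    rw [← (summable_resolvent hγ hγ1 hK c y).tsum_mul_left, ← Summable.tsum_add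
      (summable_resolvent hγ hγ1 hK dr y) ((summable_resolvent hγ hγ1 hK c y).mul_left γ)]
    refine tsum_congr fun t => ?_
    rw [iterate_avg_add dr fun z => γ * c z, iterate_avg_const_mul]
    ring
  rw [h₃]
  refine (h₁.add h₂).congr_fun fun T => ?_
  have : 1 - γ ≠ 0 := by linarith
  simp only [geoWeight]
  field_simp

end Paths

/-! ### Integration against a discrete variable with given conditional weights. -/

section Transfer

variable {Ω Θ W : Type*} [MeasurableSpace Ω] [MeasurableSpace Θ] [Countable W] {μ : Measure Ω}
  {θ : Ω → Θ} {Z : Ω → W} {p : Θ → W → ℝ}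

theorem map_restrict_eq_withDensity (hθ : Measurable θ) (hp : ∀ w, Measurable fun t => p t w)
    (hlaw : ∀ w, ∀ B : Set Θ, MeasurableSet B →
      μ (θ ⁻¹' B ∩ Z ⁻¹' {w}) = ∫⁻ ω in θ ⁻¹' B, ENNReal.ofReal (p (θ ω) w) ∂μ) (w : W) :
    (μ.restrict (Z ⁻¹' {w})).map θ = (μ.map θ).withDensity fun t => ENNReal.ofReal (p t w) := by
  ext B hB
  rw [Measure.map_apply hθ hB, Measure.restrict_apply (hθ hB), hlaw w B hB,
    withDensity_apply _ hB, setLIntegral_map hB (hp w).ennreal_ofReal hθ]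

/-- Integration of a function of `θ` and of a discrete variable `Z` with conditional law `p θ`. -/
theorem lintegral_discrete (hθ : Measurable θ) (hZ : ∀ w, MeasurableSet (Z ⁻¹' {w}))
    (hp : ∀ w, Measurable fun t => p t w)
    (hlaw : ∀ w, ∀ B : Set Θ, MeasurableSet B →
      μ (θ ⁻¹' B ∩ Z ⁻¹' {w}) = ∫⁻ ω in θ ⁻¹' B, ENNReal.ofReal (p (θ ω) w) ∂μ)
    {G : Θ → W → ENNReal} (hG : ∀ w, Measurable fun t => G t w) :
    ∫⁻ ω, G (θ ω) (Z ω) ∂μ = ∫⁻ ω, ∑' w, ENNReal.ofReal (p (θ ω) w) * G (θ ω) w ∂μ := by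
  have h₁ : ∀ w, ∫⁻ ω in Z ⁻¹' {w}, G (θ ω) w ∂μ =
      ∫⁻ ω, ENNReal.ofReal (p (θ ω) w) * G (θ ω) w ∂μ := fun w => by
    rw [← lintegral_map (f := fun t => G t w) (hG w) hθ, map_restrict_eq_withDensity hθ hp hlaw w,
      lintegral_withDensity_eq_lintegral_mul _ (hp w).ennreal_ofReal (hG w),
      lintegral_map ((hp w).ennreal_ofReal.mul (hG w)) hθ]
    rfl
  have hpG : ∀ w, Measurable fun ω => ENNReal.ofReal (p (θ ω) w) * G (θ ω) w := fun w =>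
    ((hp w).ennreal_ofReal.mul (hG w)).comp hθ
  have hind : ∀ w, Measurable fun ω => (Z ⁻¹' {w}).indicator (fun ω => G (θ ω) w) ω := fun w =>
    ((hG w).comp hθ).indicator (hZ w)
  rw [lintegral_tsum fun w => (hpG w).aemeasurable]
  simp only [← h₁]
  -- Expand along the countably many values of `Z`; on each level set the law of `θ` has density `p
  -- · w`.
  have h₂ : ∀ ω, G (θ ω) (Z ω) = ∑' w, (Z ⁻¹' {w}).indicator (fun ω => G (θ ω) w) ω := by
    intro ω
    rw [tsum_eq_single (Z ω) fun w hw => Set.indicator_of_notMem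
      (fun h => hw (by simpa using h.symm)) _]
    simp
  simp only [h₂]
  rw [lintegral_tsum fun w => (hind w).aemeasurable]
  exact tsum_congr fun w => lintegral_indicator (hZ w) _

theorem measurable_discrete (hθ : Measurable θ) (hZ : ∀ w, MeasurableSet (Z ⁻¹' {w}))
    {G : Θ → W → ℝ} (hG : ∀ w, Measurable fun t => G t w) :
    Measurable fun ω => G (θ ω) (Z ω) := by
  let _ : MeasurableSpace W := ⊤
  have hZm : Measurable Z := measurable_to_countable' hZ
  exact (measurable_from_prod_countable_left (f := fun q : Θ × W => G q.1 q.2) hG).comp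
    (hθ.prodMk hZm)

/-- The same expansion for signed functions; the finiteness hypothesis justifies both exchanges of
sum and integral, the one with indicators through `lintegral_discrete`. -/
theorem integral_discrete (hθ : Measurable θ) (hZ : ∀ w, MeasurableSet (Z ⁻¹' {w}))
    (hp0 : ∀ t w, 0 ≤ p t w) (hp : ∀ w, Measurable fun t => p t w)
    (hlaw : ∀ w, ∀ B : Set Θ, MeasurableSet B →
      μ (θ ⁻¹' B ∩ Z ⁻¹' {w}) = ∫⁻ ω in θ ⁻¹' B, ENNReal.ofReal (p (θ ω) w) ∂μ)
    {G : Θ → W → ℝ} (hG : ∀ w, Measurable fun t => G t w)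
    (hfin : ∫⁻ ω, ∑' w, ENNReal.ofReal (p (θ ω) w) * ‖G (θ ω) w‖ₑ ∂μ ≠ ⊤) :
    ∫ ω, G (θ ω) (Z ω) ∂μ = ∫ ω, ∑' w, p (θ ω) w * G (θ ω) w ∂μ := by
  have h₁ : ∀ w, ∫ ω, (Z ⁻¹' {w}).indicator (fun ω => G (θ ω) w) ω ∂μ =
      ∫ ω, p (θ ω) w * G (θ ω) w ∂μ := fun w => by
    rw [integral_indicator (hZ w),
      ← integral_map (f := fun t => G t w) hθ.aemeasurable (hG w).aestronglyMeasurable,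
      map_restrict_eq_withDensity hθ hp hlaw w,
      integral_withDensity_eq_integral_toReal_smul (hp w).ennreal_ofReal
        (Filter.Eventually.of_forall fun t => ENNReal.ofReal_lt_top)]
    simp only [ENNReal.toReal_ofReal (hp0 _ w), smul_eq_mul]
    exact integral_map hθ.aemeasurable ((hp w).mul (hG w)).aestronglyMeasurable
  have h₂ : ∀ ω, G (θ ω) (Z ω) = ∑' w, (Z ⁻¹' {w}).indicator (fun ω => G (θ ω) w) ω := by
    intro ω
    rw [tsum_eq_single (Z ω) fun w hw => Set.indicator_of_notMem
      (fun h => hw (by simpa using h.symm)) _]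
    simp
  have hpG : ∀ w, Measurable fun ω => p (θ ω) w * G (θ ω) w := fun w =>
    ((hp w).mul (hG w)).comp hθ
  have hind : ∀ w, Measurable fun ω => (Z ⁻¹' {w}).indicator (fun ω => G (θ ω) w) ω := fun w =>
    ((hG w).comp hθ).indicator (hZ w)
  simp only [h₂]
  rw [integral_tsum fun w => (hind w).aestronglyMeasurable,
    integral_tsum fun w => (hpG w).aestronglyMeasurable]
  · exact tsum_congr h₁
  · rw [← lintegral_tsum fun w => (hpG w).enorm.aemeasurable]
    simpa only [enorm_mul, Real.enorm_of_nonneg (hp0 _ _)] using hfin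
  · rw [← lintegral_tsum fun w => (hind w).enorm.aemeasurable]
    rw [← lintegral_discrete hθ hZ hp hlaw (G := fun t w => ‖G t w‖ₑ) fun w => (hG w).enorm]
      at hfin
    convert hfin using 3 with ω
    rw [tsum_eq_single (Z ω) fun w hw => ?_]
    · simp
    · rw [enorm_eq_zero]
      exact Set.indicator_of_notMem (fun h => hw (by simpa using h.symm)) _

end Transfer

/-! ### Bounds and resolvent form for the rollout estimator. -/

section RolloutSums

variable {S A : Type*} [Fintype S] [DecidableEq S] [Fintype A] [DecidableEq A] {d : ℕ} {Ξ : Type*}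

theorem rolloutEst_apply (M : (Fin d → ℝ) → Ξ → MDP S A) (γ lam : ℝ) (x : Fin d → ℝ) (ξ : Ξ)
    (π : Policy S A) (T T' : ℕ) (p : ℕ → S × A) (i : Fin d) :
    rolloutEst M γ lam x ξ π T T' p i =
      ∑ t ∈ Finset.range (T + 1), grad (fun y => (M y ξ).r (p t).1 (p t).2) x i +
      (γ / (1 - γ) * ∑ t ∈ Finset.Icc (T + 1) (T + T' + 1),
        (Real.sqrt γ) ^ (t - (T + 1)) * softReward (M x ξ) π lam (p t)) *
        grad (fun y => Real.log ((M y ξ).P (p T).1 (p T).2 (p (T + 1)).1)) x i := by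
  simp only [rolloutEst, Pi.add_apply, Finset.sum_apply, Pi.smul_apply, smul_eq_mul, softReward]

theorem rolloutEst_congr (M : (Fin d → ℝ) → Ξ → MDP S A) (γ lam : ℝ) (x : Fin d → ℝ) (ξ : Ξ)
    (π : Policy S A) (T T' : ℕ) {p p' : ℕ → S × A} (h : ∀ j ≤ T + T' + 1, p j = p' j) :
    rolloutEst M γ lam x ξ π T T' p = rolloutEst M γ lam x ξ π T T' p' := by
  funext i
  rw [rolloutEst_apply, rolloutEst_apply, h T (by omega), h (T + 1) (by omega)]
  congr 1
  · refine Finset.sum_congr rfl fun t ht => ?_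
    rw [h t (by have := Finset.mem_range.1 ht; omega)]
  · congr 2
    refine Finset.sum_congr rfl fun t ht => ?_
    rw [h t (Finset.mem_Icc.1 ht).2]

variable (A) in
/-- A bound for the rollout estimator per unit of horizon. -/
def rolloutBound (γ lam R K₁ K₂ : ℝ) : ℝ :=
  K₂ + γ / (1 - γ) * ((R + lam * Fintype.card A) / (1 - Real.sqrt γ)) * K₁

variable [MeasurableSpace Ξ] {M : (Fin d → ℝ) → Ξ → MDP S A}
  {f : (Fin d → ℝ) → (S → A → ℝ) → Ξ → ℝ} {Pξ : Measure Ξ} {U : Set (S → A → ℝ)}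
  {γ lam Lf Sf R K₁ K₂ : ℝ}

namespace Regular

variable (h : Regular M f Pξ U Lf Sf R K₁ K₂)
include h

theorem rolloutBound_nonneg [Nonempty S] [Nonempty A] [Nonempty Ξ] (hγ : 0 ≤ γ) (hγ1 : γ < 1)
    (hlam : 0 < lam) : 0 ≤ rolloutBound A γ lam R K₁ K₂ := by
  have h₁ := h.R_nonneg
  have h₂ := h.K₁_nonneg
  have h₃ := h.K₂_nonneg
  have h₄ : 0 < 1 - Real.sqrt γ := by linarith [sqrt_lt_one_of hγ1]
  have h₅ : 0 < 1 - γ := by linarith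
  unfold rolloutBound
  positivity

/-- The reward part has `T + 1` bounded terms. The score part is bounded for every `T'` by a
geometric series in $\sqrt\gamma$, so only `T` enters the bound. -/
theorem abs_rolloutEst_le [Nonempty S] [Nonempty A] (hγ : 0 ≤ γ) (hγ1 : γ < 1) (hlam : 0 < lam)
    (x : Fin d → ℝ) (ξ : Ξ) (π : Policy S A) (T T' : ℕ) (p : ℕ → S × A) (i : Fin d) :
    |rolloutEst M γ lam x ξ π T T' p i| ≤ rolloutBound A γ lam R K₁ K₂ * (1 + T) := by
  have : Nonempty Ξ := ⟨ξ⟩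
  have h₁ := h.R_nonneg
  have hK₁ := h.K₁_nonneg
  have h₄ : 0 < 1 - Real.sqrt γ := by linarith [sqrt_lt_one_of hγ1]
  have h₅ : 0 < 1 - γ := by linarith
  rw [rolloutEst_apply]
  refine (abs_add_le _ _).trans ?_
  have b₁ : |∑ t ∈ Finset.range (T + 1), grad (fun y => (M y ξ).r (p t).1 (p t).2) x i| ≤
      K₂ * (1 + T) := by
    refine (Finset.abs_sum_le_sum_abs _ _).trans ((Finset.sum_le_sum fun t _ =>
      h.abs_grad_r_le x ξ (p t).1 (p t).2 i).trans (le_of_eq ?_))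
    simp; ring
  have b₂ : |∑ t ∈ Finset.Icc (T + 1) (T + T' + 1), (Real.sqrt γ) ^ (t - (T + 1)) *
      softReward (M x ξ) π lam (p t)| ≤ (R + lam * Fintype.card A) / (1 - Real.sqrt γ) := by
    refine (Finset.abs_sum_le_sum_abs _ _).trans ((Finset.sum_le_sum (g := fun t =>
      (Real.sqrt γ) ^ (t - (T + 1)) * (R + lam * Fintype.card A)) fun t _ => ?_).trans ?_)
    · rw [abs_mul, abs_of_nonneg (by positivity : 0 ≤ (Real.sqrt γ) ^ (t - (T + 1)))]
      exact mul_le_mul_of_nonneg_left (abs_softReward_le _ π hlam (h.abs_r_le x ξ) _)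
        (by positivity)
    · have h₂ : Finset.Icc (T + 1) (T + T' + 1) = Finset.Ico (T + 1) (T + T' + 2) := by
        ext t; simp only [Finset.mem_Icc, Finset.mem_Ico]; omega
      rw [← Finset.sum_mul, h₂, Finset.sum_Ico_eq_sum_range, mul_comm, div_eq_mul_inv]
      refine mul_le_mul_of_nonneg_left ?_ (by positivity)
      simp only [Nat.add_sub_cancel_left]
      exact (hasSum_geometric_of_lt_one (Real.sqrt_nonneg γ)
        (sqrt_lt_one_of hγ1)).summable.sum_le_tsum _ (fun j _ => by positivity) |>.trans_eq
        (tsum_geometric_of_lt_one (Real.sqrt_nonneg γ) (sqrt_lt_one_of hγ1))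
  have b₃ := h.abs_grad_log_P_le hK₁ x ξ (p T).1 (p T).2 (p (T + 1)).1 i
  rw [abs_mul, abs_mul, abs_of_nonneg (by positivity : 0 ≤ γ / (1 - γ))]
  have b₄ : γ / (1 - γ) * |∑ t ∈ Finset.Icc (T + 1) (T + T' + 1), (Real.sqrt γ) ^ (t - (T + 1)) *
      softReward (M x ξ) π lam (p t)| *
      |grad (fun y => Real.log ((M y ξ).P (p T).1 (p T).2 (p (T + 1)).1)) x i| ≤
      γ / (1 - γ) * ((R + lam * Fintype.card A) / (1 - Real.sqrt γ)) * K₁ := by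
    gcongr
  have b₅ : 0 ≤ γ / (1 - γ) * ((R + lam * Fintype.card A) / (1 - Real.sqrt γ)) * K₁ * T := by
    positivity
  rw [rolloutBound, add_mul, mul_add (γ / (1 - γ) * _ * K₁), mul_one]
  linarith

theorem measurable_rolloutEst (T T' : ℕ) (p : ℕ → S × A) (i : Fin d) :
    Measurable fun z : ((Fin d → ℝ) × Ξ) × Policy S A =>
      rolloutEst M γ lam z.1.1 z.1.2 z.2 T T' p i := by
  simp only [rolloutEst_apply]
  refine Measurable.add ?_ (Measurable.mul (Measurable.const_mul ?_ _) ?_)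
  · exact Finset.measurable_fun_sum _ fun t _ => (h.measurable_grad_r _ _ i).comp measurable_fst
  · exact Finset.measurable_fun_sum _ fun t _ => (h.measurable_softReward _).const_mul _
  · exact (h.measurable_grad_log_P _ _ _ i).comp measurable_fst

/-- The score identity replaces derivatives of transition probabilities by weighted transitions, the
form that a sampled path can realize. -/
theorem gradQ_eq_resolvent (x : Fin d → ℝ) (ξ : Ξ) (π : Policy S A) (i : Fin d) (q : S × A) :
    gradQ M γ lam x ξ π i q =
      resolvent γ (pairKernel (M x ξ) π) (fun z => grad (fun y => (M y ξ).r z.1 z.2) x i +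
        γ * ∑ z', pairKernel (M x ξ) π z z' *
          grad (fun y => Real.log ((M y ξ).P z.1 z.2 z'.1)) x i *
          resolvent γ (pairKernel (M x ξ) π) (softReward (M x ξ) π lam) z') q := by
  rw [gradQ, dqValue]
  congr 1
  funext z
  congr 2
  rw [Fintype.sum_prod_type]
  refine Finset.sum_congr rfl fun s' _ => ?_
  rw [Finset.mul_sum]
  refine Finset.sum_congr rfl fun a' _ => ?_
  rw [← h.mul_grad_log_P, pairKernel, qValue]
  ring

end Regular

end RolloutSums

/-! ### The discrete law of a single rollout, and unbiasedness. -/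

section RolloutLaw

variable {S A : Type*} [Fintype S] [Fintype A]

variable (S A) in
/-- The part of a rollout that the estimator reads: the pair `(s, a)` that is drawn first, the
two horizons, and the path up to the sum of the horizons. -/
abbrev RolloutCode := Σ k : (S × A) × ℕ × ℕ, (Fin (k.2.1 + k.2.2 + 1 + 1) → S × A)

/-- The weight of a rollout when the first point of the path has law `start q`. -/
def rolloutWeight (m : MDP S A) (γ : ℝ) (ν : S → ℝ) (π : Policy S A)
    (start : S × A → S × A → ℝ) (w : RolloutCode S A) : ℝ :=
  ν w.1.1.1 * π.1 w.1.1.1 w.1.1.2 * geoWeight γ w.1.2.1 * geoWeight (Real.sqrt γ) w.1.2.2 *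
    (start w.1.1 (extendPath w.2 0) * m.contProb π (extendPath w.2) (w.1.2.1 + w.1.2.2 + 1))

variable {m : MDP S A} {γ : ℝ} {ν : S → ℝ} {π : Policy S A} {start : S × A → S × A → ℝ}

theorem contProb_nonneg (p : ℕ → S × A) (n : ℕ) : 0 ≤ m.contProb π p n :=
  Finset.prod_nonneg fun _ _ => mul_nonneg ((m.P_mem _ _).1 _) ((π.2 _).1 _)

theorem rolloutWeight_nonneg (hγ : 0 ≤ γ) (hγ1 : γ < 1) (hν : ν ∈ stdSimplex ℝ S)
    (hstart : ∀ q, start q ∈ stdSimplex ℝ (S × A)) (w : RolloutCode S A) :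
    0 ≤ rolloutWeight m γ ν π start w :=
  mul_nonneg (mul_nonneg (mul_nonneg (mul_nonneg (hν.1 _) ((π.2 _).1 _))
    (geoWeight_nonneg hγ hγ1 _)) (geoWeight_nonneg (Real.sqrt_nonneg γ) (sqrt_lt_one_of hγ1) _))
    (mul_nonneg ((hstart _).1 _) (contProb_nonneg _ _))

theorem sum_contProb (n : ℕ) (ψ : S × A → ℝ) (φ : (ℕ → S × A) → ℝ) :
    ∑ p : Fin (n + 1) → S × A, ψ (extendPath p 0) * m.contProb π (extendPath p) n *
      φ (extendPath p) = ∑ q, ψ q * pathMean (pairKernel m π) n φ q :=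
  sum_path_eq_pathMean (pairKernel m π) n ψ φ

theorem sum_start_mul_contProb (n : ℕ) {ψ : S × A → ℝ} (hψ : ψ ∈ stdSimplex ℝ (S × A)) :
    ∑ p : Fin (n + 1) → S × A, ψ (extendPath p 0) * m.contProb π (extendPath p) n = 1 := by
  have := sum_contProb (m := m) (π := π) n ψ fun _ => 1
  simpa only [mul_one, pathMean_const (pairKernel_mem m π), hψ.2] using this

theorem tsum_ofReal_geoWeight {q : ℝ} (hq : 0 ≤ q) (hq1 : q < 1) :
    ∑' k, ENNReal.ofReal (geoWeight q k) = 1 := by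
  rw [← ENNReal.ofReal_tsum_of_nonneg (geoWeight_nonneg hq hq1) (hasSum_geoWeight hq hq1).summable,
    (hasSum_geoWeight hq hq1).tsum_eq, ENNReal.ofReal_one]

theorem sum_pair (hν : ν ∈ stdSimplex ℝ S) : ∑ q : S × A, ν q.1 * π.1 q.1 q.2 = 1 := by
  simp only [Fintype.sum_prod_type, ← Finset.mul_sum, (π.2 _).2, mul_one, hν.2]

/-- Summing out the path, the second horizon and the initial pair, each of total mass one, leaves
the geometric law of the first horizon. -/
theorem tsum_rolloutWeight_mul (hγ : 0 ≤ γ) (hγ1 : γ < 1) (hν : ν ∈ stdSimplex ℝ S)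
    (hstart : ∀ q, start q ∈ stdSimplex ℝ (S × A)) (ψ : ℕ → ENNReal) :
    ∑' w, ENNReal.ofReal (rolloutWeight m γ ν π start w) * ψ w.1.2.1 =
      ∑' T, ENNReal.ofReal (geoWeight γ T) * ψ T := by
  have hs0 := Real.sqrt_nonneg γ
  have hs1 := sqrt_lt_one_of hγ1
  have h₁ : ∀ k : (S × A) × ℕ × ℕ, ∑' p : Fin (k.2.1 + k.2.2 + 1 + 1) → S × A,
      ENNReal.ofReal (rolloutWeight m γ ν π start ⟨k, p⟩) * ψ k.2.1 =
      ENNReal.ofReal (ν k.1.1 * π.1 k.1.1 k.1.2) * (ENNReal.ofReal (geoWeight γ k.2.1) *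
        ψ k.2.1 * ENNReal.ofReal (geoWeight (Real.sqrt γ) k.2.2)) := by
    intro k
    have hc : 0 ≤ ν k.1.1 * π.1 k.1.1 k.1.2 := mul_nonneg (hν.1 _) ((π.2 _).1 _)
    rw [ENNReal.tsum_mul_right, tsum_fintype, ← ENNReal.ofReal_sum_of_nonneg
      fun p _ => rolloutWeight_nonneg hγ hγ1 hν hstart ⟨k, p⟩]
    simp only [rolloutWeight]
    rw [← Finset.mul_sum, sum_start_mul_contProb _ (hstart k.1), mul_one,
      ENNReal.ofReal_mul (mul_nonneg hc (geoWeight_nonneg hγ hγ1 _)), ENNReal.ofReal_mul hc]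
    ring
  rw [ENNReal.tsum_sigma']
  simp only [h₁]
  rw [ENNReal.tsum_prod']
  simp only [ENNReal.tsum_mul_left]
  have h₂ : ∑' q : S × A, ENNReal.ofReal (ν q.1 * π.1 q.1 q.2) = 1 := by
    rw [tsum_fintype, ← ENNReal.ofReal_sum_of_nonneg
      fun q _ => mul_nonneg (hν.1 _) ((π.2 _).1 _), sum_pair hν, ENNReal.ofReal_one]
  rw [ENNReal.tsum_mul_right, h₂, one_mul, ENNReal.tsum_prod']
  simp only [ENNReal.tsum_mul_left, tsum_ofReal_geoWeight hs0 hs1, mul_one]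

/-- The second moment of `1 + T` for a geometric `T`. -/
def geoMoment (γ : ℝ) : ℝ := ∑' k : ℕ, geoWeight γ k * (1 + (k : ℝ)) ^ 2

theorem geoMoment_nonneg (hγ : 0 ≤ γ) (hγ1 : γ < 1) : 0 ≤ geoMoment γ :=
  tsum_nonneg fun k => mul_nonneg (geoWeight_nonneg hγ hγ1 k) (by positivity)

theorem tsum_geoWeight_mul_sq (hγ : 0 ≤ γ) (hγ1 : γ < 1) :
    ∑' T : ℕ, ENNReal.ofReal (geoWeight γ T) * ENNReal.ofReal ((1 + (T : ℝ)) ^ 2) =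
      ENNReal.ofReal (geoMoment γ) := by
  simp only [← ENNReal.ofReal_mul (geoWeight_nonneg hγ hγ1 _)]
  exact (ENNReal.ofReal_tsum_of_nonneg
    (fun k => mul_nonneg (geoWeight_nonneg hγ hγ1 k) (by positivity))
    (summable_geoWeight_mul_sq hγ hγ1)).symm

variable [DecidableEq S] [DecidableEq A] {d : ℕ} {Ξ : Type*} [MeasurableSpace Ξ]
  {M : (Fin d → ℝ) → Ξ → MDP S A}
  {f : (Fin d → ℝ) → (S → A → ℝ) → Ξ → ℝ} {Pξ : Measure Ξ} {U : Set (S → A → ℝ)}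
  {lam Lf Sf R K₁ K₂ : ℝ}

/-- Only finiteness matters here, so the linear growth in `T` is replaced by $(1+T)^2$; the same
moment `geoMoment` then serves for integrability and for the second moment. -/
theorem Regular.tsum_rolloutWeight_mul_enorm_le (h : Regular M f Pξ U Lf Sf R K₁ K₂)
    [Nonempty S] [Nonempty A] (hγ : 0 ≤ γ) (hγ1 : γ < 1) (hlam : 0 < lam)
    (hν : ν ∈ stdSimplex ℝ S) (hstart : ∀ q, start q ∈ stdSimplex ℝ (S × A)) (x : Fin d → ℝ)
    (ξ : Ξ) (i : Fin d) {u : S × A → ℝ} {Cu : ℝ} (hCu : ∀ q, |u q| ≤ Cu) :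
    ∑' w, ENNReal.ofReal (rolloutWeight (M x ξ) γ ν π start w) *
      ‖u w.1.1 * rolloutEst M γ lam x ξ π w.1.2.1 w.1.2.2 (extendPath w.2) i‖ₑ ≤
      ENNReal.ofReal (Cu * rolloutBound A γ lam R K₁ K₂) * ENNReal.ofReal (geoMoment γ) := by
  have : Nonempty Ξ := ⟨ξ⟩
  rw [← tsum_geoWeight_mul_sq hγ hγ1,
    ← tsum_rolloutWeight_mul (m := M x ξ) (π := π) hγ hγ1 hν hstart
      (fun T => ENNReal.ofReal ((1 + (T : ℝ)) ^ 2)), ← ENNReal.tsum_mul_left]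
  refine ENNReal.tsum_le_tsum fun w => ?_
  have hCu0 : 0 ≤ Cu := (abs_nonneg _).trans (hCu w.1.1)
  have hB := h.rolloutBound_nonneg hγ hγ1 hlam
  rw [mul_left_comm]
  refine mul_le_mul_right ?_ _
  rw [← ENNReal.ofReal_mul (by positivity), Real.enorm_eq_ofReal_abs]
  refine ENNReal.ofReal_le_ofReal ?_
  rw [abs_mul, mul_assoc]
  refine mul_le_mul (hCu _) ((h.abs_rolloutEst_le hγ hγ1 hlam x ξ π _ _ _ i).trans
    (mul_le_mul_of_nonneg_left ?_ hB)) (abs_nonneg _) hCu0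
  have : (0 : ℝ) ≤ w.1.2.1 := Nat.cast_nonneg _
  nlinarith

/-- The rollout estimator is unbiased. -/
theorem Regular.tsum_rolloutWeight_mul_rolloutEst (h : Regular M f Pξ U Lf Sf R K₁ K₂)
    [Nonempty S] [Nonempty A] (hγ : 0 ≤ γ) (hγ1 : γ < 1) (hlam : 0 < lam)
    (hν : ν ∈ stdSimplex ℝ S) (hstart : ∀ q, start q ∈ stdSimplex ℝ (S × A)) (x : Fin d → ℝ)
    (ξ : Ξ) (i : Fin d) (u : S × A → ℝ) :
    ∑' w, rolloutWeight (M x ξ) γ ν π start w *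
      (u w.1.1 * rolloutEst M γ lam x ξ π w.1.2.1 w.1.2.2 (extendPath w.2) i) =
      ∑ q : S × A, ν q.1 * π.1 q.1 q.2 * u q *
        ∑ q₀, start q q₀ * gradQ M γ lam x ξ π i q₀ := by
  have : Nonempty Ξ := ⟨ξ⟩
  set K := pairKernel (M x ξ) π
  set dr : S × A → ℝ := fun z => grad (fun y => (M y ξ).r z.1 z.2) x i
  set b : S × A → S × A → ℝ := fun z z' => grad (fun y => Real.log ((M y ξ).P z.1 z.2 z'.1)) x i
  set ρ := softReward (M x ξ) π lam
  have hK : ∀ q, K q ∈ stdSimplex ℝ (S × A) := pairKernel_mem (M x ξ) π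
  obtain ⟨Cu, hCu⟩ := exists_abs_bound u
  have hsum : Summable fun w : RolloutCode S A => rolloutWeight (M x ξ) γ ν π start w *
      (u w.1.1 * rolloutEst M γ lam x ξ π w.1.2.1 w.1.2.2 (extendPath w.2) i) := by
    refine Summable.of_enorm (ne_top_of_le_ne_top
      (ENNReal.mul_ne_top ENNReal.ofReal_ne_top ENNReal.ofReal_ne_top)
      (le_trans (le_of_eq (tsum_congr fun w => ?_))
        (h.tsum_rolloutWeight_mul_enorm_le (π := π) hγ hγ1 hlam hν hstart x ξ i hCu)))
    rw [enorm_mul, Real.enorm_of_nonneg (rolloutWeight_nonneg hγ hγ1 hν hstart w)]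
  have hpath : ∀ k : (S × A) × ℕ × ℕ, ∑' p : Fin (k.2.1 + k.2.2 + 1 + 1) → S × A,
      rolloutWeight (M x ξ) γ ν π start ⟨k, p⟩ *
        (u k.1 * rolloutEst M γ lam x ξ π k.2.1 k.2.2 (extendPath p) i) =
      ν k.1.1 * π.1 k.1.1 k.1.2 * u k.1 * (geoWeight γ k.2.1 * (geoWeight (Real.sqrt γ) k.2.2 *
        ∑ q₀, start k.1 q₀ * rolloutMean γ K dr b ρ k.2.1 k.2.2 q₀)) := by
    intro k
    rw [tsum_fintype]
    have h₁ := sum_contProb (m := M x ξ) (π := π) (k.2.1 + k.2.2 + 1) (start k.1)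
      fun p => rolloutEst M γ lam x ξ π k.2.1 k.2.2 p i
    simp only [rolloutEst_apply] at h₁ ⊢
    have h₂ : ∀ q₀, pathMean K (k.2.1 + k.2.2 + 1) (fun p =>
        ∑ t ∈ Finset.range (k.2.1 + 1), grad (fun y => (M y ξ).r (p t).1 (p t).2) x i +
        (γ / (1 - γ) * ∑ t ∈ Finset.Icc (k.2.1 + 1) (k.2.1 + k.2.2 + 1),
        (Real.sqrt γ) ^ (t - (k.2.1 + 1)) * softReward (M x ξ) π lam (p t)) *
        grad (fun y => Real.log ((M y ξ).P (p k.2.1).1 (p k.2.1).2 (p (k.2.1 + 1)).1)) x i) q₀ =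
        rolloutMean γ K dr b ρ k.2.1 k.2.2 q₀ := fun q₀ =>
      pathMean_rollout hK γ dr b ρ k.2.1 k.2.2 q₀
    simp only [K] at h₂
    simp only [h₂] at h₁
    rw [← h₁, Finset.mul_sum, Finset.mul_sum, Finset.mul_sum]
    refine Finset.sum_congr rfl fun p _ => ?_
    simp only [rolloutWeight]
    ring
  -- Absolute summability allows the order path, then `T'`, then `T`, with the finite sum over
  -- initial pairs outside: the path sum gives `rolloutMean`, and the two horizon sums are the inner
  -- and outer identities above.
  rw [hsum.tsum_sigma]
  simp only [hpath]
  have hsum' := hsum.sigma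
  simp only [hpath] at hsum'
  rw [hsum'.tsum_prod, tsum_fintype]
  refine Finset.sum_congr rfl fun q _ => ?_
  have hsum'' := hsum'.prod_factor q
  simp only at hsum'' ⊢
  rw [hsum''.tsum_prod]
  have hin : ∀ T, HasSum (fun T' => ν q.1 * π.1 q.1 q.2 * u q * (geoWeight γ T *
      (geoWeight (Real.sqrt γ) T' * ∑ q₀, start q q₀ * rolloutMean γ K dr b ρ T T' q₀)))
      (ν q.1 * π.1 q.1 q.2 * u q * (geoWeight γ T * ∑ q₀, start q q₀ *
        (∑ t ∈ Finset.range (T + 1), ((avg K)^[t] dr) q₀ + γ / (1 - γ) *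
        ((avg K)^[T] fun z => ∑ z', K z z' * b z z' * resolvent γ K ρ z') q₀))) := by
    intro T
    refine HasSum.mul_left _ (HasSum.mul_left _ ?_)
    simp only [Finset.mul_sum]
    refine hasSum_sum fun q₀ _ => ?_
    refine ((hasSum_rolloutMean_inner hγ hγ1 hK dr b ρ T q₀).mul_left (start q q₀)).congr_fun
      fun T' => ?_
    ring
  simp only [(hin _).tsum_eq]
  refine HasSum.tsum_eq (HasSum.mul_left _ ?_)
  simp only [Finset.mul_sum]
  refine hasSum_sum fun q₀ _ => ?_
  rw [h.gradQ_eq_resolvent]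
  refine ((hasSum_rolloutMean_outer hγ hγ1 hK dr
    (fun z => ∑ z', K z z' * b z z' * resolvent γ K ρ z') q₀).mul_left (start q q₀)).congr_fun
    fun T => ?_
  ring

end RolloutLaw

/-! ### Extracting one of the two rollouts from a draw. -/

section Codes

variable {S A : Type*} [Fintype S] [DecidableEq S] [Fintype A] [DecidableEq A]

/-- The rollout for the action value. -/
def codeQ (z : Draw S A) : RolloutCode S A := ⟨((z.s, z.a), z.TQ, z.TQ'), fun j => z.pQ j⟩

/-- The rollout for the value. -/
def codeV (z : Draw S A) : RolloutCode S A := ⟨((z.s, z.a), z.TV, z.TV'), fun j => z.pV j⟩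

/-- Law of the first point of the rollout for the action value. -/
def startQ (q q₀ : S × A) : ℝ := if q₀ = q then 1 else 0

/-- Law of the first point of the rollout for the value. -/
def startV (π : Policy S A) (q q₀ : S × A) : ℝ := if q₀.1 = q.1 then π.1 q.1 q₀.2 else 0

theorem sum_startQ_mul (q : S × A) (g : S × A → ℝ) : ∑ q₀, startQ q q₀ * g q₀ = g q := by
  simp [startQ]

theorem sum_startV_mul (π : Policy S A) (q : S × A) (g : S × A → ℝ) :
    ∑ q₀, startV π q q₀ * g q₀ = ∑ b, π.1 q.1 b * g (q.1, b) := by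
  simp only [startV, Fintype.sum_prod_type, ite_mul, zero_mul]
  rw [Finset.sum_eq_single q.1 (fun s _ hs => by simp [hs]) (by simp)]
  simp

theorem startQ_mem (q : S × A) : startQ q ∈ stdSimplex ℝ (S × A) :=
  ⟨fun q₀ => by unfold startQ; split_ifs <;> simp, by simp [startQ]⟩

theorem startV_mem (π : Policy S A) (q : S × A) : startV π q ∈ stdSimplex ℝ (S × A) := by
  refine ⟨fun q₀ => ?_, ?_⟩
  · unfold startV
    split_ifs
    · exact (π.2 _).1 _
    · exact le_rfl
  · have := sum_startV_mul π q fun _ => 1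
    simpa only [mul_one, (π.2 _).2] using this

theorem extendPath_restrict {Y : Type*} [Fintype Y] {n : ℕ} (p : ℕ → Y) {k : ℕ} (hk : k ≤ n) :
    extendPath (fun j : Fin (n + 1) => p j) k = p k :=
  extendPath_apply_of_le _ hk

theorem codeQ_eq_iff (z : Draw S A) (w : RolloutCode S A) :
    codeQ z = w ↔ z.s = w.1.1.1 ∧ z.a = w.1.1.2 ∧ z.TQ = w.1.2.1 ∧ z.TQ' = w.1.2.2 ∧
      ∀ i ≤ w.1.2.1 + w.1.2.2 + 1, z.pQ i = extendPath w.2 i := by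
  constructor
  · rintro rfl
    exact ⟨rfl, rfl, rfl, rfl, fun i hi => (extendPath_restrict z.pQ hi).symm⟩
  · obtain ⟨⟨⟨s, a⟩, T, T'⟩, p⟩ := w
    obtain ⟨s', a', TQ, TV, TQ', TV', pQ, pV⟩ := z
    rintro ⟨h₁, h₂, h₃, h₄, h₅⟩
    simp only at h₁ h₂ h₃ h₄ h₅ p
    subst h₁ h₂ h₃ h₄
    simp only [codeQ]
    congr 1
    funext j
    rw [h₅ j (by have := j.2; omega), extendPath_apply_of_le _ (by have := j.2; omega)]

theorem codeV_eq_iff (z : Draw S A) (w : RolloutCode S A) :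
    codeV z = w ↔ z.s = w.1.1.1 ∧ z.a = w.1.1.2 ∧ z.TV = w.1.2.1 ∧ z.TV' = w.1.2.2 ∧
      ∀ i ≤ w.1.2.1 + w.1.2.2 + 1, z.pV i = extendPath w.2 i := by
  constructor
  · rintro rfl
    exact ⟨rfl, rfl, rfl, rfl, fun i hi => (extendPath_restrict z.pV hi).symm⟩
  · obtain ⟨⟨⟨s, a⟩, T, T'⟩, p⟩ := w
    obtain ⟨s', a', TQ, TV, TQ', TV', pQ, pV⟩ := z
    rintro ⟨h₁, h₂, h₃, h₄, h₅⟩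
    simp only at h₁ h₂ h₃ h₄ h₅ p
    subst h₁ h₂ h₃ h₄
    simp only [codeV]
    congr 1
    funext j
    rw [h₅ j (by have := j.2; omega), extendPath_apply_of_le _ (by have := j.2; omega)]

/-- The draws whose first rollout has code `w`, by the data of the second rollout. -/
def drawOfQ (w : RolloutCode S A)
    (j : ℕ × ℕ × (Fin (w.1.2.1 + w.1.2.2 + 1 + 1) → S × A)) : Draw S A :=
  ⟨w.1.1.1, w.1.1.2, w.1.2.1, j.1, w.1.2.2, j.2.1, extendPath w.2, extendPath j.2.2⟩

/-- The draws whose second rollout has code `w`, by the data of the first rollout. -/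
def drawOfV (w : RolloutCode S A)
    (j : ℕ × ℕ × (Fin (w.1.2.1 + w.1.2.2 + 1 + 1) → S × A)) : Draw S A :=
  ⟨w.1.1.1, w.1.1.2, j.1, w.1.2.1, j.2.1, w.1.2.2, extendPath j.2.2, extendPath w.2⟩

/-- `drawProb` gives the probability of cylinders that fix both rollouts to a common depth. The
event that fixes only the first is the union of such cylinders over the countable data of the
second, disjoint by `agree_drawOfQ_inj`. -/
theorem codeQ_eq_iff_exists (z : Draw S A) (w : RolloutCode S A) :
    codeQ z = w ↔ ∃ j, z.Agree (w.1.2.1 + w.1.2.2 + 1) (drawOfQ w j) := by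
  rw [codeQ_eq_iff]
  constructor
  · rintro ⟨h₁, h₂, h₃, h₄, h₅⟩
    exact ⟨(z.TV, z.TV', fun j => z.pV j), h₁, h₂, h₃, rfl, h₄, rfl, h₅,
      fun i hi => (extendPath_restrict z.pV hi).symm⟩
  · rintro ⟨j, h₁, h₂, h₃, -, h₄, -, h₅, -⟩
    exact ⟨h₁, h₂, h₃, h₄, h₅⟩

theorem codeV_eq_iff_exists (z : Draw S A) (w : RolloutCode S A) :
    codeV z = w ↔ ∃ j, z.Agree (w.1.2.1 + w.1.2.2 + 1) (drawOfV w j) := by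
  rw [codeV_eq_iff]
  constructor
  · rintro ⟨h₁, h₂, h₃, h₄, h₅⟩
    exact ⟨(z.TQ, z.TQ', fun j => z.pQ j), h₁, h₂, rfl, h₃, rfl, h₄,
      fun i hi => (extendPath_restrict z.pQ hi).symm, h₅⟩
  · rintro ⟨j, h₁, h₂, -, h₃, -, h₄, -, h₅⟩
    exact ⟨h₁, h₂, h₃, h₄, h₅⟩

theorem eq_of_extendPath_eq {Y : Type*} [Fintype Y] {n : ℕ} {p p' : Fin (n + 1) → Y} {r : ℕ → Y}
    (h : ∀ i ≤ n, r i = extendPath p i) (h' : ∀ i ≤ n, r i = extendPath p' i) : p = p' := by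
  funext j
  have hj : (j : ℕ) ≤ n := by have := j.2; omega
  have := (h j hj).symm.trans (h' j hj)
  rwa [extendPath_apply_of_le _ hj, extendPath_apply_of_le _ hj] at this

theorem agree_drawOfQ_inj {z : Draw S A} {w : RolloutCode S A}
    {j j' : ℕ × ℕ × (Fin (w.1.2.1 + w.1.2.2 + 1 + 1) → S × A)}
    (h : z.Agree (w.1.2.1 + w.1.2.2 + 1) (drawOfQ w j))
    (h' : z.Agree (w.1.2.1 + w.1.2.2 + 1) (drawOfQ w j')) : j = j' := by
  obtain ⟨-, -, -, h₁, -, h₂, -, h₃⟩ := h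
  obtain ⟨-, -, -, h₁', -, h₂', -, h₃'⟩ := h'
  exact Prod.ext (h₁.symm.trans h₁') (Prod.ext (h₂.symm.trans h₂') (eq_of_extendPath_eq h₃ h₃'))

theorem agree_drawOfV_inj {z : Draw S A} {w : RolloutCode S A}
    {j j' : ℕ × ℕ × (Fin (w.1.2.1 + w.1.2.2 + 1 + 1) → S × A)}
    (h : z.Agree (w.1.2.1 + w.1.2.2 + 1) (drawOfV w j))
    (h' : z.Agree (w.1.2.1 + w.1.2.2 + 1) (drawOfV w j')) : j = j' := by
  obtain ⟨-, -, h₁, -, h₂, -, h₃, -⟩ := h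
  obtain ⟨-, -, h₁', -, h₂', -, h₃', -⟩ := h'
  exact Prod.ext (h₁.symm.trans h₁') (Prod.ext (h₂.symm.trans h₂') (eq_of_extendPath_eq h₃ h₃'))

variable {m : MDP S A} {γ : ℝ} {ν : S → ℝ} {π : Policy S A}

/-- Marginalization: horizons and path of the rollout that is not observed carry total mass one,
whatever depth `n` is fixed. -/
theorem tsum_other_rollout (hγ : 0 ≤ γ) (hγ1 : γ < 1) {start : S × A → ℝ}
    (hstart : start ∈ stdSimplex ℝ (S × A)) {c : ℝ} (hc : 0 ≤ c) (n : ℕ) :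
    ∑' j : ℕ × ℕ × (Fin (n + 1) → S × A), ENNReal.ofReal (c * (geoWeight γ j.1 *
      (geoWeight (Real.sqrt γ) j.2.1 *
        (start (extendPath j.2.2 0) * m.contProb π (extendPath j.2.2) n)))) =
      ENNReal.ofReal c := by
  have hs0 := Real.sqrt_nonneg γ
  have hs1 := sqrt_lt_one_of hγ1
  have h₁ : ∀ j : ℕ × ℕ × (Fin (n + 1) → S × A), ENNReal.ofReal (c * (geoWeight γ j.1 *
      (geoWeight (Real.sqrt γ) j.2.1 *
        (start (extendPath j.2.2 0) * m.contProb π (extendPath j.2.2) n)))) =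
      ENNReal.ofReal c * (ENNReal.ofReal (geoWeight γ j.1) *
      (ENNReal.ofReal (geoWeight (Real.sqrt γ) j.2.1) *
        ENNReal.ofReal (start (extendPath j.2.2 0) * m.contProb π (extendPath j.2.2) n))) := by
    intro j
    rw [ENNReal.ofReal_mul hc, ENNReal.ofReal_mul (geoWeight_nonneg hγ hγ1 _),
      ENNReal.ofReal_mul (geoWeight_nonneg hs0 hs1 _)]
  have h₂ : ∑' p : Fin (n + 1) → S × A,
      ENNReal.ofReal (start (extendPath p 0) * m.contProb π (extendPath p) n) = 1 := by
    rw [tsum_fintype, ← ENNReal.ofReal_sum_of_nonneg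
      fun p _ => mul_nonneg (hstart.1 _) (contProb_nonneg _ _), sum_start_mul_contProb n hstart,
      ENNReal.ofReal_one]
  simp only [h₁]
  rw [ENNReal.tsum_mul_left, ENNReal.tsum_prod']
  simp only [ENNReal.tsum_mul_left]
  rw [ENNReal.tsum_mul_right, ENNReal.tsum_prod']
  simp only [ENNReal.tsum_mul_left, h₂, mul_one, tsum_ofReal_geoWeight hs0 hs1,
    tsum_ofReal_geoWeight hγ hγ1]

theorem drawProb_drawOfQ (w : RolloutCode S A)
    (j : ℕ × ℕ × (Fin (w.1.2.1 + w.1.2.2 + 1 + 1) → S × A)) :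
    drawProb m γ ν π (drawOfQ w j) (w.1.2.1 + w.1.2.2 + 1) =
      rolloutWeight m γ ν π startQ w * (geoWeight γ j.1 * (geoWeight (Real.sqrt γ) j.2.1 *
        (startV π w.1.1 (extendPath j.2.2 0) *
          m.contProb π (extendPath j.2.2) (w.1.2.1 + w.1.2.2 + 1)))) := by
  have hQ : ∀ n, m.pathProbFromPair π w.1.1.1 w.1.1.2 (extendPath w.2) n =
    startQ w.1.1 (extendPath w.2 0) * m.contProb π (extendPath w.2) n := fun _ => rfl
  have hV : ∀ n, m.pathProbFromState π w.1.1.1 (extendPath j.2.2) n =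
    startV π w.1.1 (extendPath j.2.2 0) * m.contProb π (extendPath j.2.2) n := fun _ => rfl
  simp only [drawProb, drawOfQ, rolloutWeight, hQ, hV]
  ring

theorem drawProb_drawOfV (w : RolloutCode S A)
    (j : ℕ × ℕ × (Fin (w.1.2.1 + w.1.2.2 + 1 + 1) → S × A)) :
    drawProb m γ ν π (drawOfV w j) (w.1.2.1 + w.1.2.2 + 1) =
      rolloutWeight m γ ν π (startV π) w * (geoWeight γ j.1 * (geoWeight (Real.sqrt γ) j.2.1 *
        (startQ w.1.1 (extendPath j.2.2 0) *
          m.contProb π (extendPath j.2.2) (w.1.2.1 + w.1.2.2 + 1)))) := by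
  have hQ : ∀ n, m.pathProbFromPair π w.1.1.1 w.1.1.2 (extendPath j.2.2) n =
    startQ w.1.1 (extendPath j.2.2 0) * m.contProb π (extendPath j.2.2) n := fun _ => rfl
  have hV : ∀ n, m.pathProbFromState π w.1.1.1 (extendPath w.2) n =
    startV π w.1.1 (extendPath w.2 0) * m.contProb π (extendPath w.2) n := fun _ => rfl
  simp only [drawProb, drawOfV, rolloutWeight, hQ, hV]
  ring

variable {d : ℕ} {Ξ : Type*} [MeasurableSpace Ξ] {M : (Fin d → ℝ) → Ξ → MDP S A}
  {f : (Fin d → ℝ) → (S → A → ℝ) → Ξ → ℝ} {Pξ : Measure Ξ} {U : Set (S → A → ℝ)}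
  {lam Lf Sf R K₁ K₂ : ℝ}

theorem Regular.measurable_contProb (h : Regular M f Pξ U Lf Sf R K₁ K₂) (p : ℕ → S × A)
    (n : ℕ) : Measurable fun z : ((Fin d → ℝ) × Ξ) × Policy S A =>
      (M z.1.1 z.1.2).contProb z.2 p n :=
  Finset.measurable_fun_prod _ fun _ _ => h.measurable_pairKernel _ _

theorem measurable_startV (q q₀ : S × A) : Measurable fun π : Policy S A => startV π q q₀ := by
  unfold startV
  split_ifs
  · exact measurable_policy_apply _ _
  · exact measurable_const

theorem Regular.measurable_rolloutWeight (h : Regular M f Pξ U Lf Sf R K₁ K₂)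
    {start : Policy S A → S × A → S × A → ℝ}
    (hstart : ∀ q q₀, Measurable fun π => start π q q₀) (w : RolloutCode S A) :
    Measurable fun z : ((Fin d → ℝ) × Ξ) × Policy S A =>
      rolloutWeight (M z.1.1 z.1.2) γ ν z.2 (start z.2) w :=
  (((((measurable_policy_apply _ _).comp measurable_snd).const_mul _).mul_const _).mul_const
    _).mul (((hstart _ _).comp measurable_snd).mul (h.measurable_contProb _ _))

end Codes

/-! ### Conditional law of each rollout in a run. -/

section RunLaw

variable {S A : Type*} [Fintype S] [DecidableEq S] [MeasurableSpace S] [DiscreteMeasurableSpace S]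
  [Fintype A] [DecidableEq A] [MeasurableSpace A] [DiscreteMeasurableSpace A]
  {d : ℕ} {Ξ : Type*} [MeasurableSpace Ξ] {M : (Fin d → ℝ) → Ξ → MDP S A}
  {f : (Fin d → ℝ) → (S → A → ℝ) → Ξ → ℝ} {Pξ : Measure Ξ} {U : Set (S → A → ℝ)}
  {γ lam Lf Sf R K₁ K₂ : ℝ} {ν : S → ℝ} {O : Kernel ((Fin d → ℝ) × Ξ) (Policy S A)}
  {α : ℝ} {x₀ : Fin d → ℝ} {T : ℕ} {Ω : Type*} {mΩ : MeasurableSpace Ω} {μ : Measure Ω}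
  {ℱ : Filtration ℕ mΩ} {X : ℕ → Ω → Fin d → ℝ} {ξ : ℕ → Ω → Ξ} {πo : ℕ → Ω → Policy S A}
  {z : ℕ → Ω → Draw S A} {τ : Ω → ℕ}

namespace IsRun

variable (hrun : IsRun M f γ lam ν Pξ O α x₀ T μ ℱ X ξ πo z τ)
include hrun

theorem measurable_X (t : ℕ) : Measurable (X t) := (hrun.X_meas t).mono (ℱ.le t) le_rfl

theorem measurable_state (t : ℕ) : Measurable fun ω => ((X t ω, ξ t ω), πo t ω) :=
  ((hrun.measurable_X t).prodMk (hrun.ξ_meas t)).prodMk (hrun.πo_meas t)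

theorem measurableSet_agree (t n : ℕ) (w : Draw S A) :
    MeasurableSet {ω | (z t ω).Agree n w} := by
  refine MeasurableSet.inter (hrun.s_meas t (measurableSet_singleton _)) <|
    MeasurableSet.inter (hrun.a_meas t (measurableSet_singleton _)) <|
    MeasurableSet.inter (hrun.TQ_meas t (measurableSet_singleton _)) <|
    MeasurableSet.inter (hrun.TV_meas t (measurableSet_singleton _)) <|
    MeasurableSet.inter (hrun.TQ'_meas t (measurableSet_singleton _)) <|
    MeasurableSet.inter (hrun.TV'_meas t (measurableSet_singleton _)) <|
    MeasurableSet.inter ?_ ?_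
  · have : {ω | ∀ i ≤ n, (z t ω).pQ i = w.pQ i} =
        ⋂ i, ⋂ (_ : i ≤ n), (fun ω => (z t ω).pQ i) ⁻¹' {w.pQ i} := by ext; simp
    change MeasurableSet {ω | ∀ i ≤ n, (z t ω).pQ i = w.pQ i}
    rw [this]
    exact MeasurableSet.iInter fun i => MeasurableSet.iInter fun _ =>
      ((measurable_pi_apply i).comp (hrun.pQ_meas t)) (measurableSet_singleton _)
  · have : {ω | ∀ i ≤ n, (z t ω).pV i = w.pV i} =
        ⋂ i, ⋂ (_ : i ≤ n), (fun ω => (z t ω).pV i) ⁻¹' {w.pV i} := by ext; simp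
    change MeasurableSet {ω | ∀ i ≤ n, (z t ω).pV i = w.pV i}
    rw [this]
    exact MeasurableSet.iInter fun i => MeasurableSet.iInter fun _ =>
      ((measurable_pi_apply i).comp (hrun.pV_meas t)) (measurableSet_singleton _)

theorem measurable_context (t : ℕ) :
    Measurable[ℱ t ⊔ MeasurableSpace.comap (ξ t) inferInstance] fun ω => (X t ω, ξ t ω) := by
  refine @Measurable.prodMk _ _ _ _ _ (_) _ _ ?_ ?_
  · exact (hrun.X_meas t).mono le_sup_left le_rfl
  · exact (comap_measurable (ξ t)).mono le_sup_right le_rfl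

theorem measurable_state_sup (t : ℕ) :
    Measurable[(ℱ t ⊔ MeasurableSpace.comap (ξ t) inferInstance) ⊔
      MeasurableSpace.comap (πo t) inferInstance] fun ω => ((X t ω, ξ t ω), πo t ω) := by
  refine @Measurable.prodMk _ _ _ _ _ (_) _ _ ?_ ?_
  · exact (hrun.measurable_context t).mono le_sup_left le_rfl
  · exact (comap_measurable (πo t)).mono le_sup_right le_rfl

theorem measurableSet_codeQ (t : ℕ) (w : RolloutCode S A) :
    MeasurableSet ((fun ω => codeQ (z t ω)) ⁻¹' {w}) := by
  have : (fun ω => codeQ (z t ω)) ⁻¹' {w} =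
      ⋃ j, {ω | (z t ω).Agree (w.1.2.1 + w.1.2.2 + 1) (drawOfQ w j)} := by
    ext ω; simp [codeQ_eq_iff_exists]
  rw [this]
  exact MeasurableSet.iUnion fun j => hrun.measurableSet_agree t _ _

theorem measurableSet_codeV (t : ℕ) (w : RolloutCode S A) :
    MeasurableSet ((fun ω => codeV (z t ω)) ⁻¹' {w}) := by
  have : (fun ω => codeV (z t ω)) ⁻¹' {w} =
      ⋃ j, {ω | (z t ω).Agree (w.1.2.1 + w.1.2.2 + 1) (drawOfV w j)} := by
    ext ω; simp [codeV_eq_iff_exists]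
  rw [this]
  exact MeasurableSet.iUnion fun j => hrun.measurableSet_agree t _ _

/-- `z_law` is applied to each cylinder of the disjoint union, `drawProb_drawOfQ` factors its weight
into the two rollouts, and the factor of the unobserved one sums to one. -/
theorem codeQ_law (h : Regular M f Pξ U Lf Sf R K₁ K₂) (hγ : 0 ≤ γ) (hγ1 : γ < 1)
    (hν : ν ∈ stdSimplex ℝ S) {t : ℕ} (ht : t < T) (w : RolloutCode S A)
    (B : Set (((Fin d → ℝ) × Ξ) × Policy S A)) (hB : MeasurableSet B) :
    μ ((fun ω => ((X t ω, ξ t ω), πo t ω)) ⁻¹' B ∩ (fun ω => codeQ (z t ω)) ⁻¹' {w}) =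
      ∫⁻ ω in (fun ω => ((X t ω, ξ t ω), πo t ω)) ⁻¹' B,
        ENNReal.ofReal (rolloutWeight (M (X t ω) (ξ t ω)) γ ν (πo t ω) startQ w) ∂μ := by
  have hset : (fun ω => codeQ (z t ω)) ⁻¹' {w} =
      ⋃ j, {ω | (z t ω).Agree (w.1.2.1 + w.1.2.2 + 1) (drawOfQ w j)} := by
    ext ω; simp [codeQ_eq_iff_exists]
  have hθ := hrun.measurable_state t
  rw [hset, Set.inter_iUnion, measure_iUnion]
  · simp only [hrun.z_law t ht _ (hrun.measurable_state_sup t hB), drawProb_drawOfQ]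
    rw [← lintegral_tsum]
    · refine lintegral_congr fun ω => ?_
      exact tsum_other_rollout hγ hγ1 (startV_mem _ _)
        (rolloutWeight_nonneg hγ hγ1 hν startQ_mem w) _
    · intro j
      refine Measurable.aemeasurable (Measurable.ennreal_ofReal (Measurable.mul ?_
        (Measurable.const_mul (Measurable.const_mul (Measurable.mul ?_ ?_) _) _)))
      · exact (h.measurable_rolloutWeight (start := fun _ => startQ)
          (fun _ _ => measurable_const) w).comp hθ
      · exact (measurable_startV _ _).comp (hrun.πo_meas t)
      · exact (h.measurable_contProb _ _).comp hθ
  · intro j j' hj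
    refine Set.disjoint_left.2 fun ω hω hω' => hj (agree_drawOfQ_inj hω.2 hω'.2)
  · exact fun j => (hθ hB).inter (hrun.measurableSet_agree t _ _)

theorem codeV_law (h : Regular M f Pξ U Lf Sf R K₁ K₂) (hγ : 0 ≤ γ) (hγ1 : γ < 1)
    (hν : ν ∈ stdSimplex ℝ S) {t : ℕ} (ht : t < T) (w : RolloutCode S A)
    (B : Set (((Fin d → ℝ) × Ξ) × Policy S A)) (hB : MeasurableSet B) :
    μ ((fun ω => ((X t ω, ξ t ω), πo t ω)) ⁻¹' B ∩ (fun ω => codeV (z t ω)) ⁻¹' {w}) =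
      ∫⁻ ω in (fun ω => ((X t ω, ξ t ω), πo t ω)) ⁻¹' B,
        ENNReal.ofReal (rolloutWeight (M (X t ω) (ξ t ω)) γ ν (πo t ω) (startV (πo t ω)) w) ∂μ := by
  have hset : (fun ω => codeV (z t ω)) ⁻¹' {w} =
      ⋃ j, {ω | (z t ω).Agree (w.1.2.1 + w.1.2.2 + 1) (drawOfV w j)} := by
    ext ω; simp [codeV_eq_iff_exists]
  have hθ := hrun.measurable_state t
  rw [hset, Set.inter_iUnion, measure_iUnion]
  · simp only [hrun.z_law t ht _ (hrun.measurable_state_sup t hB), drawProb_drawOfV]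
    rw [← lintegral_tsum]
    · refine lintegral_congr fun ω => ?_
      exact tsum_other_rollout hγ hγ1 (startQ_mem _)
        (rolloutWeight_nonneg hγ hγ1 hν (startV_mem _) w) _
    · intro j
      refine Measurable.aemeasurable (Measurable.ennreal_ofReal (Measurable.mul ?_
        (Measurable.const_mul (Measurable.const_mul (Measurable.const_mul ?_ _) _) _)))
      · exact (h.measurable_rolloutWeight (start := startV) measurable_startV w).comp hθ
      · exact (h.measurable_contProb _ _).comp hθ
  · intro j j' hj
    refine Set.disjoint_left.2 fun ω hω hω' => hj (agree_drawOfV_inj hω.2 hω'.2)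
  · exact fun j => (hθ hB).inter (hrun.measurableSet_agree t _ _)

end IsRun

end RunLaw

/-! ### Expectation of a weighted rollout. -/

section RolloutExpectation

variable {S A : Type*} [Fintype S] [DecidableEq S] [Fintype A] [DecidableEq A]
  [Nonempty S] [Nonempty A]
  {d : ℕ} {Ξ : Type*} [MeasurableSpace Ξ] {M : (Fin d → ℝ) → Ξ → MDP S A}
  {f : (Fin d → ℝ) → (S → A → ℝ) → Ξ → ℝ} {Pξ : Measure Ξ} {U : Set (S → A → ℝ)}
  {γ lam Lf Sf R K₁ K₂ : ℝ} {ν : S → ℝ}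
  {Ω : Type*} {mΩ : MeasurableSpace Ω} {μ : Measure Ω} [IsProbabilityMeasure μ]
  {θ : Ω → ((Fin d → ℝ) × Ξ) × Policy S A} {Z : Ω → RolloutCode S A}
  {start : Policy S A → S × A → S × A → ℝ}

theorem Regular.lintegral_horizon_sq (h : Regular M f Pξ U Lf Sf R K₁ K₂) (hγ : 0 ≤ γ)
    (hγ1 : γ < 1) (hν : ν ∈ stdSimplex ℝ S)
    (hstart : ∀ π q, start π q ∈ stdSimplex ℝ (S × A))
    (hstart' : ∀ q q₀, Measurable fun π => start π q q₀)
    (hθ : Measurable θ) (hZ : ∀ w, MeasurableSet (Z ⁻¹' {w}))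
    (hlaw : ∀ w, ∀ B, MeasurableSet B → μ (θ ⁻¹' B ∩ Z ⁻¹' {w}) =
      ∫⁻ ω in θ ⁻¹' B, ENNReal.ofReal
        (rolloutWeight (M (θ ω).1.1 (θ ω).1.2) γ ν (θ ω).2 (start (θ ω).2) w) ∂μ) :
    ∫⁻ ω, ENNReal.ofReal ((1 + ((Z ω).1.2.1 : ℝ)) ^ 2) ∂μ = ENNReal.ofReal (geoMoment γ) := by
  rw [lintegral_discrete (p := fun t w => rolloutWeight (M t.1.1 t.1.2) γ ν t.2 (start t.2) w)
    (G := fun _ w => ENNReal.ofReal ((1 + (w.1.2.1 : ℝ)) ^ 2)) hθ hZ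
    (h.measurable_rolloutWeight hstart') hlaw fun _ => measurable_const]
  simp only [tsum_rolloutWeight_mul hγ hγ1 hν (hstart _)
    (fun k => ENNReal.ofReal ((1 + (k : ℝ)) ^ 2)), tsum_geoWeight_mul_sq hγ hγ1]
  simp

/-- `u` will hold the test function of the iterate times the importance weighted derivative of the
loss, which is measurable in the state before the rollout and bounded. The two choices of `start`
cover both rollouts. -/
theorem Regular.integrable_rollout (h : Regular M f Pξ U Lf Sf R K₁ K₂) (hγ : 0 ≤ γ)
    (hγ1 : γ < 1) (hlam : 0 < lam) (hν : ν ∈ stdSimplex ℝ S)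
    (hstart : ∀ π q, start π q ∈ stdSimplex ℝ (S × A))
    (hstart' : ∀ q q₀, Measurable fun π => start π q q₀)
    (hθ : Measurable θ) (hZ : ∀ w, MeasurableSet (Z ⁻¹' {w}))
    (hlaw : ∀ w, ∀ B, MeasurableSet B → μ (θ ⁻¹' B ∩ Z ⁻¹' {w}) =
      ∫⁻ ω in θ ⁻¹' B, ENNReal.ofReal
        (rolloutWeight (M (θ ω).1.1 (θ ω).1.2) γ ν (θ ω).2 (start (θ ω).2) w) ∂μ)
    {u : ((Fin d → ℝ) × Ξ) × Policy S A → S × A → ℝ} (hu : ∀ q, Measurable fun t => u t q)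
    {Cu : ℝ} (hCu : ∀ t q, |u t q| ≤ Cu) (i : Fin d) :
    Integrable (fun ω => u (θ ω) (Z ω).1.1 * rolloutEst M γ lam (θ ω).1.1 (θ ω).1.2 (θ ω).2
      (Z ω).1.2.1 (Z ω).1.2.2 (extendPath (Z ω).2) i) μ ∧
    Integrable (fun ω => ∑ q : S × A, ν q.1 * (θ ω).2.1 q.1 q.2 * u (θ ω) q *
      ∑ q₀, start (θ ω).2 q q₀ * gradQ M γ lam (θ ω).1.1 (θ ω).1.2 (θ ω).2 i q₀) μ ∧
    ∫ ω, u (θ ω) (Z ω).1.1 * rolloutEst M γ lam (θ ω).1.1 (θ ω).1.2 (θ ω).2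
      (Z ω).1.2.1 (Z ω).1.2.2 (extendPath (Z ω).2) i ∂μ =
    ∫ ω, ∑ q : S × A, ν q.1 * (θ ω).2.1 q.1 q.2 * u (θ ω) q *
      ∑ q₀, start (θ ω).2 q q₀ * gradQ M γ lam (θ ω).1.1 (θ ω).1.2 (θ ω).2 i q₀ ∂μ := by
  set p : ((Fin d → ℝ) × Ξ) × Policy S A → RolloutCode S A → ℝ :=
    fun t w => rolloutWeight (M t.1.1 t.1.2) γ ν t.2 (start t.2) w
  set G : ((Fin d → ℝ) × Ξ) × Policy S A → RolloutCode S A → ℝ := fun t w =>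
    u t w.1.1 * rolloutEst M γ lam t.1.1 t.1.2 t.2 w.1.2.1 w.1.2.2 (extendPath w.2) i
  have hp : ∀ w, Measurable fun t => p t w := h.measurable_rolloutWeight hstart'
  have hG : ∀ w, Measurable fun t => G t w := fun w =>
    (hu _).mul (h.measurable_rolloutEst _ _ _ i)
  have hfin : ∫⁻ ω, ∑' w, ENNReal.ofReal (p (θ ω) w) * ‖G (θ ω) w‖ₑ ∂μ ≠ ⊤ := by
    refine ne_top_of_le_ne_top (b := ENNReal.ofReal (Cu * rolloutBound A γ lam R K₁ K₂) *
      ENNReal.ofReal (geoMoment γ))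
      (ENNReal.mul_ne_top ENNReal.ofReal_ne_top ENNReal.ofReal_ne_top) ?_
    refine (lintegral_mono fun ω => h.tsum_rolloutWeight_mul_enorm_le hγ hγ1 hlam hν
      (hstart (θ ω).2) (θ ω).1.1 (θ ω).1.2 i (hCu (θ ω))).trans ?_
    simp
  refine ⟨⟨(measurable_discrete hθ hZ hG).aestronglyMeasurable, ?_⟩, ?_, ?_⟩
  · have := lintegral_discrete (p := p) hθ hZ hp hlaw (G := fun t w => ‖G t w‖ₑ)
      fun w => (hG w).enorm
    rw [HasFiniteIntegral, this]
    exact hfin.lt_top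
  · refine Integrable.of_bound (C := Cu * gradBound A γ lam R K₁ K₂)
      (Measurable.aestronglyMeasurable (Measurable.comp (g := fun t => ∑ q : S × A,
        ν q.1 * t.2.1 q.1 q.2 * u t q * ∑ q₀, start t.2 q q₀ *
          gradQ M γ lam t.1.1 t.1.2 t.2 i q₀) (f := θ) ?_ hθ))
      (Filter.Eventually.of_forall fun ω => ?_)
    · refine Finset.measurable_fun_sum _ fun q _ => Measurable.mul (Measurable.mul
        (Measurable.const_mul ((measurable_policy_apply _ _).comp measurable_snd) _) (hu q))
        (Finset.measurable_fun_sum _ fun q₀ _ => Measurable.mul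
          ((hstart' q q₀).comp measurable_snd) (h.measurable_gradQ hγ hγ1 i q₀))
    · simp only [mul_assoc (_ * _)]
      refine abs_sum_simplex_mul_le (w := fun q : S × A => ν q.1 * (θ ω).2.1 q.1 q.2)
        ⟨fun q => mul_nonneg (hν.1 _) (((θ ω).2.2 _).1 _), sum_pair hν⟩ fun q => ?_
      rw [abs_mul]
      exact mul_le_mul (hCu _ _) (abs_sum_simplex_mul_le (hstart _ _)
        fun q₀ => h.abs_gradQ_le hγ hγ1 hlam _ _ _ i q₀) (abs_nonneg _)
        ((abs_nonneg _).trans (hCu (θ ω) q))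
  · have := integral_discrete (p := p) hθ hZ
      (fun t w => rolloutWeight_nonneg hγ hγ1 hν (hstart t.2) w) hp hlaw hG hfin
    refine this.trans (integral_congr_ae (Filter.Eventually.of_forall fun ω => ?_))
    exact h.tsum_rolloutWeight_mul_rolloutEst hγ hγ1 hlam hν (hstart _) _ _ i _

end RolloutExpectation

/-! ### Second moment and conditional mean of the hypergradient estimator. -/

section Estimator

theorem integral_add_sub {Ω : Type*} {mΩ : MeasurableSpace Ω} {μ : Measure Ω} {a b c : Ω → ℝ}
    (ha : Integrable a μ) (hb : Integrable b μ) (hc : Integrable c μ) :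
    ∫ ω, (a ω + (b ω - c ω)) ∂μ = ∫ ω, a ω ∂μ + (∫ ω, b ω ∂μ - ∫ ω, c ω ∂μ) := by
  rw [← integral_sub hb hc]
  exact integral_add ha (hb.sub hc)

variable {S A : Type*} [Fintype S] [DecidableEq S] [MeasurableSpace S] [DiscreteMeasurableSpace S]
  [Fintype A] [DecidableEq A] [MeasurableSpace A] [DiscreteMeasurableSpace A]
  [Nonempty S] [Nonempty A]
  {d : ℕ} {Ξ : Type*} [MeasurableSpace Ξ] {M : (Fin d → ℝ) → Ξ → MDP S A}
  {f : (Fin d → ℝ) → (S → A → ℝ) → Ξ → ℝ} {Pξ : Measure Ξ} {U : Set (S → A → ℝ)}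
  {γ lam Lf Sf R K₁ K₂ : ℝ} {ν : S → ℝ} {O : Kernel ((Fin d → ℝ) × Ξ) (Policy S A)}
  {α : ℝ} {x₀ : Fin d → ℝ} {T : ℕ} {Ω : Type*} {mΩ : MeasurableSpace Ω} {μ : Measure Ω}
  [IsProbabilityMeasure μ]
  {ℱ : Filtration ℕ mΩ} {X : ℕ → Ω → Fin d → ℝ} {ξ : ℕ → Ω → Ξ} {πo : ℕ → Ω → Policy S A}
  {z : ℕ → Ω → Draw S A} {τ : Ω → ℕ} {ν_min : ℝ}

theorem rolloutEst_codeQ (x : Fin d → ℝ) (ξ : Ξ) (π : Policy S A) (z : Draw S A) :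
    rolloutEst M γ lam x ξ π (codeQ z).1.2.1 (codeQ z).1.2.2 (extendPath (codeQ z).2) =
      rolloutEst M γ lam x ξ π z.TQ z.TQ' z.pQ :=
  rolloutEst_congr M γ lam x ξ π _ _ fun _ hj => extendPath_restrict z.pQ hj

theorem rolloutEst_codeV (x : Fin d → ℝ) (ξ : Ξ) (π : Policy S A) (z : Draw S A) :
    rolloutEst M γ lam x ξ π (codeV z).1.2.1 (codeV z).1.2.2 (extendPath (codeV z).2) =
      rolloutEst M γ lam x ξ π z.TV z.TV' z.pV :=
  rolloutEst_congr M γ lam x ξ π _ _ fun _ hj => extendPath_restrict z.pV hj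

theorem hyperGradEst_apply (x : Fin d → ℝ) (ξ : Ξ) (π : Policy S A) (z : Draw S A) (i : Fin d) :
    hyperGradEst M f γ lam ν x ξ π z i = grad (fun y => f y π.1 ξ) x i +
      1 / (lam * ν z.s) * gradPi (fun ρ => f x ρ ξ) π.1 z.s z.a *
        (rolloutEst M γ lam x ξ π z.TQ z.TQ' z.pQ i -
          rolloutEst M γ lam x ξ π z.TV z.TV' z.pV i) := by
  simp only [hyperGradEst, Pi.add_apply, Pi.smul_apply, Pi.sub_apply, smul_eq_mul]

variable (A) in
/-- A bound for the hypergradient estimator per unit of horizon. -/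
def estBound (γ lam ν_min Lf R K₁ K₂ : ℝ) : ℝ :=
  Lf + 1 / (lam * ν_min) * Lf * rolloutBound A γ lam R K₁ K₂

theorem Regular.abs_importance_le (h : Regular M f Pξ U Lf Sf R K₁ K₂) (hlam : 0 < lam)
    (hν_min : 0 < ν_min) (hν' : ∀ s, ν_min ≤ ν s) (x : Fin d → ℝ) (ξ : Ξ) (π : Policy S A)
    (s : S) (a : A) :
    |1 / (lam * ν s) * gradPi (fun ρ => f x ρ ξ) π.1 s a| ≤ 1 / (lam * ν_min) * Lf := by
  have : Nonempty Ξ := ⟨ξ⟩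
  have hνs : 0 < ν s := hν_min.trans_le (hν' s)
  rw [abs_mul, abs_of_pos (by positivity)]
  refine mul_le_mul ?_ (h.abs_gradPi_f_le h.Lf_nonneg x ξ π s a) (abs_nonneg _) (by positivity)
  exact one_div_le_one_div_of_le (by positivity) (mul_le_mul_of_nonneg_left (hν' s) hlam.le)

theorem Regular.sq_hyperGradEst_le (h : Regular M f Pξ U Lf Sf R K₁ K₂) (hγ : 0 ≤ γ)
    (hγ1 : γ < 1) (hlam : 0 < lam) (hν_min : 0 < ν_min) (hν' : ∀ s, ν_min ≤ ν s)
    (x : Fin d → ℝ) (ξ : Ξ) (π : Policy S A) (z : Draw S A) (i : Fin d) :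
    hyperGradEst M f γ lam ν x ξ π z i ^ 2 ≤ 2 * estBound A γ lam ν_min Lf R K₁ K₂ ^ 2 *
      ((1 + (z.TQ : ℝ)) ^ 2 + (1 + (z.TV : ℝ)) ^ 2) := by
  have : Nonempty Ξ := ⟨ξ⟩
  have hLf := h.Lf_nonneg
  have hB := h.rolloutBound_nonneg hγ hγ1 hlam
  have h₁ := h.abs_grad_f_le hLf x ξ π i
  have h₂ := h.abs_importance_le hlam hν_min hν' x ξ π z.s z.a
  have h₃ := h.abs_rolloutEst_le hγ hγ1 hlam x ξ π z.TQ z.TQ' z.pQ i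
  have h₄ := h.abs_rolloutEst_le hγ hγ1 hlam x ξ π z.TV z.TV' z.pV i
  have hQ : (0 : ℝ) ≤ z.TQ := Nat.cast_nonneg _
  have hV : (0 : ℝ) ≤ z.TV := Nat.cast_nonneg _
  have h₅ : |rolloutEst M γ lam x ξ π z.TQ z.TQ' z.pQ i -
      rolloutEst M γ lam x ξ π z.TV z.TV' z.pV i| ≤
      rolloutBound A γ lam R K₁ K₂ * ((1 + z.TQ) + (1 + z.TV)) := by
    rw [mul_add]; exact (abs_sub _ _).trans (add_le_add h₃ h₄)
  have h₆ : |hyperGradEst M f γ lam ν x ξ π z i| ≤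
      estBound A γ lam ν_min Lf R K₁ K₂ * ((1 + z.TQ) + (1 + z.TV)) := by
    rw [hyperGradEst_apply]
    refine (abs_add_le _ _).trans ?_
    rw [estBound, add_mul, mul_assoc _ (rolloutBound A γ lam R K₁ K₂), abs_mul]
    refine add_le_add (h₁.trans ?_) (mul_le_mul h₂ h₅ (abs_nonneg _) (by positivity))
    exact le_mul_of_one_le_right hLf (by linarith)
  calc hyperGradEst M f γ lam ν x ξ π z i ^ 2
      = |hyperGradEst M f γ lam ν x ξ π z i| ^ 2 := (sq_abs _).symm
    _ ≤ (estBound A γ lam ν_min Lf R K₁ K₂ * ((1 + z.TQ) + (1 + z.TV))) ^ 2 :=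
        pow_le_pow_left₀ (abs_nonneg _) h₆ 2
    _ ≤ _ := by
        rw [mul_pow, mul_comm (2 : ℝ), mul_assoc]
        refine mul_le_mul_of_nonneg_left ?_ (sq_nonneg _)
        nlinarith [sq_nonneg ((1 + (z.TQ : ℝ)) - (1 + z.TV))]

namespace IsRun

variable (hrun : IsRun M f γ lam ν Pξ O α x₀ T μ ℱ X ξ πo z τ)
include hrun

/-- The estimator is an increment of the iterates divided by the step size, so its measurability
comes for free from that of the iterates. -/
theorem measurable_hyperGradEst (hα : α ≠ 0) {t : ℕ} (ht : t < T) (i : Fin d) :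
    Measurable fun ω => hyperGradEst M f γ lam ν (X t ω) (ξ t ω) (πo t ω) (z t ω) i := by
  have h₁ : (fun ω => hyperGradEst M f γ lam ν (X t ω) (ξ t ω) (πo t ω) (z t ω) i) =
      fun ω => (X t ω i - X (t + 1) ω i) / α := by
    funext ω
    rw [hrun.X_succ t ht ω, Pi.sub_apply, Pi.smul_apply, smul_eq_mul]
    field_simp
    ring
  rw [h₁]
  exact (((measurable_pi_apply i).comp (hrun.measurable_X t)).sub
    ((measurable_pi_apply i).comp (hrun.measurable_X (t + 1)))).div_const α

theorem integral_sq_hyperGradEst_le (h : Regular M f Pξ U Lf Sf R K₁ K₂) (hγ : 0 ≤ γ)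
    (hγ1 : γ < 1) (hlam : 0 < lam) (hν_min : 0 < ν_min) (hν : ν ∈ stdSimplex ℝ S)
    (hν' : ∀ s, ν_min ≤ ν s) (hα : α ≠ 0) {t : ℕ} (ht : t < T) (i : Fin d) :
    Integrable (fun ω =>
      hyperGradEst M f γ lam ν (X t ω) (ξ t ω) (πo t ω) (z t ω) i ^ 2) μ ∧
    ∫ ω, hyperGradEst M f γ lam ν (X t ω) (ξ t ω) (πo t ω) (z t ω) i ^ 2 ∂μ ≤
      4 * estBound A γ lam ν_min Lf R K₁ K₂ ^ 2 * geoMoment γ := by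
  have hQ : ∫⁻ ω, ENNReal.ofReal ((1 + ((z t ω).TQ : ℝ)) ^ 2) ∂μ = ENNReal.ofReal (geoMoment γ) :=
    h.lintegral_horizon_sq (θ := fun ω => ((X t ω, ξ t ω), πo t ω))
      (Z := fun ω => codeQ (z t ω)) (start := fun _ => startQ) hγ hγ1 hν (fun _ => startQ_mem)
      (fun _ _ => measurable_const) (hrun.measurable_state t) (hrun.measurableSet_codeQ t)
      (hrun.codeQ_law h hγ hγ1 hν ht)
  have hV : ∫⁻ ω, ENNReal.ofReal ((1 + ((z t ω).TV : ℝ)) ^ 2) ∂μ = ENNReal.ofReal (geoMoment γ) :=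
    h.lintegral_horizon_sq (θ := fun ω => ((X t ω, ξ t ω), πo t ω))
      (Z := fun ω => codeV (z t ω)) (start := startV) hγ hγ1 hν startV_mem
      measurable_startV (hrun.measurable_state t) (hrun.measurableSet_codeV t)
      (hrun.codeV_law h hγ hγ1 hν ht)
  have hmQ : Measurable fun ω => (1 + ((z t ω).TQ : ℝ)) ^ 2 :=
    (measurable_from_nat (f := fun n : ℕ => (1 + (n : ℝ)) ^ 2)).comp (hrun.TQ_meas t)
  have hmV : Measurable fun ω => (1 + ((z t ω).TV : ℝ)) ^ 2 :=
    (measurable_from_nat (f := fun n : ℕ => (1 + (n : ℝ)) ^ 2)).comp (hrun.TV_meas t)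
  have hiQ : Integrable (fun ω => (1 + ((z t ω).TQ : ℝ)) ^ 2) μ :=
    (lintegral_ofReal_ne_top_iff_integrable hmQ.aestronglyMeasurable
      (Filter.Eventually.of_forall fun _ => sq_nonneg _)).1 (hQ ▸ ENNReal.ofReal_ne_top)
  have hiV : Integrable (fun ω => (1 + ((z t ω).TV : ℝ)) ^ 2) μ :=
    (lintegral_ofReal_ne_top_iff_integrable hmV.aestronglyMeasurable
      (Filter.Eventually.of_forall fun _ => sq_nonneg _)).1 (hV ▸ ENNReal.ofReal_ne_top)
  have heQ : ∫ ω, (1 + ((z t ω).TQ : ℝ)) ^ 2 ∂μ = geoMoment γ := by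
    rw [integral_eq_lintegral_of_nonneg_ae (Filter.Eventually.of_forall fun _ => sq_nonneg _)
      hmQ.aestronglyMeasurable, hQ, ENNReal.toReal_ofReal (geoMoment_nonneg hγ hγ1)]
  have heV : ∫ ω, (1 + ((z t ω).TV : ℝ)) ^ 2 ∂μ = geoMoment γ := by
    rw [integral_eq_lintegral_of_nonneg_ae (Filter.Eventually.of_forall fun _ => sq_nonneg _)
      hmV.aestronglyMeasurable, hV, ENNReal.toReal_ofReal (geoMoment_nonneg hγ hγ1)]
  have hle := fun ω => h.sq_hyperGradEst_le hγ hγ1 hlam hν_min hν' (X t ω) (ξ t ω) (πo t ω)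
    (z t ω) i
  have hib := (hiQ.add hiV).const_mul (2 * estBound A γ lam ν_min Lf R K₁ K₂ ^ 2)
  have hi := hib.mono' ((hrun.measurable_hyperGradEst hα ht i).pow_const 2).aestronglyMeasurable
    (Filter.Eventually.of_forall fun ω => by
      rw [Real.norm_of_nonneg (sq_nonneg _)]; exact hle ω)
  refine ⟨hi, (integral_mono hi hib hle).trans (le_of_eq ?_)⟩
  simp only [Pi.add_apply]
  rw [integral_const_mul, integral_add hiQ hiV, heQ, heV]
  ring

/-- Testing against functions of the iterate plays the role of conditioning on the past. The
sampling probability `ν s` cancels the importance weight, the first rollout averages to `gradQ` at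
the drawn pair and the second to its policy mean at the drawn state; their difference is the
advantage. -/
theorem integral_mul_hyperGradEst (h : Regular M f Pξ U Lf Sf R K₁ K₂) (hγ : 0 ≤ γ)
    (hγ1 : γ < 1) (hlam : 0 < lam) (hν_min : 0 < ν_min) (hν : ν ∈ stdSimplex ℝ S)
    (hν' : ∀ s, ν_min ≤ ν s) {t : ℕ} (ht : t < T) (i : Fin d) {c : (Fin d → ℝ) → ℝ}
    (hc : Measurable c) {Cc : ℝ} (hCc : ∀ x, |c x| ≤ Cc) :
    Integrable (fun ω =>
      c (X t ω) * hyperGradEst M f γ lam ν (X t ω) (ξ t ω) (πo t ω) (z t ω) i) μ ∧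
    ∫ ω, c (X t ω) * hyperGradEst M f γ lam ν (X t ω) (ξ t ω) (πo t ω) (z t ω) i ∂μ =
      ∫ ω, c (X t ω) * hyperGrad M f γ lam (X t ω) (ξ t ω) (πo t ω) i ∂μ := by
  have hCc0 : 0 ≤ Cc := (abs_nonneg _).trans (hCc 0)
  set u : ((Fin d → ℝ) × Ξ) × Policy S A → S × A → ℝ := fun θ q =>
    c θ.1.1 * (1 / (lam * ν q.1) * gradPi (fun ρ => f θ.1.1 ρ θ.1.2) θ.2.1 q.1 q.2)
  have hu : ∀ q, Measurable fun θ => u θ q := fun q =>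
    (hc.comp (measurable_fst.comp measurable_fst)).mul
      ((h.measurable_gradPi_f q.1 q.2).const_mul _)
  have hCu : ∀ θ q, |u θ q| ≤ Cc * (1 / (lam * ν_min) * Lf) := fun θ q => by
    rw [abs_mul]
    exact mul_le_mul (hCc _) (h.abs_importance_le hlam hν_min hν' _ _ _ _ _) (abs_nonneg _) hCc0
  obtain ⟨q₁, q₂, q₃⟩ := h.integrable_rollout (start := fun _ => startQ) (lam := lam) hγ hγ1 hlam
    hν (fun _ => startQ_mem) (fun _ _ => measurable_const) (hrun.measurable_state t)
    (hrun.measurableSet_codeQ t) (hrun.codeQ_law h hγ hγ1 hν ht) hu hCu i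
  obtain ⟨v₁, v₂, v₃⟩ := h.integrable_rollout (start := startV) (lam := lam) hγ hγ1 hlam hν
    startV_mem measurable_startV (hrun.measurable_state t)
    (hrun.measurableSet_codeV t) (hrun.codeV_law h hγ hγ1 hν ht) hu hCu i
  simp only [rolloutEst_codeQ, rolloutEst_codeV] at q₁ q₃ v₁ v₃
  simp only [sum_startQ_mul, sum_startV_mul] at q₂ q₃ v₂ v₃
  have hf : Integrable (fun ω => c (X t ω) * grad (fun y => f y (πo t ω).1 (ξ t ω)) (X t ω) i)
      μ := by
    refine Integrable.of_bound (C := Cc * Lf) (Measurable.aestronglyMeasurable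
      (Measurable.comp (g := fun θ : ((Fin d → ℝ) × Ξ) × Policy S A =>
        c θ.1.1 * grad (fun y => f y θ.2.1 θ.1.2) θ.1.1 i)
        (f := fun ω => ((X t ω, ξ t ω), πo t ω))
        ((hc.comp (measurable_fst.comp measurable_fst)).mul (h.measurable_grad_f i))
        (hrun.measurable_state t))) (Filter.Eventually.of_forall fun ω => ?_)
    have : Nonempty Ξ := ⟨ξ t ω⟩
    rw [norm_mul]
    exact mul_le_mul (hCc _) (h.abs_grad_f_le h.Lf_nonneg _ _ _ i) (norm_nonneg _) hCc0
  have e₁ : ∀ ω, c (X t ω) * hyperGradEst M f γ lam ν (X t ω) (ξ t ω) (πo t ω) (z t ω) i =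
      c (X t ω) * grad (fun y => f y (πo t ω).1 (ξ t ω)) (X t ω) i +
      (u ((X t ω, ξ t ω), πo t ω) (codeQ (z t ω)).1.1 * rolloutEst M γ lam (X t ω) (ξ t ω) (πo t ω)
        (z t ω).TQ (z t ω).TQ' (z t ω).pQ i -
      u ((X t ω, ξ t ω), πo t ω) (codeV (z t ω)).1.1 * rolloutEst M γ lam (X t ω) (ξ t ω) (πo t ω)
        (z t ω).TV (z t ω).TV' (z t ω).pV i) := fun ω => by
    rw [hyperGradEst_apply]
    simp only [u, codeQ, codeV]
    ring
  have e₂ : ∀ ω, c (X t ω) * hyperGrad M f γ lam (X t ω) (ξ t ω) (πo t ω) i =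
      c (X t ω) * grad (fun y => f y (πo t ω).1 (ξ t ω)) (X t ω) i +
      (∑ q : S × A, ν q.1 * (πo t ω).1 q.1 q.2 * u ((X t ω, ξ t ω), πo t ω) q *
        gradQ M γ lam (X t ω) (ξ t ω) (πo t ω) i q -
      ∑ q : S × A, ν q.1 * (πo t ω).1 q.1 q.2 * u ((X t ω, ξ t ω), πo t ω) q *
        ∑ b, (πo t ω).1 q.1 b * gradQ M γ lam (X t ω) (ξ t ω) (πo t ω) i (q.1, b)) := fun ω => by
    rw [hyperGrad, mul_add, ← Finset.sum_sub_distrib, Fintype.sum_prod_type, Finset.mul_sum]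
    congr 1
    refine Finset.sum_congr rfl fun s _ => ?_
    rw [Finset.mul_sum]
    refine Finset.sum_congr rfl fun a _ => ?_
    have hνs : ν s ≠ 0 := (hν_min.trans_le (hν' s)).ne'
    simp only [u]
    field_simp
  simp only [e₁, e₂]
  refine ⟨hf.add (q₁.sub v₁), ?_⟩
  rw [integral_add_sub hf q₁ v₁, integral_add_sub hf q₂ v₂, q₃, v₃]

end IsRun

end Estimator

/-! ### Oracle error, bias and the random output. -/

section Bias

variable {S A : Type*} [Fintype S] [DecidableEq S] [MeasurableSpace S] [DiscreteMeasurableSpace S]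
  [Fintype A] [DecidableEq A] [MeasurableSpace A] [DiscreteMeasurableSpace A]
  [Nonempty S] [Nonempty A]
  {d : ℕ} {Ξ : Type*} [MeasurableSpace Ξ] {M : (Fin d → ℝ) → Ξ → MDP S A}
  {f : (Fin d → ℝ) → (S → A → ℝ) → Ξ → ℝ} {Pξ : Measure Ξ} [IsProbabilityMeasure Pξ]
  {U : Set (S → A → ℝ)}
  {γ lam Lf Sf R K₁ K₂ : ℝ} {ν : S → ℝ} {O : Kernel ((Fin d → ℝ) × Ξ) (Policy S A)}
  [IsMarkovKernel O]
  {α δ : ℝ} {x₀ : Fin d → ℝ} {T : ℕ} {Ω : Type*} {mΩ : MeasurableSpace Ω} {μ : Measure Ω}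
  [IsProbabilityMeasure μ]
  {ℱ : Filtration ℕ mΩ} {X : ℕ → Ω → Fin d → ℝ} {ξ : ℕ → Ω → Ξ} {πo : ℕ → Ω → Policy S A}
  {z : ℕ → Ω → Draw S A} {τ : Ω → ℕ} {ν_min : ℝ}

theorem Regular.measurable_oracleError (h : Regular M f Pξ U Lf Sf R K₁ K₂) (hγ : 0 ≤ γ)
    (hγ1 : γ < 1) (hlam : 0 < lam) : Measurable fun θ : ((Fin d → ℝ) × Ξ) × Policy S A =>
      ‖((M θ.1.1 θ.1.2).optPolicy γ lam).1 - θ.2.1‖ := by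
  have h₁ : Measurable fun θ : ((Fin d → ℝ) × Ξ) × Policy S A =>
      ((M θ.1.1 θ.1.2).optPolicy γ lam).1 :=
    measurable_subtype_coe.comp (Measurable.comp
      (g := fun z : (Fin d → ℝ) × Ξ => (M z.1 z.2).optPolicy γ lam)
      (f := fun θ : ((Fin d → ℝ) × Ξ) × Policy S A => θ.1)
      (h.measurable_optPolicy hγ hγ1 hlam) measurable_fst)
  exact (h₁.sub (measurable_subtype_coe.comp measurable_snd)).norm

namespace IsRun

variable (hrun : IsRun M f γ lam ν Pξ O α x₀ T μ ℱ X ξ πo z τ)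
include hrun

theorem measurable_pair (t : ℕ) : Measurable fun ω => (X t ω, ξ t ω) :=
  (hrun.measurable_X t).prodMk (hrun.ξ_meas t)

theorem map_context {t : ℕ} (ht : t < T) :
    μ.map (fun ω => (X t ω, ξ t ω)) = (μ.map (X t)).prod Pξ := by
  have : IsProbabilityMeasure (μ.map (X t)) :=
    Measure.isProbabilityMeasure_map (hrun.measurable_X t).aemeasurable
  refine (Measure.prod_eq fun s B hs hB => ?_).symm
  rw [Measure.map_apply (hrun.measurable_pair t) (hs.prod hB),
    Measure.map_apply (hrun.measurable_X t) hs]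
  exact hrun.ξ_law t ht _ (hrun.X_meas t hs) B hB

theorem map_state {t : ℕ} (ht : t < T) :
    μ.map (fun ω => ((X t ω, ξ t ω), πo t ω)) = (μ.map fun ω => (X t ω, ξ t ω)) ⊗ₘ O := by
  have : IsProbabilityMeasure (μ.map fun ω => (X t ω, ξ t ω)) :=
    Measure.isProbabilityMeasure_map (hrun.measurable_pair t).aemeasurable
  refine Measure.ext_prod fun {s B} hs hB => ?_
  rw [Measure.map_apply (hrun.measurable_state t) (hs.prod hB),
    Measure.compProd_apply_prod hs hB,
    setLIntegral_map hs (O.measurable_coe hB) (hrun.measurable_pair t)]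
  exact hrun.πo_law t ht _ (hrun.measurable_context t hs) B hB

/-- The context is independent of the iterate, so Fubini integrates it out first, and the inner
integral is a partial derivative of the objective. -/
theorem integral_mul_hyperGrad_optPolicy (h : Regular M f Pξ U Lf Sf R K₁ K₂) (hγ : 0 ≤ γ)
    (hγ1 : γ < 1) (hlam : 0 < lam) {t : ℕ} (ht : t < T) (i : Fin d) {c : (Fin d → ℝ) → ℝ}
    (hc : Measurable c) {Cc : ℝ} (hCc : ∀ x, |c x| ≤ Cc) :
    ∫ ω, c (X t ω) *
      hyperGrad M f γ lam (X t ω) (ξ t ω) ((M (X t ω) (ξ t ω)).optPolicy γ lam) i ∂μ =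
      ∫ ω, c (X t ω) * grad (leaderObj M f γ lam Pξ) (X t ω) i ∂μ := by
  have : IsProbabilityMeasure (μ.map (X t)) :=
    Measure.isProbabilityMeasure_map (hrun.measurable_X t).aemeasurable
  set Φ : (Fin d → ℝ) × Ξ → ℝ := fun q =>
    c q.1 * hyperGrad M f γ lam q.1 q.2 ((M q.1 q.2).optPolicy γ lam) i
  have hΦ : Measurable Φ :=
    (hc.comp measurable_fst).mul (h.measurable_hyperGrad_optPolicy hγ hγ1 hlam i)
  have hΦi : Integrable Φ ((μ.map (X t)).prod Pξ) := by
    refine Integrable.of_bound (C := Cc * hyperGradBound S A γ lam Lf R K₁ K₂)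
      hΦ.aestronglyMeasurable (Filter.Eventually.of_forall fun q => ?_)
    rw [norm_mul]
    exact mul_le_mul (hCc _) (h.abs_hyperGrad_le hγ hγ1 hlam _ _ _ i) (norm_nonneg _)
      ((abs_nonneg _).trans (hCc 0))
  have h₁ : ∀ x, ∫ y, Φ (x, y) ∂Pξ = c x * grad (leaderObj M f γ lam Pξ) x i := fun x => by
    rw [h.grad_leaderObj hγ hγ1 hlam x i, ← integral_const_mul]
  have hm : AEStronglyMeasurable (fun x => c x * grad (leaderObj M f γ lam Pξ) x i)
      (μ.map (X t)) := by
    simp only [← h₁]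
    exact hΦi.integral_prod_left.aestronglyMeasurable
  calc ∫ ω, Φ (X t ω, ξ t ω) ∂μ = ∫ q, Φ q ∂(μ.map fun ω => (X t ω, ξ t ω)) :=
        (integral_map (hrun.measurable_pair t).aemeasurable hΦ.aestronglyMeasurable).symm
    _ = ∫ x, c x * grad (leaderObj M f γ lam Pξ) x i ∂(μ.map (X t)) := by
        rw [hrun.map_context ht, integral_prod _ hΦi]
        simp only [h₁]
    _ = _ := integral_map (hrun.measurable_X t).aemeasurable hm

theorem integral_oracleError_le (h : Regular M f Pξ U Lf Sf R K₁ K₂) (hγ : 0 ≤ γ)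
    (hγ1 : γ < 1) (hlam : 0 < lam) (hδ : 0 ≤ δ) (hO : OracleAccuracy M γ lam O δ) {t : ℕ}
    (ht : t < T) :
    Integrable (fun ω => ‖((M (X t ω) (ξ t ω)).optPolicy γ lam).1 - (πo t ω).1‖) μ ∧
    ∫ ω, ‖((M (X t ω) (ξ t ω)).optPolicy γ lam).1 - (πo t ω).1‖ ∂μ ≤ δ := by
  set E : ((Fin d → ℝ) × Ξ) × Policy S A → ℝ := fun θ =>
    ‖((M θ.1.1 θ.1.2).optPolicy γ lam).1 - θ.2.1‖
  have hE : Measurable E := h.measurable_oracleError hγ hγ1 hlam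
  have hE1 : ∀ θ, E θ ≤ 1 := fun θ => norm_policy_sub_le _ _
  have hE0 : ∀ θ, 0 ≤ E θ := fun θ => norm_nonneg _
  have : IsProbabilityMeasure (μ.map fun ω => (X t ω, ξ t ω)) :=
    Measure.isProbabilityMeasure_map (hrun.measurable_pair t).aemeasurable
  set N : Ω → ℝ := fun ω => E ((X t ω, ξ t ω), πo t ω)
  have hN : Integrable N μ :=
    Integrable.of_bound (C := 1) (hE.comp (hrun.measurable_state t)).aestronglyMeasurable
      (Filter.Eventually.of_forall fun ω => by rw [Real.norm_of_nonneg (hE0 _)]; exact hE1 _)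
  have hN2 : Integrable (fun ω => N ω ^ 2) μ :=
    Integrable.of_bound (C := 1)
      ((hE.comp (hrun.measurable_state t)).pow_const 2).aestronglyMeasurable
      (Filter.Eventually.of_forall fun ω => by
        rw [Real.norm_of_nonneg (sq_nonneg _)]; exact pow_le_one₀ (hE0 _) (hE1 _))
  have hsq : ∫ ω, N ω ^ 2 ∂μ ≤ δ ^ 2 := by
    have hi : Integrable (fun θ => E θ ^ 2) ((μ.map fun ω => (X t ω, ξ t ω)) ⊗ₘ O) :=
      Integrable.of_bound (C := 1) (hE.pow_const 2).aestronglyMeasurable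
        (Filter.Eventually.of_forall fun ω => by
          rw [Real.norm_of_nonneg (sq_nonneg _)]; exact pow_le_one₀ (hE0 _) (hE1 _))
    calc ∫ ω, N ω ^ 2 ∂μ = ∫ θ, E θ ^ 2 ∂(μ.map fun ω => ((X t ω, ξ t ω), πo t ω)) :=
          (integral_map (hrun.measurable_state t).aemeasurable
            (hE.pow_const 2).aestronglyMeasurable).symm
      _ = ∫ q, ∫ π, E (q, π) ^ 2 ∂(O q) ∂(μ.map fun ω => (X t ω, ξ t ω)) := by
          rw [hrun.map_state ht, Measure.integral_compProd hi]
      _ ≤ ∫ q, δ ^ 2 ∂(μ.map fun ω => (X t ω, ξ t ω)) :=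
          integral_mono_of_nonneg
            (Filter.Eventually.of_forall fun q => integral_nonneg fun π => sq_nonneg _)
            (integrable_const _) (Filter.Eventually.of_forall fun q => hO q.1 q.2)
      _ = δ ^ 2 := by simp
  refine ⟨hN, abs_le_of_sq_le_sq' ?_ hδ |>.2⟩
  refine le_trans ?_ hsq
  -- Nonnegativity of the variance passes from the mean square error to the mean error.
  set a := ∫ ω, N ω ∂μ
  have h₁ : 0 ≤ ∫ ω, (N ω - a) ^ 2 ∂μ := integral_nonneg fun ω => sq_nonneg _
  have h₂ : ∀ ω, (N ω - a) ^ 2 = a ^ 2 + (N ω ^ 2 - 2 * a * N ω) := fun ω => by ring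
  simp only [h₂] at h₁
  rw [integral_add_sub (integrable_const _) hN2 (hN.const_mul _), integral_const_mul] at h₁
  simp only [integral_const, probReal_univ, one_smul] at h₁
  change a ^ 2 ≤ _
  have : ∫ ω, N ω ∂μ = a := rfl
  rw [this] at h₁
  linarith

/-- The bias of the hypergradient estimator. -/
theorem integral_mul_grad_sub_le (h : Regular M f Pξ U Lf Sf R K₁ K₂) (hγ : 0 ≤ γ)
    (hγ1 : γ < 1) (hlam : 0 < lam) (hν_min : 0 < ν_min) (hν : ν ∈ stdSimplex ℝ S)
    (hν' : ∀ s, ν_min ≤ ν s) (hδ : 0 ≤ δ) (hO : OracleAccuracy M γ lam O δ) {t : ℕ}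
    (ht : t < T) (i : Fin d) {c : (Fin d → ℝ) → ℝ}
    (hc : Measurable c) {Cc : ℝ} (hCc : ∀ x, |c x| ≤ Cc) :
    ∫ ω, c (X t ω) * grad (leaderObj M f γ lam Pξ) (X t ω) i ∂μ -
      Cc * (hyperGradLip S A γ lam Lf Sf R K₁ K₂ * δ) ≤
    ∫ ω, c (X t ω) * hyperGradEst M f γ lam ν (X t ω) (ξ t ω) (πo t ω) (z t ω) i ∂μ := by
  obtain ⟨hN, hNδ⟩ := hrun.integral_oracleError_le h hγ hγ1 hlam hδ hO ht
  have hCc0 : 0 ≤ Cc := (abs_nonneg _).trans (hCc 0)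
  have : Nonempty Ξ := nonempty_of_isProbabilityMeasure Pξ
  have hL := h.hyperGradLip_nonneg hγ1 hlam
  rw [(hrun.integral_mul_hyperGradEst h hγ hγ1 hlam hν_min hν hν' ht i hc hCc).2,
    ← hrun.integral_mul_hyperGrad_optPolicy h hγ hγ1 hlam ht i hc hCc]
  have hcX : Measurable fun ω => c (X t ω) := hc.comp (hrun.measurable_X t)
  have hbd : ∀ x ξ π, |c x * hyperGrad M f γ lam x ξ π i| ≤
      Cc * hyperGradBound S A γ lam Lf R K₁ K₂ := fun x ξ π => by
    rw [abs_mul]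
    exact mul_le_mul (hCc _) (h.abs_hyperGrad_le hγ hγ1 hlam _ _ _ i) (abs_nonneg _) hCc0
  have i₁ : Integrable (fun ω => c (X t ω) *
      hyperGrad M f γ lam (X t ω) (ξ t ω) ((M (X t ω) (ξ t ω)).optPolicy γ lam) i) μ :=
    Integrable.of_bound (hcX.mul (Measurable.comp
      (g := fun z : (Fin d → ℝ) × Ξ => hyperGrad M f γ lam z.1 z.2 ((M z.1 z.2).optPolicy γ lam) i)
      (h.measurable_hyperGrad_optPolicy hγ hγ1 hlam i)
      (hrun.measurable_pair t))).aestronglyMeasurable _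
      (Filter.Eventually.of_forall fun ω => hbd _ _ _)
  have i₂ : Integrable (fun ω => c (X t ω) *
      hyperGrad M f γ lam (X t ω) (ξ t ω) (πo t ω) i) μ :=
    Integrable.of_bound (hcX.mul (Measurable.comp
      (g := fun θ : ((Fin d → ℝ) × Ξ) × Policy S A => hyperGrad M f γ lam θ.1.1 θ.1.2 θ.2 i)
      (h.measurable_hyperGrad hγ hγ1 i) (hrun.measurable_state t))).aestronglyMeasurable _
      (Filter.Eventually.of_forall fun ω => hbd _ _ _)
  rw [sub_le_iff_le_add, ← sub_le_iff_le_add', ← integral_sub i₁ i₂]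
  have i₃ := hN.const_mul (Cc * hyperGradLip S A γ lam Lf Sf R K₁ K₂)
  refine (integral_mono (i₁.sub i₂) i₃ fun ω => ?_).trans ?_
  · simp only [Pi.sub_apply]
    rw [← mul_sub, mul_assoc]
    refine (le_abs_self _).trans ?_
    rw [abs_mul, abs_sub_comm]
    exact mul_le_mul (hCc _) (h.abs_hyperGrad_sub_le hγ hγ1 hlam _ _ _ i) (abs_nonneg _) hCc0
  · rw [integral_const_mul, ← mul_assoc]
    exact mul_le_mul_of_nonneg_left hNδ (mul_nonneg hCc0 hL)

/-- The output of a run is a uniformly chosen iterate. -/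
theorem integral_output (hT : 0 < T) {Ψ : (Fin d → ℝ) → ℝ} (hΨ : Measurable Ψ) {B : ℝ}
    (hB : ∀ x, |Ψ x| ≤ B) :
    Integrable (fun ω => Ψ (X (τ ω) ω)) μ ∧
    ∫ ω, Ψ (X (τ ω) ω) ∂μ = (T : ℝ)⁻¹ * ∑ t ∈ Finset.range T, ∫ ω, Ψ (X t ω) ∂μ := by
  have hset : ∀ t, MeasurableSet (τ ⁻¹' {t}) := fun t => hrun.τ_meas (measurableSet_singleton t)
  -- The `T` disjoint events of mass $1/T$ exhaust the probability.
  have hlt : ∀ᵐ ω ∂μ, τ ω < T := by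
    have h₁ : μ (⋃ t ∈ Finset.range T, τ ⁻¹' {t}) = 1 := by
      rw [measure_biUnion_finset (fun a _ b _ hab => Disjoint.preimage _ (by simpa using hab))
        fun t _ => hset t, Finset.sum_congr rfl fun t ht => hrun.τ_unif t (Finset.mem_range.1 ht)]
      rw [Finset.sum_const, Finset.card_range, nsmul_eq_mul]
      exact ENNReal.mul_inv_cancel (by exact_mod_cast hT.ne') (ENNReal.natCast_ne_top T)
    have h₂ := (prob_compl_eq_zero_iff (Finset.measurableSet_biUnion _ fun t _ => hset t)).2 h₁
    filter_upwards [measure_eq_zero_iff_ae_notMem.1 h₂] with ω hω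
    simpa using hω
  have hae : (fun ω => Ψ (X (τ ω) ω)) =ᵐ[μ] fun ω => ∑ t ∈ Finset.range T,
      (({t} : Set ℕ).indicator (fun _ => (1 : ℝ)) (τ ω) * Ψ (X t ω)) := by
    filter_upwards [hlt] with ω hω
    rw [Finset.sum_eq_single_of_mem (τ ω) (Finset.mem_range.2 hω) fun t _ ht => ?_]
    · simp
    · simp [Ne.symm ht]
  have hmeas : ∀ t, Measurable fun ω => Ψ (X t ω) := fun t => hΨ.comp (hrun.measurable_X t)
  have hind : ∀ t, Measurable fun ω => ({t} : Set ℕ).indicator (fun _ => (1 : ℝ)) (τ ω) := fun t =>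
    (measurable_from_nat (f := ({t} : Set ℕ).indicator fun _ => (1 : ℝ))).comp hrun.τ_meas
  have hint : ∀ t, Integrable
      (fun ω => ({t} : Set ℕ).indicator (fun _ => (1 : ℝ)) (τ ω) * Ψ (X t ω)) μ := fun t => by
    refine Integrable.of_bound (C := 1 * B) ((hind t).mul (hmeas t)).aestronglyMeasurable
      (Filter.Eventually.of_forall fun ω => ?_)
    rw [norm_mul]
    refine mul_le_mul ?_ (hB _) (norm_nonneg _) zero_le_one
    by_cases hω : τ ω = t <;> simp [hω]
  refine ⟨(integrable_finsetSum _ fun t _ => hint t).congr hae.symm, ?_⟩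
  rw [integral_congr_ae hae, integral_finsetSum _ fun t _ => hint t, Finset.mul_sum]
  refine Finset.sum_congr rfl fun t ht => ?_
  have ht' := Finset.mem_range.1 ht
  have h₁ := hrun.τ_indep.integral_fun_comp_mul_comp
    (f := ({t} : Set ℕ).indicator fun _ => (1 : ℝ))
    (g := fun p : Fin T → Fin d → ℝ => Ψ (p ⟨t, ht'⟩)) hrun.τ_meas.aemeasurable
    (measurable_pi_iff.2 fun t : Fin T => hrun.measurable_X t).aemeasurable
    measurable_from_nat.aestronglyMeasurable
    (hΨ.comp (measurable_pi_apply _)).aestronglyMeasurable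
  rw [h₁]
  congr 1
  have h₂ : (fun ω => ({t} : Set ℕ).indicator (fun _ => (1 : ℝ)) (τ ω)) =
      (τ ⁻¹' {t}).indicator fun _ => (1 : ℝ) := rfl
  rw [h₂, integral_indicator_const _ (hset t), Measure.real, hrun.τ_unif t ht']
  simp

end IsRun

end Bias

/-! ### Biased stochastic gradient descent. -/

section Descent

variable {d : ℕ} {F : (Fin d → ℝ) → ℝ} {L G : ℝ}

theorem norm_fderiv_sub_le (hL0 : 0 ≤ L) (hL : ∀ x y, ‖grad F x - grad F y‖ ≤ L * ‖x - y‖)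
    (x y : Fin d → ℝ) : ‖fderiv ℝ F x - fderiv ℝ F y‖ ≤ d * (L * ‖x - y‖) := by
  have h₁ : fderiv ℝ F x - fderiv ℝ F y = gradCLM (grad F x - grad F y) := by
    rw [eq_gradCLM (fderiv ℝ F x - fderiv ℝ F y)]; rfl
  rw [h₁]
  exact norm_gradCLM_le (by positivity) fun i => abs_le_of_norm_le (hL x y) i

/-- Mean value inequality for `F` minus its linearization at `x`, on the ball of radius $\|y-x\|$.
The factor `d` comes from bounding a linear form by its entries in the sup norm; a sharper constant
$1/2$ is not needed. -/
theorem le_add_sum_grad_mul (hF : Differentiable ℝ F) (hL0 : 0 ≤ L)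
    (hL : ∀ x y, ‖grad F x - grad F y‖ ≤ L * ‖x - y‖) (x y : Fin d → ℝ) :
    F y ≤ F x + ∑ i, grad F x i * (y - x) i + d * L * ‖y - x‖ ^ 2 := by
  have h₁ := (convex_closedBall x ‖y - x‖).norm_image_sub_le_of_norm_fderiv_le' (𝕜 := ℝ) (f := F)
    (φ := fderiv ℝ F x) (C := d * (L * ‖y - x‖)) (x := x) (y := y)
    (fun w _ => hF w) (fun w hw => (norm_fderiv_sub_le hL0 hL w x).trans ?_)
    (Metric.mem_closedBall_self (norm_nonneg _)) (by simp [dist_eq_norm])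
  · rw [fderiv_apply_eq_sum_grad] at h₁
    have := (le_abs_self _).trans h₁
    nlinarith
  · rw [Metric.mem_closedBall, dist_eq_norm] at hw
    gcongr

theorem norm_sq_le_sum_sq (v : Fin d → ℝ) : ‖v‖ ^ 2 ≤ ∑ i, v i ^ 2 := by
  have h₀ : 0 ≤ ∑ i, v i ^ 2 := Finset.sum_nonneg fun i _ => sq_nonneg _
  have h₁ : ‖v‖ ≤ √(∑ i, v i ^ 2) := by
    refine (pi_norm_le_iff_of_nonneg (Real.sqrt_nonneg _)).2 fun i => ?_
    refine Real.abs_le_sqrt ?_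
    exact Finset.single_le_sum (f := fun i => v i ^ 2) (fun i _ => sq_nonneg _) (Finset.mem_univ i)
  calc ‖v‖ ^ 2 ≤ √(∑ i, v i ^ 2) ^ 2 := pow_le_pow_left₀ (norm_nonneg _) h₁ 2
    _ = _ := Real.sq_sqrt h₀

theorem abs_sub_le_of_abs_grad_le (hF : Differentiable ℝ F) (hG0 : 0 ≤ G)
    (hG : ∀ x i, |grad F x i| ≤ G) (x y : Fin d → ℝ) : |F y - F x| ≤ d * G * ‖y - x‖ :=
  convex_univ.norm_image_sub_le_of_norm_fderiv_le (𝕜 := ℝ) (fun w _ => hF w)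
    (fun w _ => by
      rw [eq_gradCLM (fderiv ℝ F w)]
      exact norm_gradCLM_le hG0 fun i => hG w i) (Set.mem_univ x) (Set.mem_univ y)

/-- Convergence of stochastic gradient descent with biased gradients, in terms of the second
moment `m₂` and of the bias `b` of the gradient estimator. -/
theorem sum_integral_sq_grad_le {Ω : Type*} {mΩ : MeasurableSpace Ω} {μ : Measure Ω}
    [IsProbabilityMeasure μ] {X V : ℕ → Ω → Fin d → ℝ} {x₀ : Fin d → ℝ} {α Δ b m₂ : ℝ} {T : ℕ}
    (hF : Differentiable ℝ F) (hL0 : 0 ≤ L)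
    (hL : ∀ x y, ‖grad F x - grad F y‖ ≤ L * ‖x - y‖)
    (hG0 : 0 ≤ G) (hG : ∀ x i, |grad F x i| ≤ G) (hΔ : ∀ x, F x₀ - F x ≤ Δ) (hα : 0 < α)
    (hX : ∀ t, Measurable (X t)) (hX0 : ∀ ω, X 0 ω = x₀)
    (hXs : ∀ t < T, ∀ ω, X (t + 1) ω = X t ω - α • V t ω)
    (hV : ∀ t < T, ∀ i, Integrable (fun ω => V t ω i) μ)
    (hV2 : ∀ t < T, ∀ i, Integrable (fun ω => V t ω i ^ 2) μ)
    (hm₂ : ∀ t < T, ∀ i, ∫ ω, V t ω i ^ 2 ∂μ ≤ m₂)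
    (hgV : ∀ t < T, ∀ i, Integrable (fun ω => grad F (X t ω) i * V t ω i) μ)
    (hb : ∀ t < T, ∀ i, ∫ ω, grad F (X t ω) i ^ 2 ∂μ - b ≤ ∫ ω, grad F (X t ω) i * V t ω i ∂μ) :
    α * ∑ t ∈ Finset.range T, ∑ i, ∫ ω, grad F (X t ω) i ^ 2 ∂μ ≤
      Δ + T * (α * (d * b) + d ^ 2 * L * α ^ 2 * m₂) := by
  -- `F` need not be bounded above; integrability is propagated along the iterates, because the
  -- bounded gradient controls each increment of `F` by the integrable step.
  have hFX : ∀ t ≤ T, Integrable (fun ω => F (X t ω)) μ := by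
    intro t
    induction t with
    | zero => intro _; simp only [hX0]; exact integrable_const _
    | succ t ih =>
      intro ht
      have h₁ := ih (by omega)
      have h₂ : Integrable (fun ω => d * G * (α * ∑ i, |V t ω i|)) μ :=
        ((integrable_finsetSum _ fun i _ => (hV t (by omega) i).abs).const_mul α).const_mul _
      refine (h₁.abs.add h₂).mono' (hF.continuous.measurable.comp (hX _)).aestronglyMeasurable
        (Filter.Eventually.of_forall fun ω => ?_)
      have h₃ := abs_sub_le_of_abs_grad_le hF hG0 hG (X t ω) (X (t + 1) ω)
      have h₄ : ‖X (t + 1) ω - X t ω‖ ≤ α * ∑ i, |V t ω i| := by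
        rw [hXs t (by omega) ω, sub_sub_cancel_left, norm_neg, norm_smul, Real.norm_of_nonneg hα.le]
        refine mul_le_mul_of_nonneg_left ((pi_norm_le_iff_of_nonneg
          (Finset.sum_nonneg fun i _ => abs_nonneg _)).2 fun i => ?_) hα.le
        exact Finset.single_le_sum (f := fun i => |V t ω i|) (fun i _ => abs_nonneg _)
          (Finset.mem_univ i)
      have h₅ : d * G * ‖X (t + 1) ω - X t ω‖ ≤ d * G * (α * ∑ i, |V t ω i|) :=
        mul_le_mul_of_nonneg_left h₄ (by positivity)
      have h₆ : |F (X (t + 1) ω)| ≤ |F (X t ω)| + |F (X (t + 1) ω) - F (X t ω)| := by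
        have := abs_add_le (F (X t ω)) (F (X (t + 1) ω) - F (X t ω))
        rwa [add_sub_cancel] at this
      simp only [Pi.add_apply, Real.norm_eq_abs]
      linarith
  have hstep : ∀ t < T, ∫ ω, F (X (t + 1) ω) ∂μ ≤ ∫ ω, F (X t ω) ∂μ -
      α * ∑ i, ∫ ω, grad F (X t ω) i ^ 2 ∂μ + (α * (d * b) + d ^ 2 * L * α ^ 2 * m₂) := by
    intro t ht
    have i₁ : Integrable (fun ω => ∑ i, grad F (X t ω) i * V t ω i) μ :=
      integrable_finsetSum _ fun i _ => hgV t ht i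
    have i₂ : Integrable (fun ω => ∑ i, V t ω i ^ 2) μ :=
      integrable_finsetSum _ fun i _ => hV2 t ht i
    have h₁ : ∀ ω, F (X (t + 1) ω) ≤ d * L * α ^ 2 * ∑ i, V t ω i ^ 2 +
        (F (X t ω) - α * ∑ i, grad F (X t ω) i * V t ω i) := fun ω => by
      have h₂ := le_add_sum_grad_mul hF hL0 hL (X t ω) (X (t + 1) ω)
      have h₃ : X (t + 1) ω - X t ω = -(α • V t ω) := by
        rw [hXs t ht ω, sub_sub_cancel_left]
      have h₄ : ∑ i, grad F (X t ω) i * (X (t + 1) ω - X t ω) i =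
          -(α * ∑ i, grad F (X t ω) i * V t ω i) := by
        rw [h₃, Finset.mul_sum, ← Finset.sum_neg_distrib]
        refine Finset.sum_congr rfl fun i _ => ?_
        simp only [Pi.neg_apply, Pi.smul_apply, smul_eq_mul]
        ring
      have h₅ : ‖X (t + 1) ω - X t ω‖ ^ 2 ≤ α ^ 2 * ∑ i, V t ω i ^ 2 := by
        rw [h₃, norm_neg, norm_smul, mul_pow, Real.norm_of_nonneg hα.le]
        exact mul_le_mul_of_nonneg_left (norm_sq_le_sum_sq _) (sq_nonneg _)
      have h₆ := mul_le_mul_of_nonneg_left h₅ (by positivity : 0 ≤ d * L)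
      rw [h₄] at h₂
      linarith
    have h₂ := integral_mono (hFX (t + 1) ht)
      ((i₂.const_mul (d * L * α ^ 2)).add ((hFX t ht.le).sub (i₁.const_mul α))) h₁
    simp only [Pi.add_apply, Pi.sub_apply] at h₂
    rw [integral_add_sub (i₂.const_mul _) (hFX t ht.le) (i₁.const_mul α), integral_const_mul,
      integral_const_mul, integral_finsetSum _ fun i _ => hgV t ht i,
      integral_finsetSum _ fun i _ => hV2 t ht i] at h₂
    have h₃ : ∑ i, ∫ ω, V t ω i ^ 2 ∂μ ≤ d * m₂ :=
      (Finset.sum_le_sum fun i _ => hm₂ t ht i).trans_eq (by simp)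
    have h₄ : ∑ i, ∫ ω, grad F (X t ω) i ^ 2 ∂μ - d * b ≤
        ∑ i, ∫ ω, grad F (X t ω) i * V t ω i ∂μ := by
      refine le_trans (le_of_eq ?_) (Finset.sum_le_sum fun i _ => hb t ht i)
      rw [Finset.sum_sub_distrib]; simp
    have h₅ := mul_le_mul_of_nonneg_left h₃ (by positivity : 0 ≤ d * L * α ^ 2)
    have h₆ := mul_le_mul_of_nonneg_left h₄ hα.le
    linarith
  -- The one-step decreases telescope; the remaining difference of objective values is at most `Δ`.
  have hsum : ∀ n ≤ T, α * ∑ t ∈ Finset.range n, ∑ i, ∫ ω, grad F (X t ω) i ^ 2 ∂μ ≤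
      F x₀ - ∫ ω, F (X n ω) ∂μ + n * (α * (d * b) + d ^ 2 * L * α ^ 2 * m₂) := by
    intro n
    induction n with
    | zero => intro _; simp [hX0]
    | succ n ih =>
      intro hn
      have h₁ := ih (by omega)
      have h₂ := hstep n hn
      rw [Finset.sum_range_succ, mul_add]
      push_cast
      linarith
  have h₁ := hsum T le_rfl
  have h₂ : F x₀ - ∫ ω, F (X T ω) ∂μ ≤ Δ := by
    have h₃ : ∫ ω, (F x₀ - F (X T ω)) ∂μ ≤ ∫ _, Δ ∂μ :=
      integral_mono ((integrable_const _).sub (hFX T le_rfl)) (integrable_const _) fun ω => hΔ _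
    rw [integral_sub (integrable_const _) (hFX T le_rfl)] at h₃
    simpa using h₃
  linarith

end Descent

/-! ### Assembly of the convergence bound. -/

section Convergence

variable {S A : Type*} [Fintype S] [DecidableEq S] [MeasurableSpace S] [DiscreteMeasurableSpace S]
  [Fintype A] [DecidableEq A] [MeasurableSpace A] [DiscreteMeasurableSpace A]
  [Nonempty S] [Nonempty A]
  {d : ℕ} {Ξ : Type*} [MeasurableSpace Ξ] {M : (Fin d → ℝ) → Ξ → MDP S A}
  {f : (Fin d → ℝ) → (S → A → ℝ) → Ξ → ℝ} {Pξ : Measure Ξ} [IsProbabilityMeasure Pξ]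
  {U : Set (S → A → ℝ)}
  {γ lam Lf Sf R K₁ K₂ SF Δ : ℝ} {ν : S → ℝ} {O : Kernel ((Fin d → ℝ) × Ξ) (Policy S A)}
  [IsMarkovKernel O]
  {α δ : ℝ} {x₀ : Fin d → ℝ} {T : ℕ} {Ω : Type*} {mΩ : MeasurableSpace Ω} {μ : Measure Ω}
  [IsProbabilityMeasure μ]
  {ℱ : Filtration ℕ mΩ} {X : ℕ → Ω → Fin d → ℝ} {ξ : ℕ → Ω → Ξ} {πo : ℕ → Ω → Policy S A}
  {z : ℕ → Ω → Draw S A} {τ : Ω → ℕ} {ν_min : ℝ}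

variable (S A d) in
/-- The coefficient of the oracle error in the convergence bound. -/
def biasConst (γ lam Lf Sf R K₁ K₂ : ℝ) : ℝ :=
  d * (hyperGradBound S A γ lam Lf R K₁ K₂ * hyperGradLip S A γ lam Lf Sf R K₁ K₂)

variable (A d) in
/-- The coefficient of the step size in the convergence bound. -/
def varianceConst (γ lam ν_min Lf R K₁ K₂ SF : ℝ) : ℝ :=
  d ^ 2 * |SF| * (4 * estBound A γ lam ν_min Lf R K₁ K₂ ^ 2 * geoMoment γ)

theorem IsRun.integral_sq_grad_output_le (hrun : IsRun M f γ lam ν Pξ O α x₀ T μ ℱ X ξ πo z τ)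
    (h : Regular M f Pξ U Lf Sf R K₁ K₂) (hγ : 0 ≤ γ) (hγ1 : γ < 1) (hlam : 0 < lam)
    (hν_min : 0 < ν_min) (hν : ν ∈ stdSimplex ℝ S) (hν' : ∀ s, ν_min ≤ ν s)
    (hSF : ∀ x y, ‖grad (leaderObj M f γ lam Pξ) x - grad (leaderObj M f γ lam Pξ) y‖ ≤
      SF * ‖x - y‖)
    (hΔ : ∀ x, leaderObj M f γ lam Pξ x₀ - leaderObj M f γ lam Pξ x ≤ Δ)
    (hδ : 0 ≤ δ) (hO : OracleAccuracy M γ lam O δ) (hα : 0 < α) (hT : 0 < T) :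
    Integrable (fun ω =>
      ‖WithLp.toLp 2 (grad (leaderObj M f γ lam Pξ) (X (τ ω) ω))‖ ^ 2) μ ∧
    ∫ ω, ‖WithLp.toLp 2 (grad (leaderObj M f γ lam Pξ) (X (τ ω) ω))‖ ^ 2 ∂μ ≤
      Δ * (1 / (α * T)) + biasConst S A d γ lam Lf Sf R K₁ K₂ * δ +
        varianceConst A d γ lam ν_min Lf R K₁ K₂ SF * α := by
  have : Nonempty Ξ := nonempty_of_isProbabilityMeasure Pξ
  set F := leaderObj M f γ lam Pξ
  have hF : Differentiable ℝ F := fun x =>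
    (h.hasFDerivAt_leaderObj hγ hγ1 hlam x).differentiableAt
  have hG : ∀ x i, |grad F x i| ≤ hyperGradBound S A γ lam Lf R K₁ K₂ :=
    h.abs_grad_leaderObj_le hγ hγ1 hlam
  have hG0 := h.hyperGradBound_nonneg hγ1 hlam
  -- No sign of `SF` is assumed, and none follows when `d = 0`; the absolute value provides a
  -- nonnegative constant.
  have hL : ∀ x y, ‖grad F x - grad F y‖ ≤ |SF| * ‖x - y‖ := fun x y =>
    (hSF x y).trans (mul_le_mul_of_nonneg_right (le_abs_self _) (norm_nonneg _))
  have hg : Measurable fun x => grad F x :=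
    (LipschitzWith.of_dist_le_mul (K := Real.toNNReal |SF|) fun x y => by
      rw [dist_eq_norm, dist_eq_norm, Real.coe_toNNReal _ (abs_nonneg _)]
      exact hL x y).continuous.measurable
  have hgi : ∀ i, Measurable fun x => grad F x i := fun i => (measurable_pi_apply i).comp hg
  have hmain := sum_integral_sq_grad_le (μ := μ) (X := X) (x₀ := x₀)
    (V := fun t ω => hyperGradEst M f γ lam ν (X t ω) (ξ t ω) (πo t ω) (z t ω))
    (b := hyperGradBound S A γ lam Lf R K₁ K₂ * (hyperGradLip S A γ lam Lf Sf R K₁ K₂ * δ))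
    (m₂ := 4 * estBound A γ lam ν_min Lf R K₁ K₂ ^ 2 * geoMoment γ)
    hF (abs_nonneg SF) hL hG0 hG hΔ hα hrun.measurable_X hrun.X_zero hrun.X_succ
    (fun t ht i => by
      simpa using (hrun.integral_mul_hyperGradEst h hγ hγ1 hlam hν_min hν hν' ht i
        (c := fun _ => 1) measurable_const (Cc := 1) (by simp)).1)
    (fun t ht i =>
      (hrun.integral_sq_hyperGradEst_le h hγ hγ1 hlam hν_min hν hν' hα.ne' ht i).1)
    (fun t ht i =>
      (hrun.integral_sq_hyperGradEst_le h hγ hγ1 hlam hν_min hν hν' hα.ne' ht i).2)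
    (fun t ht i =>
      (hrun.integral_mul_hyperGradEst h hγ hγ1 hlam hν_min hν hν' ht i (hgi i)
        (fun x => hG x i)).1)
    (fun t ht i => by
      simpa only [sq] using hrun.integral_mul_grad_sub_le h hγ hγ1 hlam hν_min hν hν' hδ hO ht i
        (hgi i) fun x => hG x i)
  simp only [EuclideanSpace.real_norm_sq_eq]
  have hsq : ∀ x i, |grad F x i ^ 2| ≤ hyperGradBound S A γ lam Lf R K₁ K₂ ^ 2 := fun x i => by
    rw [abs_pow]; exact pow_le_pow_left₀ (abs_nonneg _) (hG x i) 2
  obtain ⟨hi, he⟩ := hrun.integral_output hT (Ψ := fun x => ∑ i, grad F x i ^ 2)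
    (Finset.measurable_fun_sum _ fun i _ => (hgi i).pow_const 2)
    (B := ∑ _i : Fin d, hyperGradBound S A γ lam Lf R K₁ K₂ ^ 2)
    fun x => (Finset.abs_sum_le_sum_abs _ _).trans (Finset.sum_le_sum fun i _ => hsq x i)
  refine ⟨hi, ?_⟩
  have he' : ∀ t, ∫ ω, ∑ i, grad F (X t ω) i ^ 2 ∂μ = ∑ i, ∫ ω, grad F (X t ω) i ^ 2 ∂μ := fun t =>
    integral_finsetSum _ fun i _ => Integrable.of_bound
      (((hgi i).pow_const 2).comp (hrun.measurable_X t)).aestronglyMeasurable _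
      (Filter.Eventually.of_forall fun ω => hsq _ i)
  refine he.trans_le ?_
  simp only [he']
  have hT' : (0 : ℝ) < T := by exact_mod_cast hT
  have hαT : 0 < α * T := mul_pos hα hT'
  have h₁ : (T : ℝ)⁻¹ * ∑ t ∈ Finset.range T, ∑ i, ∫ ω, grad F (X t ω) i ^ 2 ∂μ =
      (1 / (α * T)) * (α * ∑ t ∈ Finset.range T, ∑ i, ∫ ω, grad F (X t ω) i ^ 2 ∂μ) := by
    field_simp
  rw [h₁]
  refine (mul_le_mul_of_nonneg_left hmain (by positivity)).trans (le_of_eq ?_)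
  rw [biasConst, varianceConst]
  field_simp
  ring

end Convergence

end HPGD

end

theorem mainTheorem1
    {S A : Type*} [Fintype S] [DecidableEq S] [Nonempty S]
    [MeasurableSpace S] [DiscreteMeasurableSpace S]
    [Fintype A] [DecidableEq A] [Nonempty A]
    [MeasurableSpace A] [DiscreteMeasurableSpace A]
    (d : ℕ) (γ lam : ℝ) (hγ : 0 ≤ γ) (hγ1 : γ < 1) (hlam : 0 < lam)
    (ν_min : ℝ) (hν_min : 0 < ν_min)
    (Lf Sf R K₁ K₂ SF Δ : ℝ) :
    ∃ C : ℝ, 0 ≤ C ∧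
      ∀ {Ξ : Type*} [MeasurableSpace Ξ] (Pξ : Measure Ξ) [IsProbabilityMeasure Pξ]
        (M : (Fin d → ℝ) → Ξ → HPGD.MDP S A)
        (f : (Fin d → ℝ) → (S → A → ℝ) → Ξ → ℝ) (U : Set (S → A → ℝ))
        (_ : HPGD.Regular M f Pξ U Lf Sf R K₁ K₂)
        -- smoothness of the leader's objective and boundedness from below
        (_ : ∀ x y, ‖HPGD.grad (HPGD.leaderObj M f γ lam Pξ) x -
            HPGD.grad (HPGD.leaderObj M f γ lam Pξ) y‖ ≤ SF * ‖x - y‖)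
        (x₀ : Fin d → ℝ)
        (_ : ∀ x, HPGD.leaderObj M f γ lam Pξ x₀ - HPGD.leaderObj M f γ lam Pξ x ≤ Δ)
        (ν : S → ℝ) (_ : ν ∈ stdSimplex ℝ S) (_ : ∀ s, ν_min ≤ ν s),
        Differentiable ℝ (HPGD.leaderObj M f γ lam Pξ) ∧
        ∀ (O : Kernel ((Fin d → ℝ) × Ξ) (HPGD.Policy S A)) [IsMarkovKernel O]
          (δ : ℝ) (_ : 0 ≤ δ) (_ : HPGD.OracleAccuracy M γ lam O δ)
          (α : ℝ) (_ : 0 < α) (_ : 2 * Sf * α ≤ 1) (T : ℕ) (_ : 0 < T)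
          {Ω : Type*} {mΩ : MeasurableSpace Ω} (μ : Measure Ω) [IsProbabilityMeasure μ]
          (ℱ : Filtration ℕ mΩ) (X : ℕ → Ω → Fin d → ℝ) (ξ : ℕ → Ω → Ξ)
          (πo : ℕ → Ω → HPGD.Policy S A) (z : ℕ → Ω → HPGD.Draw S A) (τ : Ω → ℕ)
          (_ : HPGD.IsRun M f γ lam ν Pξ O α x₀ T μ ℱ X ξ πo z τ),
          Integrable (fun ω => ‖WithLp.toLp 2
            (HPGD.grad (HPGD.leaderObj M f γ lam Pξ) (X (τ ω) ω))‖ ^ 2) μ ∧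
          ∫ ω, ‖WithLp.toLp 2
              (HPGD.grad (HPGD.leaderObj M f γ lam Pξ) (X (τ ω) ω))‖ ^ 2 ∂μ
            ≤ C * (1 / (α * T) + δ + α) ∧
          ∀ c₁ c₂ c₃ : ℝ, 0 < c₁ → c₁ / Real.sqrt T ≤ α → α ≤ c₂ / Real.sqrt T →
            δ ≤ c₃ / Real.sqrt T →
            ∫ ω, ‖WithLp.toLp 2
                (HPGD.grad (HPGD.leaderObj M f γ lam Pξ) (X (τ ω) ω))‖ ^ 2 ∂μ
              ≤ C * (1 / c₁ + c₂ + c₃) / Real.sqrt T := by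
  -- The constant is chosen before any problem data are given, so the parameters are arbitrary reals
  -- here; the absolute values in `C` make it nonnegative in every case.
  set b := HPGD.biasConst S A d γ lam Lf Sf R K₁ K₂
  set v := HPGD.varianceConst A d γ lam ν_min Lf R K₁ K₂ SF
  have hC : 0 ≤ |Δ| + |b| + |v| := by positivity
  refine ⟨|Δ| + |b| + |v|, hC, ?_⟩
  intro Ξ _ Pξ _ M f U h hSF x₀ hΔ ν hν hν'
  refine ⟨fun x => (h.hasFDerivAt_leaderObj hγ hγ1 hlam x).differentiableAt, ?_⟩
  intro O _ δ hδ hO α hα _ T hT Ω mΩ μ _ ℱ X ξ πo z τ hrun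
  obtain ⟨hi, hle⟩ := hrun.integral_sq_grad_output_le h hγ hγ1 hlam hν_min hν hν' hSF hΔ hδ hO
    hα hT
  have hT' : (0 : ℝ) < T := by exact_mod_cast hT
  have hinv : 0 ≤ 1 / (α * T) := by positivity
  have hmain := hle.trans (b := _) (c := (|Δ| + |b| + |v|) * (1 / (α * T) + δ + α)) <| by
    have h₁ := mul_le_mul_of_nonneg_right (le_abs_self Δ) hinv
    have h₂ := mul_le_mul_of_nonneg_right (le_abs_self b) hδ
    have h₃ := mul_le_mul_of_nonneg_right (le_abs_self v) hα.le
    have h₄ := mul_nonneg (add_nonneg (abs_nonneg b) (abs_nonneg v)) hinv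
    have h₅ := mul_nonneg (add_nonneg (abs_nonneg Δ) (abs_nonneg v)) hδ
    have h₆ := mul_nonneg (add_nonneg (abs_nonneg Δ) (abs_nonneg b)) hα.le
    linarith
  refine ⟨hi, hmain, fun c₁ c₂ c₃ hc₁ h₁ h₂ h₃ => hmain.trans ?_⟩
  have hs : 0 < Real.sqrt T := Real.sqrt_pos.2 hT'
  -- Multiplying the lower bound on the step size by $T$ gives $c_1\sqrt T\le\alpha T$.
  have h₄ : 1 / (α * T) ≤ 1 / c₁ / Real.sqrt T := by
    rw [div_div]
    refine one_div_le_one_div_of_le (by positivity) ?_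
    have := mul_le_mul_of_nonneg_right h₁ hT'.le
    refine le_trans (le_of_eq ?_) this
    rw [div_mul_eq_mul_div, mul_div_assoc, Real.div_sqrt]
  rw [mul_div_assoc, add_div, add_div]
  exact mul_le_mul_of_nonneg_left (by linarith) hC
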